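/- **Setting.** Let $N\ge 0$ and let $X\subset\mathbb C^N$ be a real-analytic variety through $0$: $0\in X$, and near $0$ the set $X$ is the common zero set of finitely many real-valued real-analytic functions. Let $I_{\mathbb R}(X)$ be the ideal of germs at $0$ of real-valued real-analytic functions vanishing on $X$, and let $\sigma(Z,\bar Z)=(\sigma_1(Z,\bar Z),\dots,\sigma_d(Z,\bar Z))$ be real-valued representatives of generators of $I_{\mathbb R}(X)$ such that $\sigma(Z,\zeta)$ is holomorphic in $B\times B$ for an open ball $B\subset\mathbb C^N$ centered at $0$. Put $$\Sigma_p=\{Z\in B:\sigma(Z,\bar p)=0\}\quad(p\in B),\qquad \mathcal X=\{(Z,\zeta)\in B\times B:\sigma(Z,\zeta)=0\},\qquad E_0^U=\bigcap_{p\in\Sigma_0\cap U}\Sigma_p$$ for an open neighborhood $U\subset B$ of $0$. Thus $\Sigma_p$ is the Segre variety of $X$ at $p$ and $\mathcal X$ is the complexification of $X$. Let $S^*=\{Z:\bar Z\in S\}$. The variety $X$ is called essentially finite at $0$ if the germ of $E_0^U$ at $0$ has dimension $0$ for every open neighborhood $U\subset B$ of $0$. A complex variety through $0$ is a set containing $0$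 which near $0$ is the common zero set of finitely many holomorphic functions. For a set $V\ni 0$ in $\mathbb C^k$, $I_{\mathcal O}(V)$ is the ideal of germs at $0$ of holomorphic functions vanishing on $V$, the dimension of the germ of $V$ at $0$ is the Krull dimension of the quotient of the ring of all germs at $0$ of holomorphic functions by $I_{\mathcal O}(V)$, and $I(V)$ is the ideal generated by (the Taylor series at $0$ of the elements of) $I_{\mathcal O}(V)$ in the ring of formal power series in $k$ variables. The dimension of an ideal $J$ of a ring $R$ is the Krull dimension of $R/J$. **Lemma.** The following are equivalent: (a) $X$ is not essentially finite at $0$. (b) There is a complex variety $\Gamma$ through $0$ in $\mathbb C^N$, of positive dimension at $0$, such that $\Gamma\times\Sigma_0^*\subset\mathcal X$ as germs at $0$. (c) There is an ideal $J\subset\mathbb C[[Z]]$ of positive dimension such that $I(\mathcal X)\subset I(J)+I(\mathbb C^N\times\Sigma_0^*)$ in $\mathbb C[[Z,\zeta]]$, where $I(J)$ is the ideal of $\mathbb C[[Z,\zeta]]$ generated by $J$. (d) There are a nonzero $N$-tuple $\mu=(\mu_1,\dots,\mu_N)$ of formal power series $\mu_j\in\mathbb C[[s]]$ without constant term and an open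 neighborhood $U\subset B$ of $0$ such that, for every $p\in\Sigma_0\cap U$ and every $i$, the formal power series $\sigma_i(\mu(s),\bar p)$, obtained by substituting $\mu$ into the Taylor series of $Z\mapsto\sigma_i(Z,\bar p)$ at $0$, is identically zero. -/

import Mathlib

open Filter Topology

noncomputable section

namespace Segre

section Germs

variable (𝕜 : Type*) [NontriviallyNormedField 𝕜]
variable {E : Type*} [NormedAddCommGroup E] [NormedSpace 𝕜 E]

/-- `S` is (near `0`) a `𝕜`-analytic variety through `0`: it contains `0`, and in some neighbourhood
of `0` it is the common zero set of finitely many `𝕜`-valued `𝕜`-analytic functions.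
For `𝕜 = ℂ` this is a complex analytic variety through `0`, for `𝕜 = ℝ` a real-analytic one. -/
def IsAnalyticVarietyAt (S : Set E) : Prop :=
  (0 : E) ∈ S ∧ ∃ W : Set E, IsOpen W ∧ (0 : E) ∈ W ∧ ∃ (k : ℕ) (f : Fin k → E → 𝕜),
    (∀ j, AnalyticOnNhd 𝕜 (f j) W) ∧ ∀ z ∈ W, (z ∈ S ↔ ∀ j, f j z = 0)

variable (E) in
/-- The ring of germs at `0` of `𝕜`-valued `𝕜`-analytic functions on `E`. For `𝕜 = ℝ` and `E = ℂ^N`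
these are the germs of real-valued real-analytic functions, for `𝕜 = ℂ` the germs of holomorphic
functions. -/
def analyticGerms : Subring (Germ (𝓝 (0 : E)) 𝕜) where
  carrier := {g | ∃ f : E → 𝕜, AnalyticAt 𝕜 f 0 ∧ g = (f : Germ (𝓝 (0 : E)) 𝕜)}
  mul_mem' := by
    rintro _ _ ⟨f, hf, rfl⟩ ⟨g, hg, rfl⟩
    exact ⟨f * g, hf.mul hg, rfl⟩
  one_mem' := ⟨fun _ => 1, analyticAt_const, rfl⟩
  add_mem' := by
    rintro _ _ ⟨f, hf, rfl⟩ ⟨g, hg, rfl⟩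
    exact ⟨f + g, hf.add hg, rfl⟩
  zero_mem' := ⟨fun _ => 0, analyticAt_const, rfl⟩
  neg_mem' := by
    rintro _ ⟨f, hf, rfl⟩
    exact ⟨-f, hf.neg, rfl⟩

/-- The ideal of those germs at `0` of `𝕜`-analytic functions that vanish on (the germ at `0` of)
`S`. -/
def vanishingIdeal (S : Set E) : Ideal (analyticGerms 𝕜 E) where
  carrier := {g | ∃ f : E → 𝕜, (g : Germ (𝓝 (0 : E)) 𝕜) = (f : Germ (𝓝 (0 : E)) 𝕜) ∧
    ∀ᶠ z in 𝓝 (0 : E), z ∈ S → f z = 0}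
  add_mem' := by
    rintro a b ⟨f, hf, hf0⟩ ⟨g, hg, hg0⟩
    refine ⟨f + g, ?_, ?_⟩
    · rw [Subring.coe_add, hf, hg]
      rfl
    · filter_upwards [hf0, hg0] with z h1 h2 hz
      simp [h1 hz, h2 hz]
  zero_mem' := ⟨fun _ => 0, rfl, Eventually.of_forall fun _ _ => rfl⟩
  smul_mem' := by
    rintro c a ⟨f, hf, hf0⟩
    obtain ⟨g, _, hg⟩ := c.2
    refine ⟨g * f, ?_, ?_⟩
    · rw [smul_eq_mul, Subring.coe_mul, hf, hg]
      rfl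
    · filter_upwards [hf0] with z h1 hz
      simp [h1 hz]

end Germs

/-- The dimension at `0` of (the germ at `0` of) a complex variety `S`: the Krull dimension of its
local ring `𝒪₀ / I_𝒪(S)`. It is `⊥` if the germ of `S` is empty. -/
def germDim {E : Type*} [NormedAddCommGroup E] [NormedSpace ℂ E] (S : Set E) : WithBot ℕ∞ :=
  ringKrullDim (analyticGerms ℂ E ⧸ vanishingIdeal ℂ S)

section FormalSeries

variable {ι : Type*} [Fintype ι]

/-- `F` is the Taylor series at `0` of the function `f` of the variables `(z i)`: near `0`, `f` is
the sum of the multiple power series `F`. -/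
def HasTaylorSeries (f : (ι → ℂ) → ℂ) (F : MvPowerSeries ι ℂ) : Prop :=
  ∀ᶠ z in 𝓝 (0 : ι → ℂ),
    HasSum (fun m : ι →₀ ℕ => MvPowerSeries.coeff m F * ∏ i, z i ^ m i) (f z)

/-- The ideal `I(S)` of the ring of formal power series that is generated by (the Taylor series of)
the germs at `0` of holomorphic functions vanishing on `S`. -/
def formalIdeal (S : Set (ι → ℂ)) : Ideal (MvPowerSeries ι ℂ) :=
  Ideal.span {F | ∃ g ∈ vanishingIdeal ℂ S, ∃ f : (ι → ℂ) → ℂ,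
    (g : Germ (𝓝 (0 : ι → ℂ)) ℂ) = (f : Germ (𝓝 (0 : ι → ℂ)) ℂ) ∧ HasTaylorSeries f F}

end FormalSeries

variable {N : ℕ}

/-- The open Euclidean ball of radius `r` about `0` in `ℂ^N`. -/
def ball (N : ℕ) (r : ℝ) : Set (Fin N → ℂ) := {Z | ∑ i, ‖Z i‖ ^ 2 < r ^ 2}

/-- The product `S × T ⊆ ℂ^N × ℂ^N`. A point `(Z, ζ)` of `ℂ^N × ℂ^N` is written
`Sum.elim Z ζ`, the `inl` coordinates being `Z` and the `inr` coordinates being `ζ`. -/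
def prodSet (S T : Set (Fin N → ℂ)) : Set (Fin N ⊕ Fin N → ℂ) :=
  {w | w ∘ Sum.inl ∈ S ∧ w ∘ Sum.inr ∈ T}

/-- The complex conjugate `S^* = {Z | Z̄ ∈ S}` of a set. -/
def conjSet (S : Set (Fin N → ℂ)) : Set (Fin N → ℂ) := {Z | star Z ∈ S}

/-- `σ(Z, Z̄) = (σ₁(Z, Z̄), …, σ_d(Z, Z̄))` are representatives of generators of the ideal `I_ℝ(X)` of
germs at `0` of real-valued real-analytic functions vanishing on `X`, and the functions `σ(Z, ζ)`
are holomorphic in `B × B`, `B` being the ball of radius `r` about `0`. -/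
structure IsGenerators (X : Set (Fin N → ℂ)) (r : ℝ) {d : ℕ}
    (σ : Fin d → (Fin N ⊕ Fin N → ℂ) → ℂ) : Prop where
  pos : 0 < r
  holomorphic : ∀ i, AnalyticOnNhd ℂ (σ i) (prodSet (ball N r) (ball N r))
  real : ∀ i, ∀ Z ∈ ball N r, (σ i (Sum.elim Z (star Z))).im = 0
  generate : Ideal.span {g : analyticGerms ℝ (Fin N → ℂ) | ∃ i,
      (g : Germ (𝓝 (0 : Fin N → ℂ)) ℝ) =
        ((fun Z : Fin N → ℂ => (σ i (Sum.elim Z (star Z))).re) : Germ (𝓝 (0 : Fin N → ℂ)) ℝ)} =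
    vanishingIdeal ℝ X

section

variable (r : ℝ) {d : ℕ} (σ : Fin d → (Fin N ⊕ Fin N → ℂ) → ℂ)

/-- The Segre variety `Σ_p = {Z ∈ B | σ(Z, p̄) = 0}`. -/
def segre (p : Fin N → ℂ) : Set (Fin N → ℂ) :=
  {Z | Z ∈ ball N r ∧ ∀ i, σ i (Sum.elim Z (star p)) = 0}

/-- `E₀^U`, the intersection of the Segre varieties `Σ_p` over all `p ∈ Σ₀ ∩ U`. -/
def essVar (U : Set (Fin N → ℂ)) : Set (Fin N → ℂ) :=
  ⋂ p ∈ segre r σ 0 ∩ U, segre r σ p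

/-- Essential finiteness at `0`: `E₀^U` has dimension `0` at `0` for every open neighbourhood
`U ⊆ B` of `0`. -/
def EssentiallyFinite : Prop :=
  ∀ U : Set (Fin N → ℂ), IsOpen U → 0 ∈ U → U ⊆ ball N r → germDim (essVar r σ U) = 0

/-- The complexification `𝒳 = {(Z, ζ) ∈ B × B | σ(Z, ζ) = 0}`. -/
def complexification : Set (Fin N ⊕ Fin N → ℂ) :=
  {w | w ∈ prodSet (ball N r) (ball N r) ∧ ∀ i, σ i w = 0}

end

/-- The ideal of `ℂ[[Z, ζ]]` generated by an ideal `J` of `ℂ[[Z]]`. -/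
def extendIdeal (J : Ideal (MvPowerSeries (Fin N) ℂ)) :
    Ideal (MvPowerSeries (Fin N ⊕ Fin N) ℂ) :=
  J.map (MvPowerSeries.rename (R := ℂ) (Sum.inl : Fin N → Fin N ⊕ Fin N))

end Segre

end

/-!
The equivalence is proved along (a) ⇒ (d) ⇒ (b) ⇒ (a) and (b) ⇔ (c). Two results carry it, one
leading from ideals to formal curves and one leading from formal ideals back to sets.

* `Segre.exists_formal_curve`: an ideal `J` of formal power series for which `ℂ⟦Z⟧ / J` has positive
  dimension is killed by the substitution of a nonzero tuple of series in one variable. An ideal that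
  is maximal among the ideals containing `J` and omitting all powers of some variable is prime, and
  its quotient is finite over `ℂ⟦T⟧` for a variable `T`. The normalization of that quotient,
  localized at a maximal ideal, is a discrete valuation ring with residue field `ℂ`, and the
  expansion in powers of a uniformizer gives the curve.

* `Segre.exists_variety_of_X_pow_notMem`: if convergent power series with a common polydisc of
  convergence generate, in the ring of *formal* power series, an ideal of positive dimension, then
  they vanish on a complex variety of positive dimension.

The second result rests on a standard basis (`Segre.StandardBasis`). The monomial `x ^ α` is ordered
by the number `num α = ∏ pᵢ ^ αᵢ`, where the `pᵢ` are distinct primes, and the polydiscs `rad τ`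
have the radii `pᵢ ^ (-τ)`, so that `x ^ α` has the weight `(num α) ^ (-τ)` there. Hence a series
`g = x ^ a + (later terms)` that converges somewhere is a small perturbation of `x ^ a` on `rad τ`
for all large `τ`. Division by a standard basis therefore converges, and the operator `R` of taking
remainders modulo the formal ideal is bounded by `2` on all small polydiscs at once. If the basis
had no common zero other than the origin in `rad τ`, the only character of the quotient of the
Banach algebra of the series of finite norm on `rad τ` would be the evaluation at the origin, and
the variables would be quasi-nilpotent in the quotient; this contradicts the fact that standard
monomials keep at least half of their norm there (`Segre.StandardBasis.exists_ne_zero`). Dimension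
theory enters only through the fact that a quotient of the ring of formal power series has positive
dimension if and only if some variable is not nilpotent in it.

(a) ⇒ (d): since `σ(p, p̄)` is real, `σ(p, 0) = 0` implies `σ(0, p̄) = 0`
(`Segre.IsGenerators.reflection`), so `0 ∈ E₀^U`. If the dimension of `E₀^U` is not zero, neither is
that of its formal ideal, and a formal curve killed by that ideal is as required.

(d) ⇒ (b): for `p` near `0` the Taylor series of `σᵢ(·, p̄)` converge on a common polydisc. Those with
`p ∈ Σ₀` are killed by the substitution of `μ`, so they generate an ideal of positive dimension, and
they vanish on a variety `Γ` of positive dimension.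

(b) ⇒ (a): near the origin `Γ` is contained in `E₀^U` if `U` is small.

(b) ⇒ (c): take `J = I(Γ)`. The remainder modulo `I(Γ)` of `F(·, ζ)`, for `F ∈ I(𝒳)`, is zero for
`ζ ∈ Σ₀^*`. So the coefficientwise remainder of `F`, which is congruent to `F` modulo `I(Γ)`, has
coefficients that vanish on `Σ₀^*`; they converge because `R` is bounded.

(c) ⇒ (b): apply to `σᵢ(Z, ·)` the remainder modulo `I(Σ₀^*)`. This kills `I(ℂ^N × Σ₀^*)`, so by (c)
the coefficients of the result are series in `Z` that lie in `J`, and they converge on a common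
polydisc. They vanish on a variety `Γ` of positive dimension. For `Z ∈ Γ` the series `σᵢ(Z, ·)` has
remainder zero, that is, it lies in `I(Σ₀^*)`, so it vanishes on `Σ₀^*` in a neighbourhood of the
origin that does not depend on `Z` (`Segre.StandardBasis.eventually_ev_eq_zero`).
-/

noncomputable section

namespace Segre

open scoped ENNReal NNReal

/-! ### Weighted norms of multiple power series -/

section Monomials

variable {ι : Type*} [Fintype ι]

/-- The monomial `x ^ α = ∏ i, x i ^ α i`. -/
def mon {M : Type*} [CommMonoid M] (x : ι → M) (α : ι →₀ ℕ) : M := ∏ i, x i ^ α i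

section

variable {M : Type*} [CommMonoid M]

@[simp] lemma mon_zero (x : ι → M) : mon x 0 = 1 := by simp [mon]

lemma mon_add (x : ι → M) (α β : ι →₀ ℕ) : mon x (α + β) = mon x α * mon x β := by
  simp [mon, pow_add, Finset.prod_mul_distrib]

lemma mon_single (x : ι → M) (i : ι) (k : ℕ) : mon x (Finsupp.single i k) = x i ^ k := by
  classical
  rw [mon, Finset.prod_eq_single i]
  · simp
  · intro j _ hj
    simp [Finsupp.single_eq_of_ne hj]
  · simp

lemma map_mon {M' F : Type*} [CommMonoid M'] [FunLike F M M'] [MonoidHomClass F M M'] (f : F)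
    (x : ι → M) (α : ι →₀ ℕ) : f (mon x α) = mon (fun i => f (x i)) α := by
  simp [mon, map_prod]

lemma mon_pow (x : ι → M) (n : ℕ) (α : ι →₀ ℕ) : mon (fun i => x i ^ n) α = mon x α ^ n := by
  simp only [mon, ← Finset.prod_pow]
  exact Finset.prod_congr rfl fun i _ => pow_right_comm _ _ _

end

/-- Pairwise distinct primes indexed by `ι`. -/
def prm (i : ι) : ℕ := Nat.nth Nat.Prime (Fintype.equivFin ι i)

lemma prm_prime (i : ι) : (prm i).Prime := Nat.prime_nth_prime _

lemma prm_injective : Function.Injective (prm : ι → ℕ) := fun _ _ h =>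
  (Fintype.equivFin ι).injective (Fin.ext (Nat.nth_injective Nat.infinite_setOfPred_prime h))

/-- The number `∏ i, pᵢ ^ αᵢ`. By unique factorization it determines the exponent `α`, so that
comparing these numbers gives a monomial order. -/
def num (α : ι →₀ ℕ) : ℕ := mon prm α

lemma num_add (α β : ι →₀ ℕ) : num (α + β) = num α * num β := mon_add _ _ _

lemma num_pos (α : ι →₀ ℕ) : 0 < num α :=
  Finset.prod_pos fun i _ => pow_pos (prm_prime i).pos _

lemma factorization_num (α : ι →₀ ℕ) (i : ι) : (num α).factorization (prm i) = α i := by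
  classical
  rw [num, mon, Nat.factorization_prod (fun j _ => (pow_pos (prm_prime j).pos _).ne')]
  rw [Finsupp.finsetSum_apply, Finset.sum_eq_single i]
  · simp [Nat.factorization_pow, (prm_prime i).factorization]
  · intro j _ hj
    simp [Nat.factorization_pow, (prm_prime j).factorization,
      Finsupp.single_eq_of_ne (prm_injective.ne hj.symm)]
  · simp

lemma num_injective : Function.Injective (num : (ι →₀ ℕ) → ℕ) := fun α β h => by
  ext i
  rw [← factorization_num α, h, factorization_num]

lemma num_le_num {α β : ι →₀ ℕ} (h : α ≤ β) : num α ≤ num β := by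
  obtain ⟨γ, rfl⟩ := exists_add_of_le h
  rw [num_add]
  exact Nat.le_mul_of_pos_right _ (num_pos _)

lemma finite_num_le (K : ℕ) : {α : ι →₀ ℕ | num α ≤ K}.Finite :=
  (Set.finite_Iic K).preimage num_injective.injOn

/-- The polyradius `(pᵢ ^ (-τ))ᵢ`. -/
def rad (τ : ℕ) (i : ι) : ℝ≥0 := ((prm i : ℝ≥0)⁻¹) ^ τ

lemma rad_pos (τ : ℕ) (i : ι) : 0 < rad τ i :=
  pow_pos (inv_pos.2 (by exact_mod_cast (prm_prime i).pos)) _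

lemma mon_rad (τ : ℕ) (α : ι →₀ ℕ) : mon (rad τ) α = ((num α : ℝ≥0)⁻¹) ^ τ := by
  have : (num α : ℝ≥0)⁻¹ = mon (fun i => (prm i : ℝ≥0)⁻¹) α := by
    simp [num, mon, Finset.prod_inv_distrib]
  rw [this, ← mon_pow]
  rfl

lemma mon_rad_pos (τ : ℕ) (α : ι →₀ ℕ) : 0 < mon (rad τ) α :=
  Finset.prod_pos fun i _ => pow_pos (rad_pos τ i) _

lemma rad_le (τ : ℕ) (i : ι) : rad τ i ≤ (2⁻¹ : ℝ≥0) ^ τ := by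
  unfold rad
  gcongr
  exact_mod_cast (prm_prime i).two_le

lemma rad_antitone {τ τ' : ℕ} (h : τ ≤ τ') : (rad τ' : ι → ℝ≥0) ≤ rad τ := fun i =>
  pow_le_pow_of_le_one zero_le (inv_le_one_of_one_le₀ (by exact_mod_cast (prm_prime i).one_le)) h

lemma exists_rad_le {ρ : ι → ℝ≥0} (hρ : ∀ i, 0 < ρ i) : ∃ τ₀, ∀ τ ≥ τ₀, rad τ ≤ ρ := by
  have h : Tendsto (fun τ : ℕ => (2⁻¹ : ℝ≥0) ^ τ) atTop (𝓝 0) :=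
    NNReal.tendsto_pow_atTop_nhds_zero_of_lt_one (by
      rw [← NNReal.coe_lt_coe]; norm_num)
  have h2 : ∀ i : ι, ∀ᶠ τ : ℕ in atTop, (2⁻¹ : ℝ≥0) ^ τ ≤ ρ i := fun i =>
    (h.eventually (gt_mem_nhds (hρ i))).mono fun τ hτ => hτ.le
  obtain ⟨τ₀, h3⟩ := eventually_atTop.1 (eventually_all.2 h2)
  exact ⟨τ₀, fun τ hτ i => (rad_le τ i).trans (h3 τ hτ i)⟩

/-- The closed polydisc of polyradius `ρ`. -/
def polydisc {κ : Type*} (ρ : κ → ℝ≥0) : Set (κ → ℂ) := {z | ∀ i, ‖z i‖₊ ≤ ρ i}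

lemma polydisc_mono {κ : Type*} {ρ ρ' : κ → ℝ≥0} (h : ρ ≤ ρ') : polydisc ρ ⊆ polydisc ρ' :=
  fun _ hz i => (hz i).trans (h i)

lemma polydisc_mem_nhds {ρ : ι → ℝ≥0} (hρ : ∀ i, 0 < ρ i) : polydisc ρ ∈ 𝓝 (0 : ι → ℂ) := by
  have : ∀ i, ∀ᶠ z : ι → ℂ in 𝓝 0, ‖z i‖₊ ≤ ρ i := fun i => by
    have hc : Continuous fun z : ι → ℂ => ‖z i‖₊ := by fun_prop
    have := hc.tendsto 0
    simp only [Pi.zero_apply, nnnorm_zero] at this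
    exact (this.eventually (gt_mem_nhds (hρ i))).mono fun z hz => hz.le
  exact eventually_all.2 this

lemma exists_polydisc_subset {W : Set (ι → ℂ)} (hW : W ∈ 𝓝 (0 : ι → ℂ)) :
    ∃ τ₀, ∀ τ ≥ τ₀, polydisc (rad τ) ⊆ W := by
  obtain ⟨ε, hε, hεW⟩ := Metric.mem_nhds_iff.1 hW
  obtain ⟨τ₀, h⟩ := exists_rad_le (ι := ι) (ρ := fun _ => (ε / 2).toNNReal)
    fun _ => Real.toNNReal_pos.2 (half_pos hε)
  refine ⟨τ₀, fun τ hτ z hz => hεW ?_⟩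
  rw [mem_ball_zero_iff]
  refine lt_of_le_of_lt ((pi_norm_le_iff_of_nonneg (half_pos hε).le).2 fun i => ?_)
    (half_lt_self hε)
  exact (Real.le_toNNReal_iff_coe_le (half_pos hε).le).1 ((hz i).trans (h τ hτ i))

end Monomials

section Norm

variable {ι : Type*} [Fintype ι]

open MvPowerSeries

/-- The weighted `ℓ¹` norm `∑ |F_α| ρ ^ α` of a power series, with value `∞` if the sum diverges. -/
def nrm (ρ : ι → ℝ≥0) (F : MvPowerSeries ι ℂ) : ℝ≥0∞ :=
  ∑' α, ‖coeff α F‖ₑ * (mon ρ α : ℝ≥0)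

/-- The sum `F(z)` of a power series, meaningful if `z` lies in a polydisc on which `F` has finite
weighted norm. -/
def ev (z : ι → ℂ) (F : MvPowerSeries ι ℂ) : ℂ := ∑' α, coeff α F * mon z α

variable {ρ ρ' : ι → ℝ≥0} {F G : MvPowerSeries ι ℂ} {z : ι → ℂ}

@[simp] lemma nrm_zero : nrm ρ (0 : MvPowerSeries ι ℂ) = 0 := by simp [nrm]

lemma le_nrm (α : ι →₀ ℕ) : ‖coeff α F‖ₑ * (mon ρ α : ℝ≥0) ≤ nrm ρ F :=
  ENNReal.le_tsum (f := fun α => ‖coeff α F‖ₑ * ((mon ρ α : ℝ≥0) : ℝ≥0∞)) α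

lemma mon_mono (h : ρ ≤ ρ') (α : ι →₀ ℕ) : mon ρ α ≤ mon ρ' α :=
  Finset.prod_le_prod' fun i _ => pow_le_pow_left' (h i) _

lemma nrm_mono (h : ρ ≤ ρ') (F : MvPowerSeries ι ℂ) : nrm ρ F ≤ nrm ρ' F :=
  ENNReal.tsum_le_tsum fun α => by gcongr; exact mon_mono h α

lemma nrm_add_le : nrm ρ (F + G) ≤ nrm ρ F + nrm ρ G := by
  rw [nrm, nrm, nrm, ← ENNReal.tsum_add]
  refine ENNReal.tsum_le_tsum fun α => ?_
  rw [← add_mul, map_add]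
  gcongr
  exact enorm_add_le _ _

@[simp] lemma nrm_neg : nrm ρ (-F) = nrm ρ F := by simp [nrm]

lemma nrm_sub_le : nrm ρ (F - G) ≤ nrm ρ F + nrm ρ G := by
  rw [sub_eq_add_neg, ← nrm_neg (F := G)]
  exact nrm_add_le

lemma nrm_sum_le {κ : Type*} (s : Finset κ) (f : κ → MvPowerSeries ι ℂ) :
    nrm ρ (∑ k ∈ s, f k) ≤ ∑ k ∈ s, nrm ρ (f k) := by
  classical
  induction s using Finset.induction_on with
  | empty => simp
  | insert a s ha ih =>
    rw [Finset.sum_insert ha, Finset.sum_insert ha]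
    exact nrm_add_le.trans (add_le_add_right ih _)

lemma nrm_smul (c : ℂ) : nrm ρ (c • F) = ‖c‖ₑ * nrm ρ F := by
  rw [nrm, nrm, ← ENNReal.tsum_mul_left]
  exact tsum_congr fun α => by rw [map_smul, smul_eq_mul, enorm_mul, mul_assoc]

lemma nrm_monomial (α : ι →₀ ℕ) (c : ℂ) : nrm ρ (monomial α c) = ‖c‖ₑ * (mon ρ α : ℝ≥0) := by
  classical
  rw [nrm, tsum_eq_single α]
  · rw [coeff_monomial_same]
  · intro β hβ
    rw [coeff_monomial_ne hβ]
    simp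

lemma nrm_one : nrm ρ (1 : MvPowerSeries ι ℂ) = 1 := by
  rw [← monomial_zero_one, nrm_monomial]
  simp

lemma nrm_mul_le : nrm ρ (F * G) ≤ nrm ρ F * nrm ρ G := by
  classical
  set f : (ι →₀ ℕ) → ℝ≥0∞ := fun α => ‖coeff α F‖ₑ * ((mon ρ α : ℝ≥0) : ℝ≥0∞) with hf
  set g : (ι →₀ ℕ) → ℝ≥0∞ := fun α => ‖coeff α G‖ₑ * ((mon ρ α : ℝ≥0) : ℝ≥0∞) with hg
  have h1 : nrm ρ F * nrm ρ G = ∑' p : (ι →₀ ℕ) × (ι →₀ ℕ), f p.1 * g p.2 := by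
    rw [ENNReal.tsum_prod', nrm, nrm, ← ENNReal.tsum_mul_right]
    exact tsum_congr fun α => ENNReal.tsum_mul_left.symm
  rw [h1, ← Finset.HasAntidiagonal.sigmaAntidiagonalEquivProd.tsum_eq, ENNReal.tsum_sigma']
  refine ENNReal.tsum_le_tsum fun α => ?_
  rw [coeff_mul]
  have h2 : ∑' b : Finset.HasAntidiagonal.antidiagonal α, f (Finset.HasAntidiagonal.sigmaAntidiagonalEquivProd ⟨α, b⟩).1 *
      g (Finset.HasAntidiagonal.sigmaAntidiagonalEquivProd ⟨α, b⟩).2 =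
      ∑ p ∈ Finset.HasAntidiagonal.antidiagonal α, f p.1 * g p.2 := by
    rw [tsum_fintype]
    exact Finset.sum_coe_sort (Finset.HasAntidiagonal.antidiagonal α) fun p => f p.1 * g p.2
  rw [h2]
  calc _ ≤ (∑ p ∈ Finset.HasAntidiagonal.antidiagonal α, ‖coeff p.1 F * coeff p.2 G‖ₑ) * (mon ρ α : ℝ≥0) := by
        gcongr
        exact enorm_sum_le _ _
    _ = _ := by
        rw [Finset.sum_mul]
        refine Finset.sum_congr rfl fun p hp => ?_
        rw [← Finset.HasAntidiagonal.mem_antidiagonal.1 hp, mon_add, enorm_mul, hf, hg]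
        push_cast
        ring

lemma nrm_mul_lt_top (hF : nrm ρ F < ∞) (hG : nrm ρ G < ∞) : nrm ρ (F * G) < ∞ :=
  nrm_mul_le.trans_lt (ENNReal.mul_lt_top hF hG)

lemma enorm_mon_le (hz : z ∈ polydisc ρ) (α : ι →₀ ℕ) : ‖mon z α‖ₑ ≤ (mon ρ α : ℝ≥0) := by
  rw [enorm_eq_nnnorm, ENNReal.coe_le_coe, mon, nnnorm_prod]
  exact Finset.prod_le_prod' fun i _ => by
    rw [nnnorm_pow]
    exact pow_le_pow_left' (hz i) _

lemma tsum_enorm_le_nrm (hz : z ∈ polydisc ρ) :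
    ∑' α, ‖coeff α F * mon z α‖ₑ ≤ nrm ρ F :=
  ENNReal.tsum_le_tsum fun α => by
    rw [enorm_mul]
    gcongr
    exact enorm_mon_le hz α

lemma summable_norm_of_tsum_enorm_lt_top {α : Type*} {f : α → ℂ} (h : ∑' a, ‖f a‖ₑ < ∞) :
    Summable fun a => ‖f a‖ := by
  have := ENNReal.summable_toReal h.ne
  simpa using this

lemma summable_norm_ev (hF : nrm ρ F < ∞) (hz : z ∈ polydisc ρ) :
    Summable fun α => ‖coeff α F * mon z α‖ :=
  summable_norm_of_tsum_enorm_lt_top ((tsum_enorm_le_nrm hz).trans_lt hF)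

lemma hasSum_ev (hF : nrm ρ F < ∞) (hz : z ∈ polydisc ρ) :
    HasSum (fun α => coeff α F * mon z α) (ev z F) :=
  (summable_norm_ev hF hz).of_norm.hasSum

lemma enorm_ev_le (hz : z ∈ polydisc ρ) : ‖ev z F‖ₑ ≤ nrm ρ F := by
  by_cases hF : nrm ρ F < ∞
  · refine le_trans ?_ (tsum_enorm_le_nrm hz)
    exact enorm_tsum_le_tsum_enorm
  · rw [not_lt_top_iff.1 hF]
    exact le_top

lemma ev_add (hF : nrm ρ F < ∞) (hG : nrm ρ G < ∞) (hz : z ∈ polydisc ρ) :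
    ev z (F + G) = ev z F + ev z G := by
  refine HasSum.tsum_eq ?_
  simpa [add_mul] using (hasSum_ev hF hz).add (hasSum_ev hG hz)

lemma ev_mul (hF : nrm ρ F < ∞) (hG : nrm ρ G < ∞) (hz : z ∈ polydisc ρ) :
    ev z (F * G) = ev z F * ev z G := by
  classical
  have hf : Summable fun α => coeff α F * mon z α := (summable_norm_ev hF hz).of_norm
  have hg : Summable fun α => coeff α G * mon z α := (summable_norm_ev hG hz).of_norm
  have hfg : Summable fun p : (ι →₀ ℕ) × (ι →₀ ℕ) =>
      (coeff p.1 F * mon z p.1) * (coeff p.2 G * mon z p.2) :=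
    summable_mul_of_summable_norm (f := fun α => coeff α F * mon z α)
      (g := fun α => coeff α G * mon z α) (summable_norm_ev hF hz) (summable_norm_ev hG hz)
  have h := hf.tsum_mul_tsum_eq_tsum_sum_antidiagonal hg hfg
  rw [ev, ev, ev, h]
  refine tsum_congr fun α => ?_
  rw [coeff_mul, Finset.sum_mul]
  refine Finset.sum_congr rfl fun p hp => ?_
  rw [← Finset.HasAntidiagonal.mem_antidiagonal.1 hp, mon_add]
  ring

lemma ev_monomial (α : ι →₀ ℕ) (c : ℂ) : ev z (monomial α c) = c * mon z α := by
  classical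
  rw [ev, tsum_eq_single α]
  · rw [coeff_monomial_same]
  · intro β hβ
    rw [coeff_monomial_ne hβ, zero_mul]

@[simp] lemma ev_zero : ev z (0 : MvPowerSeries ι ℂ) = 0 := by simp [ev]

lemma ev_sum {κ : Type*} (s : Finset κ) {f : κ → MvPowerSeries ι ℂ}
    (hf : ∀ k ∈ s, nrm ρ (f k) < ∞) (hz : z ∈ polydisc ρ) :
    ev z (∑ k ∈ s, f k) = ∑ k ∈ s, ev z (f k) := by
  classical
  induction s using Finset.induction_on with
  | empty => simp
  | insert a s ha ih =>
    have h1 : ∀ k ∈ s, nrm ρ (f k) < ∞ := fun k hk => hf k (Finset.mem_insert_of_mem hk)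
    rw [Finset.sum_insert ha, Finset.sum_insert ha, ev_add (hf a (Finset.mem_insert_self _ _))
      ((nrm_sum_le s f).trans_lt (ENNReal.sum_lt_top.2 h1)) hz, ih h1]

lemma ev_zero_point (F : MvPowerSeries ι ℂ) : ev 0 F = constantCoeff F := by
  rw [ev, tsum_eq_single 0]
  · simp
  · intro α hα
    obtain ⟨i, hi⟩ := Finsupp.ne_iff.1 hα
    have : mon (0 : ι → ℂ) α = 0 :=
      Finset.prod_eq_zero (Finset.mem_univ i) (by simpa using hi)
    rw [this, mul_zero]

/-- The terms of a convergent series beyond a monomial `α₀` are dominated by `α₀` on the polydiscs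
`rad τ`, for `τ` large. -/
lemma exists_nrm_rad_le {τ₀ : ℕ} (hG : nrm (rad τ₀) G < ∞) (α₀ : ι →₀ ℕ)
    (h0 : ∀ γ, num γ ≤ num α₀ → coeff γ G = 0) {c : ℝ≥0∞} (hc : c ≠ 0) :
    ∃ τ₁, ∀ τ ≥ τ₁, nrm (rad τ) G ≤ c * (mon (rad τ) α₀ : ℝ≥0) := by
  set a : ℝ≥0 := (num α₀ : ℝ≥0) with ha
  have ha0 : 0 < a := by rw [ha]; exact_mod_cast num_pos α₀
  set q : ℝ≥0 := a / (a + 1) with hq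
  have hq1 : q < 1 := by
    rw [hq, div_lt_one (by positivity)]
    exact lt_add_one a
  have key : ∀ k, nrm (rad (τ₀ + k)) G ≤ ((a + 1)⁻¹ ^ k : ℝ≥0) * nrm (rad τ₀) G := by
    intro k
    rw [nrm, nrm, ← ENNReal.tsum_mul_left]
    refine ENNReal.tsum_le_tsum fun γ => ?_
    by_cases hγ : num γ ≤ num α₀
    · simp [h0 γ hγ]
    · rw [mon_rad, mon_rad, pow_add, mul_comm (_ ^ τ₀), ENNReal.coe_mul, ← mul_assoc, ← mul_assoc,
        mul_comm ‖_‖ₑ]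
      gcongr
      push Not at hγ
      rw [ha]
      exact_mod_cast hγ
  have hlim : Tendsto (fun k : ℕ => ((q ^ k : ℝ≥0) : ℝ≥0∞) * nrm (rad τ₀) G) atTop (𝓝 0) := by
    have := ENNReal.Tendsto.mul_const (b := nrm (rad τ₀) G)
      (ENNReal.tendsto_pow_atTop_nhds_zero_of_lt_one (r := (q : ℝ≥0∞)) (by exact_mod_cast hq1))
      (Or.inr hG.ne)
    simpa using this
  have hcm : 0 < c * (mon (rad τ₀) α₀ : ℝ≥0) :=
    ENNReal.mul_pos hc (by exact_mod_cast (mon_rad_pos τ₀ α₀).ne')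
  obtain ⟨k₀, hk₀⟩ := eventually_atTop.1 (hlim.eventually (gt_mem_nhds hcm))
  refine ⟨τ₀ + k₀, fun τ hτ => ?_⟩
  obtain ⟨k, rfl⟩ := Nat.exists_eq_add_of_le ((Nat.le_add_right _ _).trans hτ)
  have hk := (hk₀ k (by omega)).le
  calc _ ≤ _ := key k
    _ = ((a⁻¹ ^ k : ℝ≥0) : ℝ≥0∞) * (((q ^ k : ℝ≥0) : ℝ≥0∞) * nrm (rad τ₀) G) := by
        rw [← mul_assoc, ← ENNReal.coe_mul, ← mul_pow, hq]
        congr 4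
        field_simp
    _ ≤ ((a⁻¹ ^ k : ℝ≥0) : ℝ≥0∞) * (c * (mon (rad τ₀) α₀ : ℝ≥0)) := by gcongr
    _ = _ := by
        rw [mon_rad, mon_rad, pow_add, ← ha]
        push_cast
        ring

/-- A nonzero series has a nonzero coefficient that is smallest for the order by `num`. -/
lemma exists_leading (hF : F ≠ 0) :
    ∃ α, coeff α F ≠ 0 ∧ ∀ γ, num γ < num α → coeff γ F = 0 := by
  obtain ⟨β, hβ⟩ := (ne_zero_iff_exists_coeff_ne_zero F).1 hF
  have hne : {α | coeff α F ≠ 0}.Nonempty := ⟨β, hβ⟩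
  refine ⟨Function.argminOn num {α | coeff α F ≠ 0} hne,
    Function.argminOn_mem num {α | coeff α F ≠ 0} hne, fun γ hγ => ?_⟩
  by_contra h
  exact Function.not_lt_argminOn num {α | coeff α F ≠ 0} (a := γ) h hγ

/-- Identity theorem: a convergent power series whose sum vanishes near `0` is zero. -/
lemma eq_zero_of_eventually_ev_eq_zero {τ₀ : ℕ} (hF : nrm (rad τ₀) F < ∞)
    (h : ∀ᶠ z in 𝓝 (0 : ι → ℂ), ev z F = 0) : F = 0 := by
  by_contra hne
  obtain ⟨α, hα, hmin⟩ := exists_leading hne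
  set G := F - monomial α (coeff α F) with hG
  have hG' : nrm (rad τ₀) G < ∞ := nrm_sub_le.trans_lt (ENNReal.add_lt_top.2 ⟨hF, by
    rw [nrm_monomial]; exact ENNReal.mul_lt_top enorm_lt_top ENNReal.coe_lt_top⟩)
  have hG0 : ∀ γ, num γ ≤ num α → coeff γ G = 0 := fun γ hγ => by
    rcases hγ.lt_or_eq with h1 | h1
    · have : γ ≠ α := fun h => by simp [h] at h1
      rw [hG, map_sub, hmin γ h1, coeff_monomial_ne this, sub_zero]
    · rw [num_injective h1, hG, map_sub, coeff_monomial_same, sub_self]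
  obtain ⟨τ₁, h1⟩ := exists_nrm_rad_le hG' α hG0 (c := ‖coeff α F‖ₑ / 2)
    (by simpa using hα)
  obtain ⟨τ₂, h2⟩ := exists_polydisc_subset h
  set τ := max τ₀ (max τ₁ τ₂)
  set z : ι → ℂ := fun i => ((rad τ i : ℝ≥0) : ℂ) with hz
  have hzm : z ∈ polydisc (rad τ) := fun i => by simp [hz]
  have h3 : ev z F = 0 := h2 τ (by simp [τ]) hzm
  have hF' : F = monomial α (coeff α F) + G := by simp [hG]
  have hmono := rad_antitone (ι := ι) (τ := τ₀) (τ' := τ) (by simp [τ])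
  rw [hF', ev_add (ρ := rad τ) (by
    rw [nrm_monomial]; exact ENNReal.mul_lt_top enorm_lt_top ENNReal.coe_lt_top)
    ((nrm_mono hmono _).trans_lt hG') hzm, ev_monomial] at h3
  have h4 : ‖ev z G‖ₑ = ‖coeff α F‖ₑ * (mon (rad τ) α : ℝ≥0) := by
    rw [← neg_eq_of_add_eq_zero_right h3, enorm_neg, enorm_mul]
    congr 1
    have : mon z α = ((mon (rad τ) α : ℝ≥0) : ℂ) := by simp [mon, hz]
    rw [this, enorm_eq_nnnorm]
    simp
  have h5 := (enorm_ev_le hzm).trans (h1 τ (by simp [τ]))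
  rw [h4, ENNReal.div_eq_inv_mul, mul_assoc] at h5
  have h6 : ‖coeff α F‖ₑ * ((mon (rad τ) α : ℝ≥0) : ℝ≥0∞) ≠ 0 := mul_ne_zero (by simpa using hα)
    (by exact_mod_cast (mon_rad_pos τ α).ne')
  have h7 : ‖coeff α F‖ₑ * ((mon (rad τ) α : ℝ≥0) : ℝ≥0∞) ≠ ∞ :=
    ENNReal.mul_ne_top enorm_ne_top ENNReal.coe_ne_top
  rw [← ENNReal.div_eq_inv_mul] at h5
  exact (ENNReal.half_lt_self h6 h7).not_ge h5

end Norm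

/-! ### Division and standard bases -/

section Division

open MvPowerSeries
open scoped Classical in
/-- A chosen element of `A` below `γ`, if there is one. -/
def pick {ι : Type*} (A : Finset (ι →₀ ℕ)) (γ : ι →₀ ℕ) : ι →₀ ℕ :=
  if h : ∃ a ∈ A, a ≤ γ then h.choose else 0

lemma pick_spec {ι : Type*} {A : Finset (ι →₀ ℕ)} {γ : ι →₀ ℕ} (h : ∃ a ∈ A, a ≤ γ) :
    pick A γ ∈ A ∧ pick A γ ≤ γ := by
  rw [pick, dif_pos h]
  exact h.choose_spec

/-- The linear map to power series with prescribed coefficient functionals. -/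
def ofCoeff {M ι : Type*} [AddCommGroup M] [Module ℂ M] (L : (ι →₀ ℕ) → M →ₗ[ℂ] ℂ) :
    M →ₗ[ℂ] MvPowerSeries ι ℂ :=
  (LinearMap.pi L : M →ₗ[ℂ] ((ι →₀ ℕ) → ℂ))

@[simp] lemma coeff_ofCoeff {M ι : Type*} [AddCommGroup M] [Module ℂ M]
    (L : (ι →₀ ℕ) → M →ₗ[ℂ] ℂ) (x : M) (α : ι →₀ ℕ) : coeff α (ofCoeff L x) = L α x := rfl

open scoped Classical in
/-- The remainder of the division of `F` by the monomials `x ^ a`, `a ∈ A`: the part of `F` that is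
supported on the exponents which lie above no element of `A`. -/
def monRem {ι : Type*} (A : Finset (ι →₀ ℕ)) : MvPowerSeries ι ℂ →ₗ[ℂ] MvPowerSeries ι ℂ :=
  ofCoeff fun γ => if ∃ a ∈ A, a ≤ γ then 0 else coeff γ

open scoped Classical in
/-- The quotients of the division of `F` by the monomials `x ^ a`, `a ∈ A`: each monomial `x ^ γ` of
`F` with `γ` above some element of `A` is divided by `x ^ (pick A γ)`. -/
def monQuo {ι : Type*} (A : Finset (ι →₀ ℕ)) (a : ι →₀ ℕ) :
    MvPowerSeries ι ℂ →ₗ[ℂ] MvPowerSeries ι ℂ :=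
  ofCoeff fun β => if (∃ b ∈ A, b ≤ β + a) ∧ pick A (β + a) = a then coeff (β + a) else 0

variable {ι : Type*} {A : Finset (ι →₀ ℕ)}

open scoped Classical in
lemma coeff_monRem (F : MvPowerSeries ι ℂ) (γ : ι →₀ ℕ) :
    coeff γ (monRem A F) = if ∃ a ∈ A, a ≤ γ then 0 else coeff γ F := by
  rw [monRem, coeff_ofCoeff]
  split_ifs <;> rfl

open scoped Classical in
lemma coeff_monQuo (F : MvPowerSeries ι ℂ) (a β : ι →₀ ℕ) :
    coeff β (monQuo A a F) =
      if (∃ b ∈ A, b ≤ β + a) ∧ pick A (β + a) = a then coeff (β + a) F else 0 := by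
  rw [monQuo, coeff_ofCoeff]
  split_ifs <;> rfl

/-- Division by monomials. -/
lemma monRem_add_sum_monQuo (F : MvPowerSeries ι ℂ) :
    F = monRem A F + ∑ a ∈ A, monQuo A a F * monomial a 1 := by
  classical
  ext γ
  rw [map_add, map_sum, coeff_monRem]
  simp only [coeff_mul_monomial, mul_one]
  by_cases h : ∃ a ∈ A, a ≤ γ
  · rw [if_pos h, zero_add, Finset.sum_eq_single_of_mem _ (pick_spec h).1,
      if_pos (pick_spec h).2, coeff_monQuo, tsub_add_cancel_of_le (pick_spec h).2, if_pos ⟨h, rfl⟩]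
    intro b hb hne
    split_ifs with hbγ
    · rw [coeff_monQuo, tsub_add_cancel_of_le hbγ, if_neg fun h => hne h.2.symm]
    · rfl
  · rw [if_neg h, Finset.sum_eq_zero, add_zero]
    intro a ha
    rw [if_neg fun h' => h ⟨a, ha, h'⟩]

variable [Fintype ι] {ρ : ι → ℝ≥0} {F : MvPowerSeries ι ℂ}

lemma nrm_monRem_le : nrm ρ (monRem A F) ≤ nrm ρ F := by
  classical
  refine ENNReal.tsum_le_tsum fun γ => ?_
  gcongr
  rw [coeff_monRem]
  split_ifs <;> simp

lemma sum_nrm_monQuo_le : ∑ a ∈ A, nrm ρ (monQuo A a F) * (mon ρ a : ℝ≥0) ≤ nrm ρ F := by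
  classical
  have h1 : ∀ a ∈ A, nrm ρ (monQuo A a F) * (mon ρ a : ℝ≥0) ≤
      ∑' γ, if (∃ b ∈ A, b ≤ γ) ∧ pick A γ = a then ‖coeff γ F‖ₑ * ((mon ρ γ : ℝ≥0) : ℝ≥0∞)
        else 0 := by
    intro a _
    rw [nrm, ← ENNReal.tsum_mul_right]
    refine le_trans (le_of_eq ?_) (ENNReal.tsum_comp_le_tsum_of_injective
      (f := fun β => β + a) (add_left_injective a) _)
    refine tsum_congr fun β => ?_
    rw [coeff_monQuo, mon_add]
    split_ifs
    · push_cast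
      ring
    · simp
  refine (Finset.sum_le_sum h1).trans ?_
  rw [← Summable.tsum_finsetSum fun _ _ => ENNReal.summable]
  refine ENNReal.tsum_le_tsum fun γ => ?_
  by_cases h : ∃ b ∈ A, b ≤ γ
  · simp only [h, true_and]
    rw [Finset.sum_ite_eq]
    split_ifs <;> simp
  · simp [h]

lemma nrm_monQuo_lt_top (hρ : ∀ i, 0 < ρ i) (hF : nrm ρ F < ∞) {a : ι →₀ ℕ} (ha : a ∈ A) :
    nrm ρ (monQuo A a F) < ∞ := by
  have h : nrm ρ (monQuo A a F) * (mon ρ a : ℝ≥0) < ∞ :=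
    ((Finset.single_le_sum (f := fun a => nrm ρ (monQuo A a F) * ((mon ρ a : ℝ≥0) : ℝ≥0∞))
      (fun _ _ => zero_le) ha).trans sum_nrm_monQuo_le).trans_lt hF
  refine ENNReal.lt_top_of_mul_ne_top_left h.ne ?_
  have : mon ρ a ≠ 0 := Finset.prod_ne_zero_iff.2 fun i _ => (pow_pos (hρ i) _).ne'
  exact_mod_cast this

variable (A) (g : (ι →₀ ℕ) → MvPowerSeries ι ℂ)

/-- The negative of the error `∑ q_a (g_a - x ^ a)` that is made when the monomials `x ^ a` in the
division of `F` are replaced by series `g a` with leading monomial `x ^ a`. -/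
def divErr : Module.End ℂ (MvPowerSeries ι ℂ) :=
  -∑ a ∈ A, (LinearMap.mulRight ℂ (g a - monomial a 1)).comp (monQuo A a)

lemma divErr_apply {κ : Type*} (A : Finset (κ →₀ ℕ)) (g : (κ →₀ ℕ) → MvPowerSeries κ ℂ)
    (F : MvPowerSeries κ ℂ) :
    divErr A g F = -∑ a ∈ A, monQuo A a F * (g a - monomial a 1) := by
  simp [divErr]

/-- The inverse of `1 - divErr A g`, as a Neumann series: only finitely many of its terms contribute
to a given coefficient. -/
def divSeries : MvPowerSeries ι ℂ →ₗ[ℂ] MvPowerSeries ι ℂ :=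
  ofCoeff fun δ => (coeff δ).comp (∑ k ∈ Finset.range (num δ), divErr A g ^ k)

lemma coeff_divSeries (F : MvPowerSeries ι ℂ) (δ : ι →₀ ℕ) : coeff δ (divSeries A g F) =
    coeff δ ((∑ k ∈ Finset.range (num δ), divErr A g ^ k) F) := rfl

variable {A g}

section Formal

variable (hg : ∀ a ∈ A, ∀ γ, num γ ≤ num a → coeff γ (g a - monomial a 1) = 0)
include hg

lemma coeff_divErr_eq_zero {K : ℕ} (hF : ∀ γ, num γ < K → coeff γ F = 0) {δ : ι →₀ ℕ}
    (hδ : num δ < K + 1) : coeff δ (divErr A g F) = 0 := by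
  classical
  rw [divErr_apply, map_neg, map_sum, Finset.sum_eq_zero, neg_zero]
  intro a ha
  rw [coeff_mul]
  refine Finset.sum_eq_zero fun p hp => ?_
  have hp' := Finset.HasAntidiagonal.mem_antidiagonal.1 hp
  by_cases h : num p.2 ≤ num a
  · rw [hg a ha _ h, mul_zero]
  · have h1 : num (p.1 + a) < K := by
      rw [num_add]
      rw [← hp', num_add] at hδ
      have := Nat.mul_lt_mul_of_pos_left (not_le.1 h) (num_pos p.1)
      omega
    rw [coeff_monQuo, hF _ h1, ite_self, zero_mul]

lemma coeff_divErr_pow_eq_zero {K : ℕ} (hF : ∀ γ, num γ < K → coeff γ F = 0) (k : ℕ)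
    {δ : ι →₀ ℕ} (hδ : num δ < K + k) : coeff δ ((divErr A g ^ k) F) = 0 := by
  induction k generalizing δ with
  | zero => exact hF δ hδ
  | succ k ih =>
    rw [pow_succ']
    exact coeff_divErr_eq_zero hg (fun γ h => ih h) hδ

lemma coeff_divSeries_of_le {K : ℕ} {δ : ι →₀ ℕ} (hK : num δ ≤ K) :
    coeff δ (divSeries A g F) = coeff δ ((∑ k ∈ Finset.range K, divErr A g ^ k) F) := by
  rw [coeff_divSeries, LinearMap.sum_apply, LinearMap.sum_apply, map_sum, map_sum]
  refine Finset.sum_subset (Finset.range_mono hK) fun k _ hk => ?_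
  refine coeff_divErr_pow_eq_zero hg (K := 1) (fun γ h => absurd (num_pos γ) (by omega)) k ?_
  rw [Finset.mem_range, not_lt] at hk
  omega

lemma divSeries_sub_divErr (F : MvPowerSeries ι ℂ) :
    divSeries A g F - divErr A g (divSeries A g F) = F := by
  ext δ
  set K := num δ with hK
  set U := (∑ k ∈ Finset.range K, divErr A g ^ k) F with hU
  have h1 : coeff δ (divErr A g (divSeries A g F - U)) = 0 := by
    refine coeff_divErr_eq_zero hg (K := K + 1) (fun γ hγ => ?_) (by omega)
    rw [map_sub, coeff_divSeries_of_le hg (by omega : num γ ≤ K), sub_self]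
  have h2 : U - divErr A g U = F - (divErr A g ^ K) F := by
    have := mul_neg_geom_sum (divErr A g) K
    have h := congrArg (fun T : Module.End ℂ (MvPowerSeries ι ℂ) => T F) this
    rwa [sub_mul, one_mul, LinearMap.sub_apply, LinearMap.sub_apply, Module.End.mul_apply,
      Module.End.one_apply] at h
  rw [map_sub, map_sub, sub_eq_zero] at h1
  rw [map_sub, h1, coeff_divSeries, ← map_sub, h2, map_sub,
    coeff_divErr_pow_eq_zero hg (K := 1) (fun γ h => absurd (num_pos γ) (by omega)) K (by omega),
    sub_zero]

/-- Division with remainder by series `g a` with leading monomials `x ^ a`, `a ∈ A`. -/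
lemma division (F : MvPowerSeries ι ℂ) :
    F = monRem A (divSeries A g F) + ∑ a ∈ A, monQuo A a (divSeries A g F) * g a := by
  conv_lhs => rw [← divSeries_sub_divErr hg F, divErr_apply, sub_neg_eq_add]
  nth_rw 1 [monRem_add_sum_monQuo (A := A) (divSeries A g F)]
  rw [add_assoc, ← Finset.sum_add_distrib]
  congr 1
  exact Finset.sum_congr rfl fun a _ => by ring

lemma coeff_divSeries_eq_zero {K : ℕ} (hF : ∀ γ, num γ < K → coeff γ F = 0) {δ : ι →₀ ℕ}
    (hδ : num δ < K) : coeff δ (divSeries A g F) = 0 := by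
  rw [coeff_divSeries, LinearMap.sum_apply, map_sum]
  exact Finset.sum_eq_zero fun k _ => coeff_divErr_pow_eq_zero hg hF k (by omega)

end Formal

lemma divSeries_monomial {γ : ι →₀ ℕ} (hγ : ¬∃ a ∈ A, a ≤ γ) :
    divSeries A g (monomial γ 1) = monomial γ 1 := by
  classical
  have h0 : divErr A g (monomial γ 1) = 0 := by
    rw [divErr_apply, neg_eq_zero]
    refine Finset.sum_eq_zero fun a ha => ?_
    have : monQuo A a (monomial γ (1 : ℂ)) = 0 := by
      ext β
      rw [coeff_monQuo, coeff_zero]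
      split_ifs with h
      · refine coeff_monomial_ne (fun h' => hγ ?_) _
        rw [← h']
        exact ⟨_, pick_spec h.1⟩
      · rfl
    rw [this, zero_mul]
  ext δ
  obtain ⟨n, hn⟩ := Nat.exists_eq_add_of_lt (num_pos δ)
  rw [coeff_divSeries, hn, LinearMap.sum_apply, Finset.sum_range_succ']
  simp [pow_succ, h0]

section Estimates

variable (hs : ∀ a ∈ A, nrm ρ (g a - monomial a 1) ≤ 2⁻¹ * (mon ρ a : ℝ≥0))
include hs

lemma nrm_divErr_le (F : MvPowerSeries ι ℂ) : nrm ρ (divErr A g F) ≤ 2⁻¹ * nrm ρ F := by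
  rw [divErr_apply, nrm_neg]
  refine (nrm_sum_le _ _).trans ?_
  refine le_trans ?_ (mul_le_mul_right (sum_nrm_monQuo_le (A := A) (ρ := ρ) (F := F)) 2⁻¹)
  rw [Finset.mul_sum]
  refine Finset.sum_le_sum fun a ha => nrm_mul_le.trans ?_
  rw [mul_left_comm]
  gcongr
  exact hs a ha

lemma nrm_divErr_pow_le (F : MvPowerSeries ι ℂ) (k : ℕ) :
    nrm ρ ((divErr A g ^ k) F) ≤ 2⁻¹ ^ k * nrm ρ F := by
  induction k with
  | zero => simp
  | succ k ih =>
    rw [pow_succ', pow_succ', mul_assoc]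
    exact (nrm_divErr_le hs _).trans (by gcongr)

lemma nrm_divSeries_le (hg : ∀ a ∈ A, ∀ γ, num γ ≤ num a → coeff γ (g a - monomial a 1) = 0)
    (F : MvPowerSeries ι ℂ) : nrm ρ (divSeries A g F) ≤ 2 * nrm ρ F := by
  have h1 : ∀ K, nrm ρ ((∑ k ∈ Finset.range K, divErr A g ^ k) F) ≤ 2 * nrm ρ F := by
    intro K
    rw [LinearMap.sum_apply]
    refine (nrm_sum_le _ _).trans ?_
    refine (Finset.sum_le_sum fun k _ => nrm_divErr_pow_le hs F k).trans ?_
    rw [← Finset.sum_mul]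
    gcongr
    refine (ENNReal.sum_le_tsum _).trans ?_
    rw [ENNReal.tsum_geometric, ENNReal.one_sub_inv_two, inv_inv]
  rw [nrm, ENNReal.tsum_eq_iSup_sum]
  refine iSup_le fun s => ?_
  obtain ⟨K, hK⟩ := (s.image num).exists_le
  refine le_trans (le_trans (Finset.sum_le_sum fun γ hγ => le_of_eq ?_)
    (ENNReal.sum_le_tsum s)) (h1 K)
  rw [coeff_divSeries_of_le hg (hK _ (Finset.mem_image_of_mem _ hγ))]

end Estimates

end Division

section StandardBasis

open MvPowerSeries

variable {ι : Type*} [Fintype ι]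

/-- Elements of the ideal generated by `S` agree, up to any given order, with combinations of
elements of `S` with polynomial coefficients. -/
lemma exists_mem_span_polynomial {S : Set (MvPowerSeries ι ℂ)} {F : MvPowerSeries ι ℂ}
    (hF : F ∈ Ideal.span S) (K : ℕ) :
    ∃ G ∈ Submodule.span (MvPolynomial ι ℂ) S, ∀ γ, num γ ≤ K → coeff γ G = coeff γ F := by
  classical
  induction hF using Submodule.span_induction with
  | mem x h => exact ⟨x, Submodule.subset_span h, fun _ _ => rfl⟩
  | zero => exact ⟨0, Submodule.zero_mem _, fun _ _ => rfl⟩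
  | add x y _ _ hx hy =>
    obtain ⟨G, hG, h1⟩ := hx
    obtain ⟨H, hH, h2⟩ := hy
    exact ⟨G + H, Submodule.add_mem _ hG hH, fun γ hγ => by rw [map_add, map_add, h1 γ hγ, h2 γ hγ]⟩
  | smul a x _ hx =>
    obtain ⟨G, hG, h1⟩ := hx
    refine ⟨truncFinset ℂ (finite_num_le K).toFinset a • G, Submodule.smul_mem _ _ hG,
      fun γ hγ => ?_⟩
    rw [Algebra.smul_def, smul_eq_mul, MvPowerSeries.algebraMap_apply', coeff_mul, coeff_mul]
    refine Finset.sum_congr rfl fun p hp => ?_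
    have hp' := Finset.HasAntidiagonal.mem_antidiagonal.1 hp
    have h3 : num p.1 ≤ K := (num_le_num (hp' ▸ le_self_add)).trans hγ
    have h4 : num p.2 ≤ K := (num_le_num (hp' ▸ le_add_self)).trans hγ
    rw [h1 _ h4]
    congr 1
    simp [coeff_truncFinset, h3]

lemma nrm_coe_lt_top (ρ : ι → ℝ≥0) (P : MvPolynomial ι ℂ) :
    nrm ρ (P : MvPowerSeries ι ℂ) < ∞ := by
  rw [nrm, tsum_eq_sum (s := P.support)]
  · exact ENNReal.sum_lt_top.2 fun _ _ => ENNReal.mul_lt_top enorm_lt_top ENNReal.coe_lt_top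
  · intro α hα
    rw [MvPolynomial.coeff_coe, MvPolynomial.notMem_support_iff.1 hα]
    simp

lemma exists_nrm_lt_top_of_mem_span {S : Set (MvPowerSeries ι ℂ)}
    (hS : ∀ F ∈ S, ∃ τ, nrm (rad τ) F < ∞) {F : MvPowerSeries ι ℂ}
    (hF : F ∈ Submodule.span (MvPolynomial ι ℂ) S) : ∃ τ, nrm (rad τ) F < ∞ := by
  induction hF using Submodule.span_induction with
  | mem x h => exact hS x h
  | zero => exact ⟨0, by simp⟩
  | add x y _ _ hx hy =>
    obtain ⟨τ, h1⟩ := hx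
    obtain ⟨τ', h2⟩ := hy
    exact ⟨max τ τ', nrm_add_le.trans_lt (ENNReal.add_lt_top.2
      ⟨(nrm_mono (rad_antitone (le_max_left _ _)) _).trans_lt h1,
        (nrm_mono (rad_antitone (le_max_right _ _)) _).trans_lt h2⟩)⟩
  | smul a x _ hx =>
    obtain ⟨τ, h1⟩ := hx
    refine ⟨τ, ?_⟩
    rw [Algebra.smul_def, MvPowerSeries.algebraMap_apply']
    exact nrm_mul_lt_top (by simpa using nrm_coe_lt_top _ a) h1

/-- A standard basis of the ideal generated by a set `S` of convergent power series, with the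
operator `R` of taking remainders modulo that ideal. The estimates hold on all polydiscs `rad τ`
with `τ ≥ τ₀`; this uniformity is what makes the division useful. -/
structure StandardBasis (S : Set (MvPowerSeries ι ℂ)) where
  /-- The exponents of the leading monomials. -/
  A : Finset (ι →₀ ℕ)
  /-- The basis elements. -/
  g : (ι →₀ ℕ) → MvPowerSeries ι ℂ
  /-- The remainder modulo the ideal. -/
  R : MvPowerSeries ι ℂ →ₗ[ℂ] MvPowerSeries ι ℂ
  /-- The estimates hold on the polydiscs `rad τ` with `τ ≥ τ₀`. -/
  τ₀ : ℕ
  mem_span : ∀ a ∈ A, g a ∈ Submodule.span (MvPolynomial ι ℂ) S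
  R_eq_zero_iff : ∀ F, R F = 0 ↔ F ∈ Ideal.span S
  sub_R_mem : ∀ F, F - R F ∈ Ideal.span S
  coeff_R_eq_zero : ∀ F K, (∀ γ, num γ < K → coeff γ F = 0) → ∀ γ, num γ < K → coeff γ (R F) = 0
  coeff_R_of_le : ∀ F γ, (∃ a ∈ A, a ≤ γ) → coeff γ (R F) = 0
  R_monomial : ∀ γ, (¬∃ a ∈ A, a ≤ γ) → R (monomial γ 1) = monomial γ 1
  nrm_g : ∀ τ ≥ τ₀, ∀ a ∈ A, nrm (rad τ) (g a) < ∞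
  nrm_R : ∀ τ ≥ τ₀, ∀ F, nrm (rad τ) (R F) ≤ 2 * nrm (rad τ) F
  division : ∀ τ ≥ τ₀, ∀ F, nrm (rad τ) F < ∞ → ∃ q : (ι →₀ ℕ) → MvPowerSeries ι ℂ,
    (∀ a ∈ A, nrm (rad τ) (q a) < ∞) ∧ F = R F + ∑ a ∈ A, q a * g a

/-- By Dickson's lemma every leading exponent of the ideal lies above one of finitely many. The basis
elements with these finitely many leading exponents are chosen as combinations of elements of `S` with *polynomial*
coefficients, so that they converge; on small polydiscs they are perturbations of monomials. -/
theorem exists_standardBasis {S : Set (MvPowerSeries ι ℂ)}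
    (hS : ∀ F ∈ S, ∃ τ, nrm (rad τ) F < ∞) : Nonempty (StandardBasis S) := by
  classical
  set I := Ideal.span S with hI
  set M : Set (ι →₀ ℕ) :=
    {α | ∃ F ∈ I, coeff α F ≠ 0 ∧ ∀ γ, num γ < num α → coeff γ F = 0} with hM
  -- By Dickson's lemma the set `M` of leading exponents has finitely many minimal elements.
  have hfin : {α | Minimal (· ∈ M) α}.Finite :=
    (setOfPred_minimal_antichain (· ∈ M)).finite_of_partiallyWellOrderedOn
      (Set.isPWO_of_wellQuasiOrderedLE _)
  set A := hfin.toFinset with hA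
  have hAM : ∀ a ∈ A, a ∈ M := fun a ha => ((Set.Finite.mem_toFinset _).1 ha).1
  have hMA : ∀ α ∈ M, ∃ a ∈ A, a ≤ α := fun α hα => by
    obtain ⟨m, hm, hmin⟩ := exists_minimal_le_of_wellFoundedLT (· ∈ M) α hα
    exact ⟨m, (Set.Finite.mem_toFinset _).2 hmin, hm⟩
  have hex : ∀ a ∈ A, ∃ G ∈ Submodule.span (MvPolynomial ι ℂ) S,
      ∀ γ, num γ ≤ num a → coeff γ (G - monomial a 1) = 0 := by
    intro a ha
    obtain ⟨F, hF, h1, h2⟩ := hAM a ha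
    obtain ⟨G, hG, h3⟩ := exists_mem_span_polynomial hF (num a)
    refine ⟨MvPolynomial.C (coeff a F)⁻¹ • G, Submodule.smul_mem _ _ hG, fun γ hγ => ?_⟩
    rw [Algebra.smul_def, MvPowerSeries.algebraMap_apply', map_sub, MvPolynomial.coe_C, map_C,
      Algebra.algebraMap_self_apply, coeff_C_mul]
    rw [h3 γ hγ]
    rcases eq_or_ne γ a with rfl | hne
    · rw [coeff_monomial_same, inv_mul_cancel₀ h1, sub_self]
    · rw [h2 γ (lt_of_le_of_ne hγ (num_injective.ne hne)), coeff_monomial_ne hne]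
      simp
  choose! g hgS hg using hex
  have hconv : ∀ a ∈ A, ∃ τ, nrm (rad τ) (g a - monomial a 1) < ∞ := fun a ha => by
    obtain ⟨τ, h⟩ := exists_nrm_lt_top_of_mem_span hS (hgS a ha)
    exact ⟨τ, nrm_sub_le.trans_lt (ENNReal.add_lt_top.2 ⟨h, by rw [nrm_monomial]; simp⟩)⟩
  have hsm : ∀ a ∈ A, ∃ τ₁, ∀ τ ≥ τ₁,
      nrm (rad τ) (g a - monomial a 1) ≤ 2⁻¹ * (mon (rad τ) a : ℝ≥0) := fun a ha => by
    obtain ⟨τ, h⟩ := hconv a ha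
    exact exists_nrm_rad_le h a (hg a ha) (by simp)
  choose! t ht using hsm
  set τ₀ := A.sup t with hτ₀
  have hs : ∀ τ ≥ τ₀, ∀ a ∈ A,
      nrm (rad τ) (g a - monomial a 1) ≤ 2⁻¹ * (mon (rad τ) a : ℝ≥0) :=
    fun τ hτ a ha => ht a ha τ ((Finset.le_sup ha).trans hτ)
  have hle : Submodule.span (MvPolynomial ι ℂ) S ≤ I.restrictScalars (MvPolynomial ι ℂ) :=
    Submodule.span_le.2 fun x hx => Ideal.subset_span hx
  have hsub : ∀ F, F - monRem A (divSeries A g F) ∈ I := fun F => by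
    nth_rw 1 [division hg F]
    rw [add_sub_cancel_left]
    exact sum_mem fun a ha => I.mul_mem_left _ (hle (hgS a ha))
  refine ⟨⟨A, g, (monRem A).comp (divSeries A g), τ₀, hgS, fun F => ⟨fun h => ?_, fun h => ?_⟩,
    hsub, fun F K hF γ hγ => ?_, fun F γ h => ?_, fun γ h => ?_, fun τ hτ a ha => ?_,
    fun τ hτ F => ?_, fun τ hτ F hF => ?_⟩⟩
  · have := hsub F
    rw [LinearMap.comp_apply] at h
    rwa [h, sub_zero] at this
  · by_contra hne
    have h1 : monRem A (divSeries A g F) ∈ I := by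
      have := I.sub_mem h (hsub F)
      rwa [sub_sub_cancel] at this
    obtain ⟨α, hα, hmin⟩ := exists_leading hne
    have hα' := hα
    rw [LinearMap.comp_apply, coeff_monRem, if_pos (hMA α ⟨_, h1, hα, hmin⟩)] at hα'
    exact hα' rfl
  · rw [LinearMap.comp_apply, coeff_monRem, coeff_divSeries_eq_zero hg hF hγ, ite_self]
  · rw [LinearMap.comp_apply, coeff_monRem, if_pos h]
  · rw [LinearMap.comp_apply, divSeries_monomial h]
    ext β
    rw [coeff_monRem]
    split_ifs with hβ
    · rw [coeff_monomial_ne]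
      rintro rfl
      exact h hβ
    · rfl
  · have : g a = (g a - monomial a 1) + monomial a 1 := by ring
    rw [this]
    refine nrm_add_le.trans_lt (ENNReal.add_lt_top.2 ⟨(hs τ hτ a ha).trans_lt ?_, ?_⟩)
    · exact ENNReal.mul_lt_top (by simp) ENNReal.coe_lt_top
    · rw [nrm_monomial]
      exact ENNReal.mul_lt_top enorm_lt_top ENNReal.coe_lt_top
  · exact nrm_monRem_le.trans (nrm_divSeries_le (hs τ hτ) hg F)
  · refine ⟨fun a => monQuo A a (divSeries A g F), fun a ha => nrm_monQuo_lt_top (rad_pos τ) ?_ ha,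
      division hg F⟩
    exact (nrm_divSeries_le (hs τ hτ) hg F).trans_lt (ENNReal.mul_lt_top (by simp) hF)

variable {S : Set (MvPowerSeries ι ℂ)}

/-- An element of the ideal generated by `S` vanishes at the common zeros of the standard basis in
every polydisc `rad τ`, `τ ≥ τ₀`, on which it converges: the neighbourhood does not depend on the
element. -/
lemma StandardBasis.ev_eq_zero (B : StandardBasis S) {τ : ℕ} (hτ : B.τ₀ ≤ τ)
    {F : MvPowerSeries ι ℂ} (hF : F ∈ Ideal.span S) (hF' : nrm (rad τ) F < ∞) {z : ι → ℂ}
    (hz : z ∈ polydisc (rad τ)) (hgz : ∀ a ∈ B.A, ev z (B.g a) = 0) : ev z F = 0 := by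
  obtain ⟨q, hq, h⟩ := B.division τ hτ F hF'
  rw [(B.R_eq_zero_iff F).2 hF, zero_add] at h
  rw [h, ev_sum B.A (fun a ha => nrm_mul_lt_top (hq a ha) (B.nrm_g τ hτ a ha)) hz]
  refine Finset.sum_eq_zero fun a ha => ?_
  rw [ev_mul (hq a ha) (B.nrm_g τ hτ a ha) hz, hgz a ha, mul_zero]

end StandardBasis

/-! ### A Nullstellensatz for formal ideals of convergent series -/

section BanachAlgebra

open MvPowerSeries

variable {ι : Type*} [Fintype ι]

variable (ι) in
/-- The Banach algebra of power series that converge absolutely on the closed polydisc of polyradius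
`rad τ`, with the weighted `ℓ¹` norm. -/
def wAlg (τ : ℕ) : Subalgebra ℂ (MvPowerSeries ι ℂ) where
  carrier := {F | nrm (rad τ) F < ∞}
  mul_mem' := nrm_mul_lt_top
  add_mem' h h' := nrm_add_le.trans_lt (ENNReal.add_lt_top.2 ⟨h, h'⟩)
  algebraMap_mem' c := by
    have : algebraMap ℂ (MvPowerSeries ι ℂ) c = c • 1 := Algebra.algebraMap_eq_smul_one c
    change nrm _ _ < ∞
    rw [this, nrm_smul, nrm_one, mul_one]
    exact enorm_lt_top

variable {τ : ℕ}

lemma nrm_lt_top_of_wAlg (x : wAlg ι τ) : nrm (rad τ) (x : MvPowerSeries ι ℂ) < ∞ := x.2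

lemma eq_zero_of_nrm_eq_zero {F : MvPowerSeries ι ℂ} (h : nrm (rad τ) F = 0) : F = 0 := by
  ext α
  have h1 := (ENNReal.tsum_eq_zero.1 h) α
  rw [mul_eq_zero, enorm_eq_zero] at h1
  exact h1.resolve_right (by exact_mod_cast (mon_rad_pos τ α).ne')

variable (ι τ) in
/-- The weighted `ℓ¹` norm as a ring norm. -/
def wNorm : RingNorm (wAlg ι τ) where
  toFun x := (nrm (rad τ) (x : MvPowerSeries ι ℂ)).toReal
  map_zero' := by simp
  add_le' x y := by
    rw [← ENNReal.toReal_add (nrm_lt_top_of_wAlg x).ne (nrm_lt_top_of_wAlg y).ne]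
    exact ENNReal.toReal_mono (ENNReal.add_ne_top.2
      ⟨(nrm_lt_top_of_wAlg x).ne, (nrm_lt_top_of_wAlg y).ne⟩) nrm_add_le
  neg' x := by simp
  mul_le' x y := by
    rw [← ENNReal.toReal_mul]
    exact ENNReal.toReal_mono (ENNReal.mul_ne_top
      (nrm_lt_top_of_wAlg x).ne (nrm_lt_top_of_wAlg y).ne) nrm_mul_le
  eq_zero_of_map_eq_zero' x h :=
    Subtype.ext (eq_zero_of_nrm_eq_zero
      (((ENNReal.toReal_eq_zero_iff _).1 h).resolve_right (nrm_lt_top_of_wAlg x).ne))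

instance : NormedCommRing (wAlg ι τ) :=
  { RingNorm.toNormedRing (wNorm ι τ) with mul_comm := mul_comm }

lemma norm_wAlg (x : wAlg ι τ) : ‖x‖ = (nrm (rad τ) (x : MvPowerSeries ι ℂ)).toReal := rfl

lemma enorm_wAlg (x : wAlg ι τ) : ‖x‖ₑ = nrm (rad τ) (x : MvPowerSeries ι ℂ) := by
  rw [← ofReal_norm, norm_wAlg, ENNReal.ofReal_toReal (nrm_lt_top_of_wAlg x).ne]

instance : NormedAlgebra ℂ (wAlg ι τ) where
  norm_smul_le c x := by
    rw [norm_wAlg, norm_wAlg, Subalgebra.coe_smul, nrm_smul, ENNReal.toReal_mul]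
    simp

instance : NormOneClass (wAlg ι τ) where
  norm_one := by
    rw [norm_wAlg, Subalgebra.coe_one, nrm_one]
    simp

instance : CompleteSpace (wAlg ι τ) := by
  refine NormedAddCommGroup.completeSpace_of_summable_imp_tendsto fun u hu => ?_
  have hu' : ∑' n, nrm (rad τ) (u n : MvPowerSeries ι ℂ) ≠ ∞ := by
    have h := hu.tsum_ofReal_ne_top
    refine ne_of_eq_of_ne (tsum_congr fun n => ?_) h
    rw [ofReal_norm, enorm_wAlg]
  have hsum : ∀ α, Summable fun n => coeff α (u n : MvPowerSeries ι ℂ) := by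
    intro α
    refine (summable_norm_of_tsum_enorm_lt_top (lt_top_iff_ne_top.2 fun htop => ?_)).of_norm
    refine hu' (top_le_iff.1 ?_)
    have h1 : (∑' n, ‖coeff α (u n : MvPowerSeries ι ℂ)‖ₑ) * (mon (rad τ) α : ℝ≥0) ≤
        ∑' n, nrm (rad τ) (u n : MvPowerSeries ι ℂ) := by
      rw [← ENNReal.tsum_mul_right]
      exact ENNReal.tsum_le_tsum fun n => le_nrm α
    rwa [htop, ENNReal.top_mul (by exact_mod_cast (mon_rad_pos τ α).ne')] at h1
  set F : MvPowerSeries ι ℂ := fun α => ∑' n, coeff α (u n : MvPowerSeries ι ℂ) with hF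
  have hcF : ∀ α, coeff α F = ∑' n, coeff α (u n : MvPowerSeries ι ℂ) := fun _ => rfl
  have htail : ∀ n, nrm (rad τ) (F - ∑ k ∈ Finset.range n, (u k : MvPowerSeries ι ℂ)) ≤
      ∑' k, nrm (rad τ) (u (k + n) : MvPowerSeries ι ℂ) := by
    intro n
    have h2 : ∀ α, ‖coeff α (F - ∑ k ∈ Finset.range n, (u k : MvPowerSeries ι ℂ))‖ₑ ≤
        ∑' k, ‖coeff α (u (k + n) : MvPowerSeries ι ℂ)‖ₑ := by
      intro α
      rw [map_sub, map_sum, hcF, ← (hsum α).sum_add_tsum_nat_add n, add_sub_cancel_left]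
      exact enorm_tsum_le_tsum_enorm
    calc _ ≤ ∑' α, (∑' k, ‖coeff α (u (k + n) : MvPowerSeries ι ℂ)‖ₑ) *
          ((mon (rad τ) α : ℝ≥0) : ℝ≥0∞) := ENNReal.tsum_le_tsum fun α => by gcongr; exact h2 α
      _ = ∑' α, ∑' k, ‖coeff α (u (k + n) : MvPowerSeries ι ℂ)‖ₑ *
          ((mon (rad τ) α : ℝ≥0) : ℝ≥0∞) := tsum_congr fun α => ENNReal.tsum_mul_right.symm
      _ = _ := ENNReal.tsum_comm
  have hFm : nrm (rad τ) F < ∞ := by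
    have := htail 0
    simp only [Finset.range_zero, Finset.sum_empty, sub_zero, add_zero] at this
    exact this.trans_lt (lt_top_iff_ne_top.2 hu')
  refine ⟨⟨F, hFm⟩, ?_⟩
  rw [tendsto_iff_norm_sub_tendsto_zero]
  have hlim := ENNReal.tendsto_sum_nat_add
    (fun n => nrm (rad τ) (u n : MvPowerSeries ι ℂ)) hu'
  have hlim2 : Tendsto (fun n =>
      nrm (rad τ) (F - ∑ k ∈ Finset.range n, (u k : MvPowerSeries ι ℂ))) atTop (𝓝 0) :=
    tendsto_of_tendsto_of_tendsto_of_le_of_le tendsto_const_nhds hlim (fun _ => zero_le) htail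
  have hlim3 := (ENNReal.tendsto_toReal ENNReal.zero_ne_top).comp hlim2
  refine hlim3.congr fun n => ?_
  rw [norm_sub_rev, norm_wAlg, Subalgebra.coe_sub, Function.comp_apply]
  simp

/-- The variable `X i` as an element of the Banach algebra. -/
def wX (τ : ℕ) (i : ι) : wAlg ι τ := ⟨X i, by
  change nrm _ _ < ∞
  rw [X, nrm_monomial]
  exact ENNReal.mul_lt_top enorm_lt_top ENNReal.coe_lt_top⟩

lemma norm_wX (i : ι) : ‖wX τ i‖ = rad τ i := by
  rw [norm_wAlg]
  change (nrm (rad τ) (monomial (Finsupp.single i 1) (1 : ℂ))).toReal = _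
  rw [nrm_monomial, mon_single]
  simp

lemma coe_mon_wX (α : ι →₀ ℕ) : ((mon (wX τ) α : wAlg ι τ) : MvPowerSeries ι ℂ) = monomial α 1 := by
  classical
  have := map_mon (wAlg ι τ).val (wX τ) α
  rw [Subalgebra.val_apply] at this
  rw [this, monomial_one_eq]
  simp only [mon, wX, Subalgebra.val_apply]
  exact (Finsupp.prod_fintype α _ fun i => pow_zero _).symm

/-- The characters of the Banach algebra are the evaluations at the points of the polydisc. -/
lemma character_eq_ev (ψ : wAlg ι τ →ₐ[ℂ] ℂ) :
    (fun i => ψ (wX τ i)) ∈ polydisc (rad τ) ∧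
      ∀ x : wAlg ι τ, ψ x = ev (fun i => ψ (wX τ i)) (x : MvPowerSeries ι ℂ) := by
  classical
  have hz : (fun i => ψ (wX τ i)) ∈ polydisc (rad τ) := fun i => by
    rw [← NNReal.coe_le_coe, coe_nnnorm]
    exact (AlgHom.norm_apply_le_self ψ _).trans (norm_wX i).le
  refine ⟨hz, fun x => ?_⟩
  refine HasSum.unique ?_ (hasSum_ev (nrm_lt_top_of_wAlg x) hz)
  rw [HasSum, SummationFilter.unconditional_filter, tendsto_iff_norm_sub_tendsto_zero]
  set f : (ι →₀ ℕ) → ℝ≥0∞ := fun α => ‖coeff α (x : MvPowerSeries ι ℂ)‖ₑ *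
    ((mon (rad τ) α : ℝ≥0) : ℝ≥0∞)
  have hlim := (ENNReal.tendsto_toReal ENNReal.zero_ne_top).comp
    (ENNReal.tendsto_tsum_compl_atTop_zero (f := f) (nrm_lt_top_of_wAlg x).ne)
  refine squeeze_zero (fun _ => norm_nonneg _) (fun s => ?_) hlim
  have h1 : ∑ α ∈ s, coeff α (x : MvPowerSeries ι ℂ) * mon (fun i => ψ (wX τ i)) α - ψ x =
      ψ (∑ α ∈ s, coeff α (x : MvPowerSeries ι ℂ) • mon (wX τ) α - x) := by
    rw [map_sub, map_sum]
    simp only [map_smul, map_mon, smul_eq_mul]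
  rw [h1, ← norm_neg, ← map_neg, neg_sub]
  refine (AlgHom.norm_apply_le_self ψ _).trans ?_
  rw [norm_wAlg, Function.comp_apply]
  refine ENNReal.toReal_mono ?_ ?_
  · exact ((ENNReal.tsum_comp_le_tsum_of_injective Subtype.val_injective f).trans_lt
      (nrm_lt_top_of_wAlg x)).ne
  · have h2 : ∀ γ, coeff γ ((x - ∑ α ∈ s, coeff α (x : MvPowerSeries ι ℂ) • mon (wX τ) α :
        wAlg ι τ) : MvPowerSeries ι ℂ) = if γ ∈ s then 0 else coeff γ (x : MvPowerSeries ι ℂ) := by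
      intro γ
      rw [Subalgebra.coe_sub, map_sub, AddSubmonoidClass.coe_finsetSum, map_sum]
      simp only [Subalgebra.coe_smul, coe_mon_wX, map_smul, coeff_monomial, smul_eq_mul, mul_ite,
        mul_one, mul_zero, Finset.sum_ite_eq]
      split_ifs <;> simp
    rw [nrm]
    simp only [h2]
    change _ ≤ ∑' b : ({a | a ∉ s} : Set (ι →₀ ℕ)), f b
    rw [tsum_subtype {a | a ∉ s} f]
    refine ENNReal.tsum_le_tsum fun γ => ?_
    by_cases hγ : γ ∈ s <;> simp [hγ, f]

end BanachAlgebra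

/-- The powers of a quasi-nilpotent element decay faster than any geometric progression. -/
lemma exists_norm_pow_le_of_spectralRadius_eq_zero {A : Type*} [NormedRing A] [NormedAlgebra ℂ A]
    [CompleteSpace A] {a : A} (ha : spectralRadius ℂ a = 0) {c : ℝ} (hc : 0 < c) :
    ∃ C > 0, ∀ n, ‖a ^ n‖ ≤ C * c ^ n := by
  have h := spectrum.pow_norm_pow_one_div_tendsto_nhds_spectralRadius a
  rw [ha] at h
  obtain ⟨n₀, hn₀⟩ := eventually_atTop.1
    (h.eventually (gt_mem_nhds (ENNReal.ofReal_pos.2 hc)))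
  refine ⟨1 + ∑ k ∈ Finset.range (n₀ + 1), ‖a ^ k‖ / c ^ k, by positivity, fun n => ?_⟩
  rw [← div_le_iff₀ (by positivity)]
  have hnn : ∀ k, 0 ≤ ‖a ^ k‖ / c ^ k := fun k => by positivity
  rcases le_or_gt n n₀ with hn | hn
  · have := Finset.single_le_sum (f := fun k => ‖a ^ k‖ / c ^ k) (fun k _ => hnn k)
      (Finset.mem_range.2 (Nat.lt_succ_of_le hn))
    linarith
  · have h1 : ‖a ^ n‖ ^ (1 / n : ℝ) < c := (ENNReal.ofReal_lt_ofReal_iff hc).1 (hn₀ n hn.le)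
    have h2 : ‖a ^ n‖ ≤ c ^ n := by
      have h3 := pow_le_pow_left₀ (by positivity) h1.le n
      rwa [← Real.rpow_natCast, ← Real.rpow_mul (norm_nonneg _), one_div,
        inv_mul_cancel₀ (by exact_mod_cast (by omega : n ≠ 0)), Real.rpow_one] at h3
    have h4 : ‖a ^ n‖ / c ^ n ≤ 1 := (div_le_one (by positivity)).2 h2
    have : 0 ≤ ∑ k ∈ Finset.range (n₀ + 1), ‖a ^ k‖ / c ^ k := Finset.sum_nonneg fun k _ => hnn k
    linarith

section Nullstellensatz

open MvPowerSeries

variable {ι : Type*} [Fintype ι] {S : Set (MvPowerSeries ι ℂ)}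

/-- If no power of some variable lies in the ideal, there are monomials of arbitrarily high degree
outside the ideal of leading monomials. -/
lemma StandardBasis.exists_standard_monomial (B : StandardBasis S)
    (hi : ∃ i, ∀ l, (X i : MvPowerSeries ι ℂ) ^ l ∉ Ideal.span S) (K : ℕ) :
    ∃ γ, (¬∃ a ∈ B.A, a ≤ γ) ∧ K < num γ := by
  classical
  obtain ⟨i, hi⟩ := hi
  by_contra! h
  refine hi K ((B.R_eq_zero_iff _).1 ?_)
  ext γ
  rw [coeff_zero]
  by_cases hγ : ∃ a ∈ B.A, a ≤ γ
  · exact B.coeff_R_of_le _ γ hγ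
  · refine B.coeff_R_eq_zero _ (K + 1) (fun δ hδ => ?_) γ
      (Nat.lt_succ_of_le (h γ (by simpa using hγ)))
    rw [X_pow_eq]
    refine coeff_monomial_ne ?_ _
    rintro rfl
    rw [num, mon_single] at hδ
    have h1 := Nat.pow_le_pow_left (prm_prime i).two_le K
    have h2 := Nat.lt_two_pow_self (n := K)
    omega

/-- A zero-dimensional Nullstellensatz: if the ideal generated by `S` contains no power of some
variable, then its standard basis has common zeros other than `0` in all small polydiscs. Otherwise
the origin would be the only character of the quotient of the Banach algebra by the ideal, so that
the variables would be quasi-nilpotent in that quotient; but the norm of a monomial outside the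
ideal of leading monomials does not drop in the quotient by more than a factor `2`. -/
theorem StandardBasis.exists_ne_zero (B : StandardBasis S)
    (hi : ∃ i, ∀ l, (X i : MvPowerSeries ι ℂ) ^ l ∉ Ideal.span S) {τ : ℕ} (hτ : B.τ₀ ≤ τ) :
    ∃ z ∈ polydisc (rad τ), z ≠ 0 ∧ ∀ a ∈ B.A, ev z (B.g a) = 0 := by
  classical
  by_contra! h
  set I : Ideal (wAlg ι τ) := (Ideal.span S).comap (wAlg ι τ).val.toRingHom with hI
  have hmemI : ∀ x : wAlg ι τ, x ∈ I ↔ (x : MvPowerSeries ι ℂ) ∈ Ideal.span S := fun x => Iff.rfl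
  -- The ideal is closed, because `R` is bounded: the quotient is a Banach algebra.
  have : IsClosed (I : Set (wAlg ι τ)) := by
    refine isClosed_of_closure_subset fun x hx => ?_
    rw [SetLike.mem_coe, hmemI, ← B.R_eq_zero_iff]
    refine eq_zero_of_nrm_eq_zero (τ := τ) (nonpos_iff_eq_zero.1 ?_)
    refine le_of_forall_gt fun ε hε => ?_
    have hε2 : 0 < ε / 2 := ENNReal.half_pos hε.ne'
    obtain ⟨y, hy, hxy⟩ := EMetric.mem_closure_iff.1 hx (ε / 2) hε2
    have h1 : B.R (x : MvPowerSeries ι ℂ) = B.R ((x - y : wAlg ι τ) : MvPowerSeries ι ℂ) := by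
      rw [Subalgebra.coe_sub, map_sub, (B.R_eq_zero_iff _).2 ((hmemI y).1 hy), sub_zero]
    rw [h1]
    refine (B.nrm_R τ hτ _).trans_lt ?_
    rw [← enorm_wAlg, ← edist_eq_enorm_sub, mul_comm]
    exact (ENNReal.lt_div_iff_mul_lt (by simp) (by simp)).1 hxy
  let Q := wAlg ι τ ⧸ I
  let x : ι → Q := fun i => Ideal.Quotient.mk I (wX τ i)
  have hspec : ∀ i, spectralRadius ℂ (x i) = 0 := by
    intro i
    refine le_antisymm (iSup₂_le fun k hk => ?_) zero_le
    obtain ⟨φ, rfl⟩ := WeakDual.CharacterSpace.mem_spectrum_iff_exists.1 hk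
    set ψ : wAlg ι τ →ₐ[ℂ] ℂ :=
      (WeakDual.CharacterSpace.toAlgHom φ).comp (Ideal.Quotient.mkₐ ℂ I) with hψ
    obtain ⟨hz, hev⟩ := character_eq_ev ψ
    have h0 : (fun i => ψ (wX τ i)) = 0 := by
      by_contra hne
      obtain ⟨a, ha, hne'⟩ := h _ hz hne
      have hga : (⟨B.g a, B.nrm_g τ hτ a ha⟩ : wAlg ι τ) ∈ I := by
        rw [hmemI]
        exact (Submodule.span_le.2 fun x hx => Ideal.subset_span hx :
          Submodule.span (MvPolynomial ι ℂ) S ≤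
            (Ideal.span S).restrictScalars (MvPolynomial ι ℂ)) (B.mem_span a ha)
      refine hne' ?_
      rw [← hev ⟨B.g a, B.nrm_g τ hτ a ha⟩, hψ, AlgHom.comp_apply, Ideal.Quotient.mkₐ_eq_mk,
        Ideal.Quotient.eq_zero_iff_mem.2 hga, map_zero]
    have h1 : φ (x i) = 0 := congrFun h0 i
    rw [h1]
    simp
  have hC : ∀ i, ∃ C > 0, ∀ n, ‖x i ^ n‖ ≤ C * ((rad τ i : ℝ) / 2) ^ n := fun i =>
    exists_norm_pow_le_of_spectralRadius_eq_zero (hspec i)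
      (half_pos (NNReal.coe_pos.2 (rad_pos τ i)))
  choose C hC0 hC using hC
  set C' := ∏ i, C i with hC'
  -- The two estimates of the norm of a standard monomial in the quotient are incompatible when its
  -- degree is large.
  obtain ⟨D, hD⟩ := pow_unbounded_of_one_lt (2 * C') (one_lt_two)
  obtain ⟨γ, hγ, hK⟩ := B.exists_standard_monomial hi ((∏ i : ι, prm i) ^ D)
  set w : ℝ := ((mon (rad τ) γ : ℝ≥0) : ℝ) with hw
  have hw0 : 0 < w := NNReal.coe_pos.2 (mon_rad_pos τ γ)
  have hdeg : D ≤ ∑ i, γ i := by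
    by_contra hlt
    have h1 : num γ ≤ (∏ i : ι, prm i) ^ (∑ i, γ i) := by
      rw [num, mon, ← Finset.prod_pow_eq_pow_sum]
      exact Finset.prod_le_prod' fun i _ => Nat.pow_le_pow_left
        (Finset.single_le_prod' (fun j _ => (prm_prime j).one_le) (Finset.mem_univ i)) _
    have h2 : (∏ i : ι, prm i) ^ (∑ i, γ i) ≤ (∏ i : ι, prm i) ^ D :=
      Nat.pow_le_pow_right (Finset.prod_pos fun i _ => (prm_prime i).pos) (by omega)
    omega
  have hupper : ‖mon x γ‖ ≤ C' * (w * (1 / 2) ^ (∑ i, γ i)) := by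
    have hne : (Finset.univ : Finset ι).Nonempty := by
      obtain ⟨i, -⟩ := hi
      exact ⟨i, Finset.mem_univ i⟩
    refine (Finset.norm_prod_le' _ hne _).trans ?_
    refine (Finset.prod_le_prod (fun i _ => norm_nonneg _) fun i _ => hC i (γ i)).trans (le_of_eq ?_)
    have h1 : ∏ i, ((rad τ i : ℝ) / 2) ^ γ i = w * (1 / 2) ^ (∑ i, γ i) := by
      rw [← Finset.prod_pow_eq_pow_sum, hw, mon]
      push_cast
      rw [← Finset.prod_mul_distrib]
      exact Finset.prod_congr rfl fun i _ => by rw [← mul_pow, mul_one_div]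
    rw [Finset.prod_mul_distrib, h1]
  have hlower : w ≤ 2 * ‖mon x γ‖ := by
    refine le_of_forall_pos_le_add fun ε hε => ?_
    obtain ⟨y, hy, hylt⟩ := Ideal.Quotient.norm_mk_lt (mon x γ) (half_pos hε)
    have hmk : mon x γ = Ideal.Quotient.mk I (mon (wX τ) γ) :=
      (map_mon (Ideal.Quotient.mk I) _ _).symm
    rw [hmk, Ideal.Quotient.eq] at hy
    have h1 : B.R (y : MvPowerSeries ι ℂ) = monomial γ 1 := by
      have := (B.R_eq_zero_iff _).2 ((hmemI _).1 hy)
      rwa [Subalgebra.coe_sub, coe_mon_wX, map_sub, B.R_monomial γ hγ, sub_eq_zero] at this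
    have h2 := B.nrm_R τ hτ (y : MvPowerSeries ι ℂ)
    rw [h1, nrm_monomial, ← enorm_wAlg] at h2
    have h3 := ENNReal.toReal_mono (ENNReal.mul_ne_top (by simp) enorm_ne_top) h2
    simp only [enorm_one, one_mul, ENNReal.toReal_mul, toReal_enorm, ENNReal.coe_toReal,
      ENNReal.toReal_ofNat] at h3
    linarith
  have hfin : (2 : ℝ) ^ (∑ i, γ i) ≤ 2 * C' := by
    have h1 : w ≤ 2 * (C' * (w * (1 / 2) ^ (∑ i, γ i))) := hlower.trans (by linarith)
    have h2 : w * 2 ^ (∑ i, γ i) ≤ w * (2 * C') := by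
      calc w * 2 ^ (∑ i, γ i) ≤ (2 * (C' * (w * (1 / 2) ^ (∑ i, γ i)))) * 2 ^ (∑ i, γ i) := by gcongr
        _ = w * (2 * C') * ((1 / 2) ^ (∑ i, γ i) * 2 ^ (∑ i, γ i)) := by ring
        _ = _ := by rw [← mul_pow]; norm_num
    exact le_of_mul_le_mul_left h2 hw0
  have h4 : (2 : ℝ) ^ D ≤ 2 ^ (∑ i, γ i) := pow_le_pow_right₀ one_le_two hdeg
  linarith

end Nullstellensatz

/-! ### Taylor series of holomorphic functions -/

section Taylor

open MvPowerSeries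

/-- The exponent of the monomial `∏ k, x (s k)` that belongs to a word `s` in the variables. -/
def expo {ι : Type*} (t : Σ n, Fin n → ι) : ι →₀ ℕ := ∑ k, Finsupp.single (t.2 k) 1

lemma mon_expo {ι : Type*} [Fintype ι] {M : Type*} [CommMonoid M] (x : ι → M) (t : Σ n, Fin n → ι) :
    mon x (expo t) = ∏ k, x (t.2 k) := by
  classical
  have h : ∀ s : Finset (Fin t.1), mon x (∑ k ∈ s, Finsupp.single (t.2 k) 1) =
      ∏ k ∈ s, x (t.2 k) := fun s => by
    induction s using Finset.induction_on with
    | empty => simp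
    | insert a s ha ih =>
      rw [Finset.sum_insert ha, Finset.prod_insert ha, mon_add, ih, mon_single, pow_one]
  exact h _

lemma expo_surjective {ι : Type*} : Function.Surjective (expo : (Σ n, Fin n → ι) → ι →₀ ℕ) := by
  intro α
  induction α using Finsupp.induction_linear with
  | zero => exact ⟨⟨0, Fin.elim0⟩, by simp [expo]⟩
  | add α β hα hβ =>
    obtain ⟨⟨n, s⟩, rfl⟩ := hα
    obtain ⟨⟨m, t⟩, rfl⟩ := hβ
    refine ⟨⟨n + m, Fin.append s t⟩, ?_⟩
    simp [expo, Fin.sum_univ_add]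
  | single i k => exact ⟨⟨k, fun _ => i⟩, by simp [expo]⟩

/-- The power series whose coefficients are the sums of a family `c` over the words with a given
exponent. -/
def wordSeries {ι : Type*} (c : (Σ n, Fin n → ι) → ℂ) : MvPowerSeries ι ℂ :=
  fun α => ∑' t : {t // expo t = α}, c t

lemma coeff_wordSeries {ι : Type*} (c : (Σ n, Fin n → ι) → ℂ) (α : ι →₀ ℕ) :
    coeff α (wordSeries c) = ∑' t : {t // expo t = α}, c t := rfl

variable {ι : Type*} [Fintype ι]

lemma nrm_wordSeries_le (c : (Σ n, Fin n → ι) → ℂ) (ρ : ι → ℝ≥0) :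
    nrm ρ (wordSeries c) ≤ ∑' t, ‖c t‖ₑ * ((mon ρ (expo t) : ℝ≥0) : ℝ≥0∞) := by
  rw [← (Equiv.sigmaFiberEquiv expo).tsum_eq, ENNReal.tsum_sigma']
  refine ENNReal.tsum_le_tsum fun α => ?_
  rw [coeff_wordSeries]
  calc _ ≤ (∑' t : {t // expo t = α}, ‖c t‖ₑ) * ((mon ρ α : ℝ≥0) : ℝ≥0∞) := by
        gcongr
        exact enorm_tsum_le_tsum_enorm
    _ = _ := by
        rw [← ENNReal.tsum_mul_right]
        refine tsum_congr fun t => ?_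
        rw [Equiv.sigmaFiberEquiv_apply, t.2]

lemma ev_wordSeries {c : (Σ n, Fin n → ι) → ℂ} {z : ι → ℂ}
    (h : Summable fun t => c t * mon z (expo t)) :
    ev z (wordSeries c) = ∑' t, c t * mon z (expo t) := by
  rw [← (Equiv.sigmaFiberEquiv expo).tsum_eq]
  refine Eq.trans ?_ (Summable.tsum_sigma (((Equiv.sigmaFiberEquiv expo).summable_iff).2 h)).symm
  refine tsum_congr fun α => ?_
  rw [coeff_wordSeries, ← tsum_mul_right]
  refine tsum_congr fun t => ?_
  rw [Function.comp_apply, Equiv.sigmaFiberEquiv_apply, t.2]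

lemma summable_word {c : (Σ n, Fin n → ι) → ℂ} {ρ : ι → ℝ≥0} {z : ι → ℂ} (hz : z ∈ polydisc ρ)
    (h : ∑' t, ‖c t‖ₑ * ((mon ρ (expo t) : ℝ≥0) : ℝ≥0∞) < ∞) :
    Summable fun t => c t * mon z (expo t) := by
  refine (summable_norm_of_tsum_enorm_lt_top (lt_of_le_of_lt
    (ENNReal.tsum_le_tsum fun t => ?_) h)).of_norm
  rw [enorm_mul]
  gcongr
  exact enorm_mon_le hz _

/-- Expansion of a multilinear map on the diagonal in the standard basis: a sum over words in the
variables. -/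
lemma multilinear_eq_sum_words {n : ℕ} (p : ContinuousMultilinearMap ℂ (fun _ : Fin n => ι → ℂ) ℂ)
    (z : ι → ℂ) [DecidableEq ι] :
    p (fun _ => z) = ∑ s : Fin n → ι, p (fun k => Pi.single (s k) 1) * mon z (expo ⟨n, s⟩) := by
  have hz : z = ∑ i, z i • (Pi.single i 1 : ι → ℂ) := by
    ext j
    simp [Finset.sum_apply, Pi.single_apply]
  conv_lhs => rw [hz]
  rw [p.map_sum]
  refine Finset.sum_congr rfl fun s _ => ?_
  rw [p.map_smul_univ, mon_expo, smul_eq_mul, mul_comm]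

/-- Every function that is analytic at `0` has an absolutely convergent Taylor series. -/
lemma exists_taylorSeries {f : (ι → ℂ) → ℂ} (hf : AnalyticAt ℂ f 0) :
    ∃ F : MvPowerSeries ι ℂ, ∃ τ, nrm (rad τ) F < ∞ ∧ ∀ z ∈ polydisc (rad τ), f z = ev z F := by
  classical
  obtain ⟨p, r, hp⟩ := hf
  obtain ⟨ρ, hρ0, hρr⟩ := ENNReal.lt_iff_exists_nnreal_btwn.1 hp.r_pos
  have hρ0' : 0 < ρ := by exact_mod_cast hρ0
  obtain ⟨C, hC, hbound⟩ := p.norm_mul_pow_le_of_lt_radius (hρr.trans_le hp.r_le)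
  set m : ℕ := Fintype.card ι with hm
  set ρ' : ℝ≥0 := ρ / (2 * (m + 1)) with hρ'
  have hρ'0 : 0 < ρ' := by positivity
  have hρ'ρ : ρ' < ρ := by
    rw [hρ', div_lt_iff₀ (by positivity)]
    have : (1 : ℝ≥0) < 2 * (m + 1) := by
      rw [mul_add]
      have : (0 : ℝ≥0) ≤ 2 * m := zero_le
      calc (1 : ℝ≥0) < 2 * 1 := by norm_num
        _ ≤ _ := le_add_self
    exact lt_mul_of_one_lt_right hρ0' this
  set c : (Σ n, Fin n → ι) → ℂ := fun t => p t.1 (fun k => Pi.single (t.2 k) 1) with hc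
  have hcn : ∀ t, ‖c t‖₊ ≤ ‖p t.1‖₊ := fun t => by
    refine ((p t.1).le_opNNNorm _).trans
      (mul_le_of_le_one_right' (Finset.prod_le_one' fun k _ => ?_))
    rw [Pi.nnnorm_single, nnnorm_one]
  have hsum : ∑' t, ‖c t‖ₑ * ((mon (fun _ : ι => ρ') (expo t) : ℝ≥0) : ℝ≥0∞) < ∞ := by
    rw [ENNReal.tsum_sigma']
    have h1 : ∀ n, ∑' s : Fin n → ι, ‖c ⟨n, s⟩‖ₑ *
        ((mon (fun _ : ι => ρ') (expo ⟨n, s⟩) : ℝ≥0) : ℝ≥0∞) ≤ ENNReal.ofReal C * 2⁻¹ ^ n := by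
      intro n
      have h2 : ∀ s : Fin n → ι, ‖c ⟨n, s⟩‖ₑ *
          ((mon (fun _ : ι => ρ') (expo ⟨n, s⟩) : ℝ≥0) : ℝ≥0∞) ≤ ‖p n‖₊ * (ρ' : ℝ≥0∞) ^ n := by
        intro s
        rw [mon_expo]
        simp only [Finset.prod_const, Finset.card_univ, Fintype.card_fin, ENNReal.coe_pow,
          enorm_eq_nnnorm]
        gcongr
        exact hcn ⟨n, s⟩
      refine (ENNReal.tsum_le_tsum h2).trans ?_
      rw [tsum_fintype, Finset.sum_const, Finset.card_univ, Fintype.card_fun, Fintype.card_fin,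
        ← hm, nsmul_eq_mul]
      have h3 : ‖p n‖₊ * ρ ^ n ≤ C.toNNReal := by
        rw [← NNReal.coe_le_coe, Real.coe_toNNReal _ hC.le]
        exact_mod_cast hbound n
      have h4 : ((m ^ n : ℕ) : ℝ≥0) * (‖p n‖₊ * ρ' ^ n) ≤ C.toNNReal * 2⁻¹ ^ n := by
        calc ((m ^ n : ℕ) : ℝ≥0) * (‖p n‖₊ * ρ' ^ n)
            = (‖p n‖₊ * ρ ^ n) * (m / (2 * (m + 1))) ^ n := by
              rw [hρ', div_pow, div_pow]
              push_cast
              ring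
          _ ≤ C.toNNReal * 2⁻¹ ^ n := by
              gcongr
              rw [div_le_iff₀ (by positivity), ← mul_assoc, inv_mul_cancel₀ two_ne_zero, one_mul]
              exact le_self_add
      calc _ = ((((m ^ n : ℕ) : ℝ≥0) * (‖p n‖₊ * ρ' ^ n) : ℝ≥0) : ℝ≥0∞) := by push_cast; rfl
        _ ≤ ((C.toNNReal * 2⁻¹ ^ n : ℝ≥0) : ℝ≥0∞) := by exact_mod_cast h4
        _ = _ := by
          rw [ENNReal.ofReal]
          push_cast
          rfl
    refine (ENNReal.tsum_le_tsum h1).trans_lt ?_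
    rw [ENNReal.tsum_mul_left, ENNReal.tsum_geometric, ENNReal.one_sub_inv_two, inv_inv]
    exact ENNReal.mul_lt_top ENNReal.ofReal_lt_top (by simp)
  obtain ⟨τ, hτ⟩ := exists_rad_le (ι := ι) (ρ := fun _ => ρ') fun _ => hρ'0
  refine ⟨wordSeries c, τ, ?_, fun z hz => ?_⟩
  · exact (nrm_mono (hτ τ le_rfl) _).trans_lt ((nrm_wordSeries_le c _).trans_lt hsum)
  · have hz' : z ∈ polydisc fun _ => ρ' := polydisc_mono (hτ τ le_rfl) hz
    have hs := summable_word hz' hsum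
    rw [ev_wordSeries hs, Summable.tsum_sigma hs]
    have hzb : z ∈ Metric.eball (0 : ι → ℂ) r := by
      rw [mem_eball_zero_iff]
      refine lt_of_le_of_lt ?_ hρr
      rw [enorm_eq_nnnorm, ENNReal.coe_le_coe]
      exact pi_nnnorm_le_iff.2 fun i => (hz' i).trans hρ'ρ.le
    have := hp.hasSum hzb
    rw [zero_add] at this
    rw [← this.tsum_eq]
    refine tsum_congr fun n => ?_
    rw [multilinear_eq_sum_words, tsum_fintype]

lemma hasTaylorSeries_of_eqOn {f : (ι → ℂ) → ℂ} {F : MvPowerSeries ι ℂ} {τ : ℕ}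
    (hF : nrm (rad τ) F < ∞) (h : ∀ᶠ z in 𝓝 0, f z = ev z F) : HasTaylorSeries f F := by
  filter_upwards [h, polydisc_mem_nhds (rad_pos τ)] with z hz hz'
  rw [hz]
  exact hasSum_ev hF hz'

/-- A power series that is summable near the origin is summable at a point with positive
coordinates, so it has finite norm on a polydisc. -/
lemma HasTaylorSeries.exists_nrm {f : (ι → ℂ) → ℂ} {F : MvPowerSeries ι ℂ}
    (h : HasTaylorSeries f F) :
    (∃ τ, nrm (rad τ) F < ∞) ∧ ∀ᶠ z in 𝓝 0, f z = ev z F := by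
  refine ⟨?_, h.mono fun z hz => hz.tsum_eq.symm⟩
  obtain ⟨τ, hτ⟩ := exists_polydisc_subset h
  set z : ι → ℂ := fun i => ((rad τ i : ℝ≥0) : ℂ) with hz
  have hzm : z ∈ polydisc (rad τ) := fun i => by simp [hz]
  have h1 := (hτ τ le_rfl hzm).summable.norm
  refine ⟨τ, ?_⟩
  have h2 := h1.tsum_ofReal_lt_top
  refine lt_of_eq_of_lt (tsum_congr fun α => ?_) h2
  have h3 : ∏ i, z i ^ α i = ((mon (rad τ) α : ℝ≥0) : ℂ) := by simp [mon, hz]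
  rw [h3, ofReal_norm, enorm_mul]
  congr 1
  rw [enorm_eq_nnnorm]
  simp

/-- Taylor series are unique. -/
lemma HasTaylorSeries.unique {f : (ι → ℂ) → ℂ} {F G : MvPowerSeries ι ℂ}
    (hF : HasTaylorSeries f F) (hG : HasTaylorSeries f G) : F = G := by
  obtain ⟨⟨τ, h1⟩, h2⟩ := hF.exists_nrm
  obtain ⟨⟨τ', h3⟩, h4⟩ := hG.exists_nrm
  have h1' := (nrm_mono (rad_antitone (le_max_left τ τ')) F).trans_lt h1
  have h3' := (nrm_mono (rad_antitone (le_max_right τ τ')) G).trans_lt h3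
  rw [← sub_eq_zero]
  refine eq_zero_of_eventually_ev_eq_zero (τ₀ := max τ τ')
    (nrm_sub_le.trans_lt (ENNReal.add_lt_top.2 ⟨h1', h3'⟩)) ?_
  filter_upwards [h2, h4, polydisc_mem_nhds (rad_pos (max τ τ'))] with z hz hz' hp
  have h5 : nrm (rad (max τ τ')) (-G) < ∞ := by rwa [nrm_neg]
  have h6 : ev z (G + -G) = ev z G + ev z (-G) := ev_add h3' h5 hp
  rw [add_neg_cancel, ev_zero] at h6
  rw [sub_eq_add_neg, ev_add h1' h5 hp, ← hz, hz', ← h6]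

/-- The sum of a convergent power series is analytic at `0`. -/
lemma analyticAt_ev {F : MvPowerSeries ι ℂ} {τ : ℕ} (hF : nrm (rad τ) F < ∞) :
    AnalyticAt ℂ (fun z => ev z F) 0 := by
  classical
  obtain ⟨r, hr0, hr⟩ : ∃ r : ℝ≥0, 0 < r ∧ ∀ i : ι, r ≤ rad τ i := by
    have h := (eventually_all.2 fun i : ι =>
      ((gt_mem_nhds (rad_pos τ i)).mono fun x hx => hx.le :
        ∀ᶠ x : ℝ≥0 in 𝓝 0, x ≤ rad τ i)).filter_mono (nhdsWithin_le_nhds (s := Set.Ioi 0))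
    obtain ⟨r, h1, h2⟩ := (h.and self_mem_nhdsWithin).exists
    exact ⟨r, h2, h1⟩
  have hF' : nrm (fun _ => r) F < ∞ := (nrm_mono hr F).trans_lt hF
  -- each monomial is realized by one chosen word
  set rep := Function.surjInv (expo_surjective (ι := ι)) with hrep
  have hrepe : ∀ α, expo (rep α) = α := Function.surjInv_eq _
  have hinj : Function.Injective rep := Function.injective_surjInv _
  set c : (Σ n, Fin n → ι) → ℂ := fun t => if rep (expo t) = t then coeff (expo t) F else 0 with hc
  have hcr : ∀ α, c (rep α) = coeff α F := fun α => by simp [hc, hrepe]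
  have hc0 : ∀ t, t ∉ Set.range rep → c t = 0 := fun t ht => if_neg fun h => ht ⟨_, h⟩
  have hsum : ∑' t, ‖c t‖ₑ * ((mon (fun _ : ι => r) (expo t) : ℝ≥0) : ℝ≥0∞) < ∞ := by
    rw [← hinj.tsum_eq]
    · refine lt_of_eq_of_lt (tsum_congr fun α => ?_) hF'
      rw [hcr, hrepe]
    · intro t ht
      by_contra h
      simp [hc0 t h] at ht
  set p : FormalMultilinearSeries ℂ (ι → ℂ) ℂ := fun n => ∑ s : Fin n → ι, c ⟨n, s⟩ •
    (ContinuousMultilinearMap.mkPiAlgebra ℂ (Fin n) ℂ).compContinuousLinearMap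
      (fun k => ContinuousLinearMap.proj (s k)) with hp
  have hpn : ∀ n, ‖p n‖₊ * r ^ n ≤
      ∑ s : Fin n → ι, ‖c ⟨n, s⟩‖₊ * mon (fun _ : ι => r) (expo ⟨n, s⟩) := by
    intro n
    simp only [mon_expo, Finset.prod_const, Finset.card_univ, Fintype.card_fin]
    rw [← Finset.sum_mul]
    gcongr
    refine (nnnorm_sum_le _ _).trans (Finset.sum_le_sum fun s _ => ?_)
    rw [nnnorm_smul]
    refine mul_le_of_le_one_right' ?_
    refine ContinuousMultilinearMap.opNNNorm_le_iff.2 fun m => ?_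
    simp only [ContinuousMultilinearMap.compContinuousLinearMap_apply,
      ContinuousLinearMap.proj_apply, ContinuousMultilinearMap.mkPiAlgebra_apply, one_mul,
      nnnorm_prod]
    exact Finset.prod_le_prod' fun k _ => nnnorm_le_pi_nnnorm _ _
  have hps : ∑' n, ((‖p n‖₊ * r ^ n : ℝ≥0) : ℝ≥0∞) < ∞ := by
    refine lt_of_le_of_lt (ENNReal.tsum_le_tsum fun n => ?_) (by rwa [ENNReal.tsum_sigma'] at hsum)
    rw [tsum_fintype]
    exact (ENNReal.coe_le_coe.2 (hpn n)).trans (by push_cast; rfl)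
  refine ⟨p, r, ?_, by exact_mod_cast hr0, fun {y} hy => ?_⟩
  · refine p.le_radius_of_summable_nnnorm ?_
    exact ENNReal.tsum_coe_ne_top_iff_summable.1 hps.ne
  · have hy' : y ∈ polydisc fun _ => r := fun i => by
      rw [mem_eball_zero_iff, enorm_eq_nnnorm, ENNReal.coe_lt_coe] at hy
      exact (nnnorm_le_pi_nnnorm y i).trans hy.le
    have hs := summable_word hy' hsum
    have h1 : ev y F = ∑' t, c t * mon y (expo t) := by
      rw [← hinj.tsum_eq]
      · exact tsum_congr fun α => by rw [hcr, hrepe]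
      · intro t ht
        by_contra h
        simp [hc0 t h] at ht
    rw [zero_add, h1]
    have h2 := hs.hasSum.sigma fun n => hasSum_fintype _
    refine h2.congr_fun fun n => ?_
    simp [hp, mon_expo]

end Taylor

/-! ### Power series in two groups of variables -/

section Slices

open MvPowerSeries

/-- The exponent in the variables `ω ≃ ι ⊕ κ` that is composed of an exponent in the variables `ι`
and one in the variables `κ`. -/
def comb {ω ι κ : Type*} (u : ι → ω) (v : κ → ω) (α : ι →₀ ℕ) (β : κ →₀ ℕ) : ω →₀ ℕ :=
  α.mapDomain u + β.mapDomain v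

section Exponents

variable {ω ι κ : Type*} {u : ι → ω} {v : κ → ω}

lemma comb_add (α α' : ι →₀ ℕ) (β β' : κ →₀ ℕ) :
    comb u v (α + α') (β + β') = comb u v α β + comb u v α' β' := by
  simp only [comb, Finsupp.mapDomain_add]
  abel

lemma comb_comm (α : ι →₀ ℕ) (β : κ →₀ ℕ) : comb u v α β = comb v u β α := add_comm _ _

lemma comb_apply_left (h : Function.Bijective (Sum.elim u v)) (α : ι →₀ ℕ) (β : κ →₀ ℕ) (i : ι) :
    comb u v α β (u i) = α i := by
  have hu : Function.Injective u := h.1.comp Sum.inl_injective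
  rw [comb, Finsupp.add_apply, Finsupp.mapDomain_apply hu, Finsupp.mapDomain_of_notMem_range, add_zero]
  rintro ⟨k, hk⟩
  exact Sum.inl_ne_inr (h.1 (a₁ := .inl i) (a₂ := .inr k) hk.symm)

lemma bijective_elim_swap (h : Function.Bijective (Sum.elim u v)) :
    Function.Bijective (Sum.elim v u) := by
  have : Sum.elim v u = Sum.elim u v ∘ Sum.swap := by
    ext x
    rcases x with x | x <;> rfl
  rw [this]
  exact h.comp (Equiv.sumComm _ _).bijective

lemma comb_apply_right (h : Function.Bijective (Sum.elim u v)) (α : ι →₀ ℕ) (β : κ →₀ ℕ) (k : κ) :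
    comb u v α β (v k) = β k := by
  rw [comb_comm, comb_apply_left (bijective_elim_swap h)]

lemma comb_injective (h : Function.Bijective (Sum.elim u v)) :
    Function.Injective fun p : (ι →₀ ℕ) × (κ →₀ ℕ) => comb u v p.1 p.2 := by
  rintro ⟨α, β⟩ ⟨α', β'⟩ hp
  ext i
  · have := DFunLike.congr_fun hp (u i)
    simpa [comb_apply_left h] using this
  · have := DFunLike.congr_fun hp (v i)
    simpa [comb_apply_right h] using this

lemma comb_surjective (h : Function.Bijective (Sum.elim u v)) :
    Function.Surjective fun p : (ι →₀ ℕ) × (κ →₀ ℕ) => comb u v p.1 p.2 := by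
  intro γ
  have hu : Function.Injective u := h.1.comp Sum.inl_injective
  have hv : Function.Injective v := h.1.comp Sum.inr_injective
  refine ⟨(γ.comapDomain u hu.injOn, γ.comapDomain v hv.injOn), ?_⟩
  ext x
  obtain ⟨y, rfl⟩ := h.2 x
  rcases y with y | y
  · exact comb_apply_left h _ _ y
  · exact comb_apply_right h _ _ y

/-- Splitting exponents in the variables `ω ≃ ι ⊕ κ`. -/
def combEquiv (h : Function.Bijective (Sum.elim u v)) :
    (ι →₀ ℕ) × (κ →₀ ℕ) ≃ (ω →₀ ℕ) :=
  Equiv.ofBijective _ ⟨comb_injective h, comb_surjective h⟩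

lemma combEquiv_apply (h : Function.Bijective (Sum.elim u v)) (p : (ι →₀ ℕ) × (κ →₀ ℕ)) :
    combEquiv h p = comb u v p.1 p.2 := rfl

lemma mon_mapDomain [Fintype ω] [Fintype ι] {M : Type*} [CommMonoid M] (w : ω → M) (u : ι → ω)
    (α : ι →₀ ℕ) : mon w (α.mapDomain u) = mon (w ∘ u) α := by
  induction α using Finsupp.induction_linear with
  | zero => simp
  | add α β hα hβ => rw [Finsupp.mapDomain_add, mon_add, mon_add, hα, hβ]
  | single i k => rw [Finsupp.mapDomain_single, mon_single, mon_single, Function.comp_apply]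

lemma mon_comb [Fintype ω] [Fintype ι] [Fintype κ] {M : Type*} [CommMonoid M] (w : ω → M)
    (α : ι →₀ ℕ) (β : κ →₀ ℕ) : mon w (comb u v α β) = mon (w ∘ u) α * mon (w ∘ v) β := by
  rw [comb, mon_add, mon_mapDomain, mon_mapDomain]

end Exponents

variable {ω ι κ : Type*}

/-- The coefficient of the monomial `x ^ α`, `α` an exponent in the variables `ι`, of a power series
in the variables `ω ≃ ι ⊕ κ`: a power series in the variables `κ`. -/
def slice (u : ι → ω) (v : κ → ω) (α : ι →₀ ℕ) : MvPowerSeries ω ℂ →ₗ[ℂ] MvPowerSeries κ ℂ :=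
  ofCoeff fun β => coeff (comb u v α β)

variable {u : ι → ω} {v : κ → ω}

@[simp] lemma coeff_slice (α : ι →₀ ℕ) (β : κ →₀ ℕ) (G : MvPowerSeries ω ℂ) :
    coeff β (slice u v α G) = coeff (comb u v α β) G := rfl

lemma ext_slice (h : Function.Bijective (Sum.elim u v)) {G H : MvPowerSeries ω ℂ}
    (hs : ∀ α, slice u v α G = slice u v α H) : G = H := by
  ext γ
  obtain ⟨⟨α, β⟩, rfl⟩ := comb_surjective h γ
  rw [← coeff_slice, hs, coeff_slice]

lemma slice_mul (h : Function.Bijective (Sum.elim u v)) [DecidableEq ι] (α : ι →₀ ℕ)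
    (G H : MvPowerSeries ω ℂ) : slice u v α (G * H) =
      ∑ p ∈ Finset.HasAntidiagonal.antidiagonal α, slice u v p.1 G * slice u v p.2 H := by
  classical
  ext β
  rw [coeff_slice, coeff_mul, map_sum]
  simp only [coeff_mul, coeff_slice]
  rw [← Finset.sum_product']
  symm
  refine Finset.sum_bij' (fun q _ => (comb u v q.1.1 q.2.1, comb u v q.1.2 q.2.2))
    (fun p _ => ((((combEquiv h).symm p.1).1, ((combEquiv h).symm p.2).1),
      (((combEquiv h).symm p.1).2, ((combEquiv h).symm p.2).2))) ?_ ?_ ?_ ?_ ?_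
  · rintro ⟨⟨a, b⟩, c, d⟩ hq
    simp only [Finset.mem_product, Finset.HasAntidiagonal.mem_antidiagonal] at hq ⊢
    rw [← comb_add, hq.1, hq.2]
  · rintro ⟨a, b⟩ hp
    simp only [Finset.mem_product, Finset.HasAntidiagonal.mem_antidiagonal] at hp ⊢
    have h1 : comb u v (((combEquiv h).symm a).1 + ((combEquiv h).symm b).1)
        (((combEquiv h).symm a).2 + ((combEquiv h).symm b).2) = comb u v α β := by
      rw [comb_add, ← combEquiv_apply h, ← combEquiv_apply h]
      simpa using hp
    have h2 := @comb_injective _ _ _ _ _ h (_, _) (_, _) h1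
    exact ⟨congrArg Prod.fst h2, congrArg Prod.snd h2⟩
  · rintro ⟨⟨a, b⟩, c, d⟩ _
    have h1 := (combEquiv h).symm_apply_apply (a, c)
    have h2 := (combEquiv h).symm_apply_apply (b, d)
    rw [combEquiv_apply] at h1 h2
    simp only [h1, h2]
  · rintro ⟨a, b⟩ _
    have h1 := (combEquiv h).apply_symm_apply a
    have h2 := (combEquiv h).apply_symm_apply b
    rw [combEquiv_apply] at h1 h2
    simp only [h1, h2]
  · rintro ⟨⟨a, b⟩, c, d⟩ _
    rfl

lemma coeff_mapDomain_rename [Finite ι] (hu : Function.Injective u) (F : MvPowerSeries ι ℂ)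
    (α : ι →₀ ℕ) : coeff (α.mapDomain u) (rename u F) = coeff α F := by
  have := coeff_embDomain_rename (⟨u, hu⟩ : ι ↪ ω) F α
  rwa [Finsupp.embDomain_eq_mapDomain] at this

lemma slice_rename_right [Finite κ] (h : Function.Bijective (Sum.elim u v)) [DecidableEq ι]
    (F : MvPowerSeries κ ℂ) (α : ι →₀ ℕ) :
    slice u v α (rename v F) = if α = 0 then F else 0 := by
  have hv : Function.Injective v := h.1.comp Sum.inr_injective
  ext β
  rw [coeff_slice]
  split_ifs with hα
  · subst hα
    rw [comb, Finsupp.mapDomain_zero, zero_add, coeff_mapDomain_rename hv]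
  · rw [coeff_zero]
    refine coeff_rename_eq_zero _ _ ?_
    rintro ⟨γ, hγ⟩
    refine hα ?_
    have h1 : comb u v 0 γ = comb u v α β := by simpa [comb] using hγ
    exact (congrArg Prod.fst (@comb_injective _ _ _ _ _ h (_, _) (_, _) h1)).symm

lemma slice_rename_left [Finite ι] (h : Function.Bijective (Sum.elim u v))
    (F : MvPowerSeries ι ℂ) (α : ι →₀ ℕ) :
    slice u v α (rename u F) = C (coeff α F) := by
  classical
  have hu : Function.Injective u := h.1.comp Sum.inl_injective
  ext β
  rw [coeff_slice, coeff_C]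
  split_ifs with hβ
  · subst hβ
    rw [comb, Finsupp.mapDomain_zero, add_zero, coeff_mapDomain_rename hu]
  · refine coeff_rename_eq_zero _ _ ?_
    rintro ⟨γ, hγ⟩
    refine hβ ?_
    have h1 : comb u v γ 0 = comb u v α β := by simpa [comb] using hγ
    exact (congrArg Prod.snd (@comb_injective _ _ _ _ _ h (_, _) (_, _) h1)).symm

lemma slice_mul_rename_right [Finite κ] (h : Function.Bijective (Sum.elim u v)) (α : ι →₀ ℕ)
    (G : MvPowerSeries ω ℂ) (F : MvPowerSeries κ ℂ) :
    slice u v α (G * rename v F) = slice u v α G * F := by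
  classical
  rw [slice_mul h, Finset.sum_eq_single (α, 0)]
  · rw [slice_rename_right h, if_pos rfl]
  · rintro ⟨a, b⟩ hab hne
    rw [slice_rename_right h, if_neg, mul_zero]
    rintro rfl
    rw [Finset.HasAntidiagonal.mem_antidiagonal, add_zero] at hab
    exact hne (by rw [← hab])
  · intro hn
    exact absurd (Finset.HasAntidiagonal.mem_antidiagonal.2 (add_zero α)) hn

/-- A power series in the variables `ω ≃ ι ⊕ κ` whose slices all lie in an ideal of the ring of
power series in the variables `κ` lies in the extension of that ideal. -/
lemma mem_map_rename_of_slice_mem [Finite κ] (h : Function.Bijective (Sum.elim u v))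
    {K : Ideal (MvPowerSeries κ ℂ)} {G : MvPowerSeries ω ℂ} (hG : ∀ α, slice u v α G ∈ K) :
    G ∈ K.map (rename (R := ℂ) v) := by
  obtain ⟨s, hs⟩ := (isNoetherianRing_iff_ideal_fg _).1 (inferInstance :
    IsNoetherianRing (MvPowerSeries κ ℂ)) K
  have h1 : ∀ α, ∃ c : MvPowerSeries κ ℂ → MvPowerSeries κ ℂ,
      ∑ g ∈ s, c g * g = slice u v α G := fun α => by
    have := hG α
    rw [← hs, Submodule.mem_span_finset] at this
    obtain ⟨c, -, hc⟩ := this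
    exact ⟨c, hc⟩
  choose c hc using h1
  let D : MvPowerSeries κ ℂ → MvPowerSeries ω ℂ := fun g γ =>
    coeff ((combEquiv h).symm γ).2 (c ((combEquiv h).symm γ).1 g)
  have hD : ∀ g α, slice u v α (D g) = c α g := fun g α => by
    ext β
    have h2 := (combEquiv h).symm_apply_apply (α, β)
    rw [combEquiv_apply] at h2
    change coeff ((combEquiv h).symm (comb u v α β)).2
      (c ((combEquiv h).symm (comb u v α β)).1 g) = _
    rw [h2]
  have : G = ∑ g ∈ s, D g * rename v g := by
    refine ext_slice h fun α => ?_
    rw [map_sum, ← hc α]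
    exact Finset.sum_congr rfl fun g _ => by rw [slice_mul_rename_right h, hD]
  rw [this]
  refine sum_mem fun g hg => Ideal.mul_mem_left _ _ (Ideal.mem_map_of_mem _ ?_)
  rw [← hs]
  exact Ideal.subset_span hg

lemma slice_mul_mem (h : Function.Bijective (Sum.elim u v)) {K : Ideal (MvPowerSeries κ ℂ)}
    {G : MvPowerSeries ω ℂ} (hG : ∀ α, slice u v α G ∈ K) (H : MvPowerSeries ω ℂ) (α : ι →₀ ℕ) :
    slice u v α (H * G) ∈ K := by
  classical
  rw [slice_mul h]
  exact sum_mem fun p _ => K.mul_mem_left _ (hG _)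

/-- Applying a linear functional on the power series in the variables `κ` to the slices of a power
series in the variables `ω ≃ ι ⊕ κ`. -/
def contract (u : ι → ω) (v : κ → ω) (L : MvPowerSeries κ ℂ →ₗ[ℂ] ℂ) :
    MvPowerSeries ω ℂ →ₗ[ℂ] MvPowerSeries ι ℂ :=
  ofCoeff fun α => L.comp (slice u v α)

@[simp] lemma coeff_contract (L : MvPowerSeries κ ℂ →ₗ[ℂ] ℂ) (G : MvPowerSeries ω ℂ) (α : ι →₀ ℕ) :
    coeff α (contract u v L G) = L (slice u v α G) := rfl

/-- Contraction is linear over the power series in the remaining variables. -/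
lemma contract_mul_rename [Finite ι] (h : Function.Bijective (Sum.elim u v))
    (L : MvPowerSeries κ ℂ →ₗ[ℂ] ℂ) (G : MvPowerSeries ω ℂ) (F : MvPowerSeries ι ℂ) :
    contract u v L (G * rename u F) = contract u v L G * F := by
  classical
  ext α
  rw [coeff_contract, slice_mul h, map_sum, coeff_mul]
  refine Finset.sum_congr rfl fun p _ => ?_
  rw [slice_rename_left h, mul_comm, ← smul_eq_C_mul, map_smul, coeff_contract, smul_eq_mul,
    mul_comm]

/-- The power series `G(z, ·)` that is obtained by evaluating the variables `ι` at `z`. -/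
def partialEval [Fintype ι] (u : ι → ω) (v : κ → ω) (z : ι → ℂ) (G : MvPowerSeries ω ℂ) :
    MvPowerSeries κ ℂ :=
  fun β => ∑' α, coeff (comb u v α β) G * mon z α

lemma coeff_partialEval_eq_tsum [Fintype ι] (z : ι → ℂ) (G : MvPowerSeries ω ℂ) (β : κ →₀ ℕ) :
    coeff β (partialEval u v z G) = ∑' α, coeff (comb u v α β) G * mon z α := rfl

/-- The coefficients of `G(z, ·)` are the values at `z` of the slices of `G` in the other
direction. -/
lemma coeff_partialEval [Fintype ι] (z : ι → ℂ) (G : MvPowerSeries ω ℂ) (β : κ →₀ ℕ) :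
    coeff β (partialEval u v z G) = ev z (slice v u β G) := by
  rw [coeff_partialEval_eq_tsum, ev]
  exact tsum_congr fun α => by rw [coeff_slice, comb_comm]

variable [Fintype ω] [Fintype ι] [Fintype κ] {ρ : ω → ℝ≥0} {G : MvPowerSeries ω ℂ}

lemma nrm_eq_tsum_slice (h : Function.Bijective (Sum.elim u v)) (G : MvPowerSeries ω ℂ) :
    nrm ρ G = ∑' α, nrm (ρ ∘ v) (slice u v α G) * ((mon (ρ ∘ u) α : ℝ≥0) : ℝ≥0∞) := by
  rw [nrm, ← (combEquiv h).tsum_eq, ENNReal.tsum_prod']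
  refine tsum_congr fun α => ?_
  rw [nrm, ← ENNReal.tsum_mul_right]
  refine tsum_congr fun β => ?_
  rw [combEquiv_apply, mon_comb, coeff_slice]
  push_cast
  ring

lemma nrm_slice_lt_top (h : Function.Bijective (Sum.elim u v)) (hρ : ∀ x, 0 < ρ x)
    (hG : nrm ρ G < ∞) (α : ι →₀ ℕ) : nrm (ρ ∘ v) (slice u v α G) < ∞ := by
  rw [nrm_eq_tsum_slice h] at hG
  refine ENNReal.lt_top_of_mul_ne_top_left ((ENNReal.le_tsum α).trans_lt hG).ne ?_
  have : mon (ρ ∘ u) α ≠ 0 := Finset.prod_ne_zero_iff.2 fun i _ => (pow_pos (hρ _) _).ne'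
  exact_mod_cast this

variable {z : ι → ℂ}

/-- The tail estimate for the partial evaluation of a convergent power series. -/
lemma nrm_partialEval_sub_le (h : Function.Bijective (Sum.elim u v)) (hG : nrm ρ G < ∞)
    (hρ : ∀ x, 0 < ρ x) (hz : z ∈ polydisc (ρ ∘ u)) (s : Finset (ι →₀ ℕ)) :
    nrm (ρ ∘ v) (partialEval u v z G - ∑ α ∈ s, mon z α • slice u v α G) ≤
      ∑' α : {α // α ∉ s}, nrm (ρ ∘ v) (slice u v α G) * ((mon (ρ ∘ u) α : ℝ≥0) : ℝ≥0∞) := by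
  classical
  have hsum : ∀ β, Summable fun α => coeff (comb u v α β) G * mon z α := by
    intro β
    have h1 := nrm_slice_lt_top (bijective_elim_swap h) hρ hG β
    refine (summable_norm_ev h1 hz).of_norm.congr fun α => ?_
    rw [coeff_slice, comb_comm]
  have h2 : ∀ β, coeff β (partialEval u v z G - ∑ α ∈ s, mon z α • slice u v α G) =
      ∑' α : {α // α ∉ s}, coeff (comb u v α β) G * mon z α := by
    intro β
    rw [map_sub, coeff_partialEval_eq_tsum, map_sum, ← (hsum β).sum_add_tsum_subtype_compl s]
    rw [add_sub_assoc, add_comm, sub_add_eq_add_sub, sub_eq_iff_eq_add]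
    congr 1
    refine Finset.sum_congr rfl fun α _ => ?_
    rw [map_smul, coeff_slice, smul_eq_mul, mul_comm]
  calc _ ≤ ∑' β, (∑' α : {α // α ∉ s}, ‖coeff (comb u v α β) G‖ₑ *
        ((mon (ρ ∘ u) (α : ι →₀ ℕ) : ℝ≥0) : ℝ≥0∞)) * ((mon (ρ ∘ v) β : ℝ≥0) : ℝ≥0∞) := by
        refine ENNReal.tsum_le_tsum fun β => ?_
        gcongr
        rw [h2]
        refine enorm_tsum_le_tsum_enorm.trans (ENNReal.tsum_le_tsum fun α => ?_)
        rw [enorm_mul]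
        gcongr
        exact enorm_mon_le hz _
    _ = ∑' β, ∑' α : {α // α ∉ s}, ‖coeff (comb u v α β) G‖ₑ *
        ((mon (ρ ∘ u) (α : ι →₀ ℕ) : ℝ≥0) : ℝ≥0∞) * ((mon (ρ ∘ v) β : ℝ≥0) : ℝ≥0∞) :=
        tsum_congr fun β => ENNReal.tsum_mul_right.symm
    _ = _ := by
        rw [ENNReal.tsum_comm]
        refine tsum_congr fun α => ?_
        rw [nrm, ← ENNReal.tsum_mul_right]
        exact tsum_congr fun β => by rw [coeff_slice]; ring

lemma nrm_partialEval_le (h : Function.Bijective (Sum.elim u v)) (hG : nrm ρ G < ∞)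
    (hρ : ∀ x, 0 < ρ x) (hz : z ∈ polydisc (ρ ∘ u)) :
    nrm (ρ ∘ v) (partialEval u v z G) ≤ nrm ρ G := by
  have h1 := nrm_partialEval_sub_le h hG hρ hz ∅
  rw [Finset.sum_empty, sub_zero] at h1
  refine h1.trans ?_
  rw [nrm_eq_tsum_slice h]
  exact ENNReal.tsum_comp_le_tsum_of_injective Subtype.val_injective
    fun α => nrm (ρ ∘ v) (slice u v α G) * ((mon (ρ ∘ u) α : ℝ≥0) : ℝ≥0∞)

lemma nrm_contract_le (h : Function.Bijective (Sum.elim u v)) {L : MvPowerSeries κ ℂ →ₗ[ℂ] ℂ}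
    {c : ℝ≥0∞} (hL : ∀ F, ‖L F‖ₑ ≤ c * nrm (ρ ∘ v) F) :
    nrm (ρ ∘ u) (contract u v L G) ≤ c * nrm ρ G := by
  rw [nrm_eq_tsum_slice h, ← ENNReal.tsum_mul_left]
  refine ENNReal.tsum_le_tsum fun α => ?_
  rw [← mul_assoc]
  gcongr
  exact hL _

/-- A functional that is bounded in the weighted norm commutes with evaluation. -/
lemma ev_contract (h : Function.Bijective (Sum.elim u v)) {L : MvPowerSeries κ ℂ →ₗ[ℂ] ℂ}
    {c : ℝ≥0∞} (hc : c ≠ ∞) (hL : ∀ F, ‖L F‖ₑ ≤ c * nrm (ρ ∘ v) F) (hG : nrm ρ G < ∞)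
    (hρ : ∀ x, 0 < ρ x) (hz : z ∈ polydisc (ρ ∘ u)) :
    ev z (contract u v L G) = L (partialEval u v z G) := by
  classical
  have h0 : nrm (ρ ∘ u) (contract u v L G) < ∞ :=
    (nrm_contract_le h hL).trans_lt (ENNReal.mul_lt_top hc.lt_top hG)
  refine (hasSum_ev h0 hz).unique ?_
  rw [HasSum, SummationFilter.unconditional_filter, tendsto_iff_norm_sub_tendsto_zero]
  set f : (ι →₀ ℕ) → ℝ≥0∞ := fun α =>
    nrm (ρ ∘ v) (slice u v α G) * ((mon (ρ ∘ u) α : ℝ≥0) : ℝ≥0∞) with hf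
  have hfG : ∑' α, f α ≠ ∞ := by
    rw [nrm_eq_tsum_slice h] at hG
    exact hG.ne
  have hlim0 := ENNReal.Tendsto.const_mul (ENNReal.tendsto_tsum_compl_atTop_zero hfG)
    (Or.inr hc)
  rw [mul_zero] at hlim0
  have hlim := (ENNReal.tendsto_toReal ENNReal.zero_ne_top).comp hlim0
  refine squeeze_zero (fun _ => norm_nonneg _) (fun s => ?_) hlim
  have h1 : ∑ α ∈ s, coeff α (contract u v L G) * mon z α - L (partialEval u v z G) =
      -L (partialEval u v z G - ∑ α ∈ s, mon z α • slice u v α G) := by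
    rw [map_sub, map_sum, neg_sub]
    congr 1
    refine Finset.sum_congr rfl fun α _ => ?_
    rw [map_smul, coeff_contract, smul_eq_mul, mul_comm]
  rw [h1, norm_neg, Function.comp_apply, ← toReal_enorm]
  refine ENNReal.toReal_mono (ENNReal.mul_ne_top hc ?_) ((hL _).trans ?_)
  · exact ((ENNReal.tsum_comp_le_tsum_of_injective Subtype.val_injective f).trans_lt
      hfG.lt_top).ne
  · gcongr
    exact nrm_partialEval_sub_le h hG hρ hz s

/-- Evaluating the variables `ι` and then the variables `κ` is evaluating all variables. -/
lemma ev_partialEval (h : Function.Bijective (Sum.elim u v)) (hG : nrm ρ G < ∞) {w : ω → ℂ}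
    (hw : w ∈ polydisc ρ) : ev (w ∘ v) (partialEval u v (w ∘ u) G) = ev w G := by
  have hs : Summable fun p : (κ →₀ ℕ) × (ι →₀ ℕ) =>
      coeff (comb u v p.2 p.1) G * mon (w ∘ u) p.2 * mon (w ∘ v) p.1 := by
    have h1 := ((combEquiv h).summable_iff.2 (hasSum_ev hG hw).summable)
    refine ((Equiv.prodComm _ _).summable_iff.2 h1).congr fun p => ?_
    simp only [Function.comp_apply, Equiv.prodComm_apply, Prod.fst_swap, Prod.snd_swap,
      combEquiv_apply, mon_comb, mul_assoc]
  have h2 : ev w G = ∑' p : (κ →₀ ℕ) × (ι →₀ ℕ),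
      coeff (comb u v p.2 p.1) G * mon (w ∘ u) p.2 * mon (w ∘ v) p.1 := by
    rw [ev, ← (combEquiv h).tsum_eq, ← (Equiv.prodComm _ _).tsum_eq]
    refine tsum_congr fun p => ?_
    simp only [Equiv.prodComm_apply, Prod.fst_swap, Prod.snd_swap,
      combEquiv_apply, mon_comb, mul_assoc]
  rw [h2, hs.tsum_prod, ev]
  refine tsum_congr fun β => ?_
  rw [coeff_partialEval_eq_tsum, ← tsum_mul_right]

end Slices

/-! ### Dimension, vanishing ideals and varieties -/

section LocalRings

variable {R : Type*} [CommRing R] {𝔪 J : Ideal R}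

lemma isMaximal_of_isUnit (h𝔪 : 𝔪 ≠ ⊤) (hu : ∀ x, x ∉ 𝔪 → IsUnit x) : 𝔪.IsMaximal :=
  Ideal.isMaximal_iff.2 ⟨fun h => h𝔪 ((Ideal.eq_top_iff_one _).2 h), fun I x _ hx hxI => by
    rw [← Ideal.eq_top_iff_one]
    exact Ideal.eq_top_of_isUnit_mem _ hxI (hu x hx)⟩

lemma le_of_isUnit (hu : ∀ x, x ∉ 𝔪 → IsUnit x) (hJ : J ≠ ⊤) : J ≤ 𝔪 := fun x hx => by
  by_contra h
  exact hJ (Ideal.eq_top_of_isUnit_mem _ hx (hu x h))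

/-- In a local ring, an ideal with a non-nilpotent element of the maximal ideal in the quotient
has positive dimension. -/
lemma ringKrullDim_quotient_pos (h𝔪 : 𝔪 ≠ ⊤) (hu : ∀ x, x ∉ 𝔪 → IsUnit x) {x : R} (hx : x ∈ 𝔪)
    (hxJ : ∀ k, x ^ k ∉ J) : 0 < ringKrullDim (R ⧸ J) := by
  have hmax := isMaximal_of_isUnit h𝔪 hu
  obtain ⟨Q, hQ, hJQ, hd⟩ := J.exists_le_prime_disjoint (Submonoid.powers x)
    (Set.disjoint_left.2 fun y hy ⟨k, hk⟩ => hxJ k (by subst hk; exact hy))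
  have hQ𝔪 : Q ≤ 𝔪 := le_of_isUnit hu hQ.ne_top
  rw [ringKrullDim_quotient, Order.krullDim_pos_iff]
  refine ⟨⟨⟨Q, hQ⟩, hJQ⟩, ⟨⟨𝔪, hmax.isPrime⟩, hJQ.trans hQ𝔪⟩, ?_⟩
  refine lt_of_le_not_ge hQ𝔪 fun h => ?_
  exact Set.disjoint_left.1 hd (h hx) (Submonoid.mem_powers x)

lemma ringKrullDim_quotient_le_zero (hu : ∀ x, x ∉ 𝔪 → IsUnit x)
    (h : ∀ Q : Ideal R, Q.IsPrime → J ≤ Q → 𝔪 ≤ Q) : ringKrullDim (R ⧸ J) ≤ 0 := by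
  rw [ringKrullDim_quotient, Order.krullDim_nonpos_iff_forall_isMin]
  rintro ⟨⟨Q, hQ⟩, hJQ⟩ ⟨⟨Q', hQ'⟩, hJQ'⟩ _
  exact (le_of_isUnit hu hQ.ne_top).trans (h Q' hQ' hJQ')

end LocalRings

section FormalDimension

open MvPowerSeries

variable {ι : Type*} [Fintype ι]

/-- The variables generate the maximal ideal of the ring of formal power series. -/
lemma mem_of_constantCoeff_eq_zero {Q : Ideal (MvPowerSeries ι ℂ)} (hQ : ∀ i, X i ∈ Q)
    {F : MvPowerSeries ι ℂ} (hF : constantCoeff F = 0) : F ∈ Q := by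
  classical
  have h := monRem_add_sum_monQuo (A := Finset.univ.image fun i : ι => Finsupp.single i 1) F
  have h0 : monRem (Finset.univ.image fun i : ι => Finsupp.single i 1) F = 0 := by
    ext γ
    rw [coeff_monRem, map_zero]
    split_ifs with hγ
    · rfl
    · rcases eq_or_ne γ 0 with rfl | hne
      · rwa [coeff_zero_eq_constantCoeff_apply]
      · obtain ⟨i, hi⟩ := Finsupp.ne_iff.1 hne
        refine absurd ⟨_, Finset.mem_image_of_mem _ (Finset.mem_univ i), ?_⟩ hγ
        rw [Finsupp.single_le_iff]
        exact Nat.one_le_iff_ne_zero.2 hi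
  rw [h0, zero_add] at h
  rw [h]
  refine sum_mem fun a ha => Q.mul_mem_left _ ?_
  obtain ⟨i, -, rfl⟩ := Finset.mem_image.1 ha
  exact hQ i

/-- A quotient of the ring of formal power series has positive dimension if and only if some
variable is not nilpotent in it. -/
lemma ringKrullDim_powerSeries_quotient_pos_iff {J : Ideal (MvPowerSeries ι ℂ)} :
    0 < ringKrullDim (MvPowerSeries ι ℂ ⧸ J) ↔ ∃ i, ∀ l, (X i : MvPowerSeries ι ℂ) ^ l ∉ J := by
  have h𝔪 : RingHom.ker (constantCoeff (σ := ι) (R := ℂ)) ≠ ⊤ := RingHom.ker_ne_top _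
  have hu : ∀ F, F ∉ RingHom.ker (constantCoeff (σ := ι) (R := ℂ)) → IsUnit F := fun F hF =>
    isUnit_iff_constantCoeff.2 (isUnit_iff_ne_zero.2 hF)
  refine ⟨fun h => ?_, fun ⟨i, hi⟩ => ringKrullDim_quotient_pos h𝔪 hu (x := X i) (by simp) hi⟩
  by_contra! hc
  refine absurd h (not_lt.2 (ringKrullDim_quotient_le_zero hu fun Q hQ hJQ F hF => ?_))
  exact mem_of_constantCoeff_eq_zero
    (fun i => hQ.mem_of_pow_mem _ (hJQ (hc i).choose_spec)) hF

end FormalDimension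

section Germs

open MvPowerSeries

section Normed

variable {E : Type*} [NormedAddCommGroup E] [NormedSpace ℂ E]

variable (E) in
/-- The germs of holomorphic functions that vanish at the origin: the maximal ideal. -/
def germMax : Ideal (analyticGerms ℂ E) :=
  RingHom.ker ((Germ.valueRingHom (x := (0 : E)) (E := ℂ)).comp (analyticGerms ℂ E).subtype)

lemma mem_germMax {g : analyticGerms ℂ E} {f : E → ℂ}
    (h : (g : Germ (𝓝 (0 : E)) ℂ) = (f : Germ (𝓝 (0 : E)) ℂ)) : g ∈ germMax E ↔ f 0 = 0 := by
  rw [germMax, RingHom.mem_ker, RingHom.comp_apply, Subring.subtype_apply, h]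
  rfl

lemma germMax_ne_top : germMax E ≠ ⊤ := RingHom.ker_ne_top _

lemma isUnit_of_notMem_germMax {g : analyticGerms ℂ E} (hg : g ∉ germMax E) : IsUnit g := by
  obtain ⟨f, hf, h⟩ := g.2
  rw [mem_germMax h] at hg
  refine IsUnit.of_mul_eq_one ⟨((f⁻¹ : E → ℂ) : Germ (𝓝 (0 : E)) ℂ), f⁻¹, hf.inv hg, rfl⟩ ?_
  refine Subtype.ext ?_
  rw [Subring.coe_mul, h, Subring.coe_one]
  refine Germ.coe_eq.2 ?_
  filter_upwards [hf.continuousAt.eventually_ne hg] with z hz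
  exact mul_inv_cancel₀ hz

lemma mem_vanishingIdeal {S : Set E} {g : analyticGerms ℂ E} {f : E → ℂ}
    (h : (g : Germ (𝓝 (0 : E)) ℂ) = (f : Germ (𝓝 (0 : E)) ℂ)) :
    g ∈ vanishingIdeal ℂ S ↔ ∀ᶠ z in 𝓝 (0 : E), z ∈ S → f z = 0 := by
  refine ⟨fun ⟨f', h', hf'⟩ => ?_, fun hf => ⟨f, h, hf⟩⟩
  filter_upwards [hf', Germ.coe_eq.1 (h.symm.trans h')] with z h1 h2 hz
  rw [h2, h1 hz]

lemma germDim_mono {S T : Set E} (h : ∀ᶠ z in 𝓝 (0 : E), z ∈ S → z ∈ T) :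
    germDim S ≤ germDim T := by
  have hle : vanishingIdeal ℂ T ≤ vanishingIdeal ℂ S := fun g ⟨f, hf, hv⟩ =>
    ⟨f, hf, by filter_upwards [h, hv] with z h1 h2 hz using h2 (h1 hz)⟩
  exact ringKrullDim_le_of_surjective (Ideal.Quotient.factor hle)
    (Ideal.Quotient.factor_surjective hle)

end Normed

variable {ι : Type*} [Fintype ι]

/-- A set that accumulates at the origin has positive dimension there. -/
lemma germDim_pos {S : Set (ι → ℂ)} (h : ∃ᶠ z in 𝓝 (0 : ι → ℂ), z ∈ S ∧ z ≠ 0) :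
    0 < germDim S := by
  obtain ⟨i, hi⟩ : ∃ i, ∃ᶠ z in 𝓝 (0 : ι → ℂ), z ∈ S ∧ z i ≠ 0 := by
    by_contra! hc
    refine h ?_
    filter_upwards [eventually_all.2 hc] with z hz hz'
    exact hz'.2 (funext fun i => hz i hz'.1)
  have han : AnalyticAt ℂ (fun z : ι → ℂ => z i) 0 :=
    (ContinuousLinearMap.proj (R := ℂ) (φ := fun _ : ι => ℂ) i).analyticAt 0
  let x : analyticGerms ℂ (ι → ℂ) :=
    ⟨((fun z : ι → ℂ => z i) : Germ (𝓝 (0 : ι → ℂ)) ℂ), _, han, rfl⟩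
  refine ringKrullDim_quotient_pos germMax_ne_top (fun _ => isUnit_of_notMem_germMax) (x := x)
    ((mem_germMax rfl).2 rfl) fun k hk => ?_
  have hxk : ((x ^ k : analyticGerms ℂ (ι → ℂ)) : Germ (𝓝 (0 : ι → ℂ)) ℂ) =
      ((fun z : ι → ℂ => z i ^ k) : Germ (𝓝 (0 : ι → ℂ)) ℂ) := rfl
  rw [mem_vanishingIdeal hxk] at hk
  refine hi (hk.mono fun z hz hz' => hz'.2 ?_)
  exact eq_zero_of_pow_eq_zero (hz hz'.1)

/-- The Taylor series of the holomorphic germs that vanish on `S`. -/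
def taylorGens (S : Set (ι → ℂ)) : Set (MvPowerSeries ι ℂ) :=
  {F | (∃ τ, nrm (rad τ) F < ∞) ∧ ∀ᶠ z in 𝓝 (0 : ι → ℂ), z ∈ S → ev z F = 0}

lemma formalIdeal_eq_span (S : Set (ι → ℂ)) : formalIdeal S = Ideal.span (taylorGens S) := by
  refine congrArg Ideal.span (Set.ext fun F => ⟨?_, ?_⟩)
  · rintro ⟨g, hg, f, hgf, hf⟩
    obtain ⟨h1, h2⟩ := hf.exists_nrm
    refine ⟨h1, ?_⟩
    filter_upwards [h2, (mem_vanishingIdeal hgf).1 hg] with z h3 h4 hz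
    rw [← h3, h4 hz]
  · rintro ⟨⟨τ, hτ⟩, h⟩
    exact ⟨⟨_, _, analyticAt_ev hτ, rfl⟩, (mem_vanishingIdeal rfl).2 h, _, rfl,
      hasTaylorSeries_of_eqOn hτ (Eventually.of_forall fun _ => rfl)⟩

lemma mem_formalIdeal {S : Set (ι → ℂ)} {F : MvPowerSeries ι ℂ} {τ : ℕ} (hF : nrm (rad τ) F < ∞)
    (h : ∀ᶠ z in 𝓝 (0 : ι → ℂ), z ∈ S → ev z F = 0) : F ∈ formalIdeal S := by
  rw [formalIdeal_eq_span]
  exact Ideal.subset_span ⟨⟨τ, hF⟩, h⟩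

lemma ev_smul_of_nrm_lt_top {F : MvPowerSeries ι ℂ} {τ : ℕ} (hF : nrm (rad τ) F < ∞)
    (P : MvPolynomial ι ℂ) {z : ι → ℂ} (hz : z ∈ polydisc (rad τ)) :
    ev z (P • F) = ev z (P : MvPowerSeries ι ℂ) * ev z F := by
  rw [Algebra.smul_def, MvPowerSeries.algebraMap_apply']
  have : MvPowerSeries.map (algebraMap ℂ ℂ) (P : MvPowerSeries ι ℂ) = P := by
    ext; simp
  rw [this, ev_mul (nrm_coe_lt_top _ P) hF hz]

/-- The set `taylorGens S` is a module over the polynomials. -/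
lemma mem_taylorGens_of_mem_span {S : Set (ι → ℂ)} {F : MvPowerSeries ι ℂ}
    (hF : F ∈ Submodule.span (MvPolynomial ι ℂ) (taylorGens S)) : F ∈ taylorGens S := by
  refine ⟨exists_nrm_lt_top_of_mem_span (fun F hF => hF.1) hF, ?_⟩
  induction hF using Submodule.span_induction with
  | mem x h => exact h.2
  | zero => exact Eventually.of_forall fun z _ => by simp [ev]
  | add x y hx' hy' hx hy =>
    obtain ⟨τ, h1⟩ := exists_nrm_lt_top_of_mem_span (fun F hF => hF.1) hx'
    obtain ⟨τ', h2⟩ := exists_nrm_lt_top_of_mem_span (fun F hF => hF.1) hy'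
    filter_upwards [hx, hy, polydisc_mem_nhds (rad_pos (max τ τ'))] with z h3 h4 hz hzS
    rw [ev_add ((nrm_mono (rad_antitone (le_max_left _ _)) _).trans_lt h1)
        ((nrm_mono (rad_antitone (le_max_right _ _)) _).trans_lt h2) hz, h3 hzS, h4 hzS, add_zero]
  | smul a x hx' hx =>
    obtain ⟨τ, h1⟩ := exists_nrm_lt_top_of_mem_span (fun F hF => hF.1) hx'
    filter_upwards [hx, polydisc_mem_nhds (rad_pos τ)] with z h3 hz hzS
    rw [ev_smul_of_nrm_lt_top h1 _ hz, h3 hzS, mul_zero]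

/-- A standard basis of `I(S)` made of convergent series that vanish on `S`. -/
lemma exists_standardBasis_taylorGens (S : Set (ι → ℂ)) :
    Nonempty (StandardBasis (taylorGens S)) := exists_standardBasis fun _ hF => hF.1

/-- All convergent elements of `I(S)` vanish on one and the same neighbourhood of the origin in
`S`, up to their domain of convergence. -/
lemma StandardBasis.eventually_ev_eq_zero {S : Set (ι → ℂ)} (B : StandardBasis (taylorGens S)) :
    ∀ᶠ z in 𝓝 (0 : ι → ℂ), z ∈ S → ∀ τ ≥ B.τ₀, z ∈ polydisc (rad τ) → ∀ F ∈ formalIdeal S,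
      nrm (rad τ) F < ∞ → ev z F = 0 := by
  have h : ∀ a ∈ B.A, ∀ᶠ z in 𝓝 (0 : ι → ℂ), z ∈ S → ev z (B.g a) = 0 := fun a ha =>
    (mem_taylorGens_of_mem_span (B.mem_span a ha)).2
  filter_upwards [(Finset.eventually_all B.A).2 h] with z hz hzS τ hτ hzτ F hF hFτ
  exact B.ev_eq_zero hτ (formalIdeal_eq_span S ▸ hF) hFτ hzτ fun a ha => hz a ha hzS

/-- The formal ideal of a set of nonzero dimension has positive dimension. -/
lemma exists_X_pow_notMem_formalIdeal {S : Set (ι → ℂ)} (h0 : 0 ∈ S) (hS : germDim S ≠ 0) :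
    ∃ i, ∀ l, (X i : MvPowerSeries ι ℂ) ^ l ∉ formalIdeal S := by
  by_contra! hc
  choose l hl using hc
  obtain ⟨B⟩ := exists_standardBasis_taylorGens S
  have hS0 : ∀ᶠ z in 𝓝 (0 : ι → ℂ), z ∈ S → z = 0 := by
    filter_upwards [B.eventually_ev_eq_zero, polydisc_mem_nhds (rad_pos B.τ₀)] with z hz hzτ hzS
    funext i
    have hX : (X i : MvPowerSeries ι ℂ) ^ l i = monomial (Finsupp.single i (l i)) 1 := by
      rw [X_pow_eq]
    have h1 := hz hzS _ le_rfl hzτ _ (hl i) (by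
      rw [hX, nrm_monomial]
      exact ENNReal.mul_lt_top enorm_lt_top ENNReal.coe_lt_top)
    rw [hX, ev_monomial, mon_single, one_mul] at h1
    exact eq_zero_of_pow_eq_zero h1
  -- As `S` is `{0}` near the origin, a germ vanishes on `S` if and only if it vanishes at `0`.
  have heq : vanishingIdeal ℂ S = germMax (ι → ℂ) := by
    ext g
    obtain ⟨f, hf, h⟩ := g.2
    rw [mem_vanishingIdeal h, mem_germMax h]
    refine ⟨fun h => h.self_of_nhds h0, fun h => hS0.mono fun z hz hzS => ?_⟩
    rw [hz hzS, h]
  have hmax : (germMax (ι → ℂ)).IsMaximal :=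
    isMaximal_of_isUnit germMax_ne_top fun _ => isUnit_of_notMem_germMax
  refine hS ?_
  rw [germDim, heq]
  exact ringKrullDim_eq_zero_of_isField
    (Ideal.Quotient.maximal_ideal_iff_isField_quotient _ |>.1 hmax)

/-- Convergent power series with a common domain of convergence that generate an ideal of positive
dimension in the ring of *formal* power series vanish on a complex variety of positive dimension. -/
theorem exists_variety_of_X_pow_notMem {S : Set (MvPowerSeries ι ℂ)} {τ₁ : ℕ}
    (hS : ∀ F ∈ S, nrm (rad τ₁) F < ∞)
    (hi : ∃ i, ∀ l, (X i : MvPowerSeries ι ℂ) ^ l ∉ Ideal.span S) :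
    ∃ Γ : Set (ι → ℂ), IsAnalyticVarietyAt ℂ Γ ∧ 0 < germDim Γ ∧
      ∀ z ∈ Γ, z ∈ polydisc (rad τ₁) ∧ ∀ F ∈ S, ev z F = 0 := by
  obtain ⟨B⟩ := exists_standardBasis (S := S) fun F hF => ⟨τ₁, hS F hF⟩
  set τ := max B.τ₀ τ₁ with hτ
  set Γ : Set (ι → ℂ) := {z | z ∈ polydisc (rad τ) ∧ ∀ a ∈ B.A, ev z (B.g a) = 0} with hΓ
  have h1 : rad τ ≤ (rad τ₁ : ι → ℝ≥0) := rad_antitone (le_max_right _ _)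
  have hne : Ideal.span S ≠ ⊤ := fun h => by
    obtain ⟨i, hi⟩ := hi
    exact hi 0 (h ▸ Submodule.mem_top)
  have hle : Submodule.span (MvPolynomial ι ℂ) S ≤
      (Ideal.span S).restrictScalars (MvPolynomial ι ℂ) :=
    Submodule.span_le.2 fun x hx => Ideal.subset_span hx
  have hΓ0 : (0 : ι → ℂ) ∈ Γ := by
    refine ⟨fun i => by simp, fun a ha => ?_⟩
    rw [ev_zero_point]
    by_contra h
    exact hne (Ideal.eq_top_of_isUnit_mem _ (hle (B.mem_span a ha))
      (isUnit_iff_constantCoeff.2 (isUnit_iff_ne_zero.2 h)))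
  refine ⟨Γ, ⟨hΓ0, ?_⟩, germDim_pos ?_, fun z hz => ⟨polydisc_mono h1 hz.1, fun F hF => ?_⟩⟩
  · have hW : ∀ᶠ z in 𝓝 (0 : ι → ℂ), z ∈ polydisc (rad τ) ∧
        ∀ a ∈ B.A, AnalyticAt ℂ (fun z => ev z (B.g a)) z :=
      (show ∀ᶠ z in 𝓝 (0 : ι → ℂ), z ∈ polydisc (rad τ) from polydisc_mem_nhds (rad_pos τ)).and
        ((Finset.eventually_all B.A).2 fun a ha =>
          (analyticAt_ev (B.nrm_g _ le_rfl a ha)).eventually_analyticAt)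
    obtain ⟨W, hWs, hWo, hW0⟩ := eventually_nhds_iff.1 hW
    refine ⟨W, hWo, hW0, B.A.card, fun j z => ev z (B.g (B.A.equivFin.symm j)),
      fun j z hz => (hWs z hz).2 _ (B.A.equivFin.symm j).2, fun z hz => ⟨fun h j =>
        h.2 _ (B.A.equivFin.symm j).2, fun h => ⟨(hWs z hz).1, fun a ha => ?_⟩⟩⟩
    simpa using h (B.A.equivFin ⟨a, ha⟩)
  · intro hev
    obtain ⟨τ₂, hτ₂⟩ := exists_polydisc_subset hev
    obtain ⟨z, hz, hz0, hzg⟩ := B.exists_ne_zero hi (τ := max τ τ₂)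
      ((le_max_left _ _).trans (le_max_left _ _))
    exact hτ₂ _ (le_max_right _ _) hz
      ⟨⟨polydisc_mono (rad_antitone (le_max_left _ _)) hz, hzg⟩, hz0⟩
  · exact B.ev_eq_zero (le_max_left _ _) (Ideal.subset_span hF)
      ((nrm_mono h1 F).trans_lt (hS F hF)) hz.1 hz.2

end Germs

/-! ### Finite extensions of the ring of power series in one variable -/

section Expansion

open PowerSeries

variable {V : Type*} [CommRing V] [Algebra ℂ V]

/-- A local ring with residue field `ℂ` whose maximal ideal is generated by a nonzerodivisor `ϖ`
maps to the ring of formal power series in one variable, by `ϖ`-adic expansion. -/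
lemma exists_expansion (res : V →ₐ[ℂ] ℂ) {ϖ : V} (hϖ : ∀ a, ϖ * a = 0 → a = 0)
    (hker : ∀ v, res v = 0 → ϖ ∣ v) :
    ∃ φ : V →ₐ[ℂ] ℂ⟦X⟧, ∀ v, φ v = 0 → ∀ n, ϖ ^ n ∣ v := by
  have hcancel : ∀ a b, ϖ * a = ϖ * b → a = b := fun a b h =>
    sub_eq_zero.1 (hϖ _ (by rw [mul_sub, h, sub_self]))
  have hex : ∀ v, ∃ w, v = algebraMap ℂ V (res v) + ϖ * w := fun v => by
    obtain ⟨w, hw⟩ := hker (v - algebraMap ℂ V (res v)) (by simp)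
    exact ⟨w, by rw [← hw]; ring⟩
  -- The quotient `q v` in `v = res v + ϖ * q v` is unique, hence linear in `v`; the coefficients of
  -- the expansion of `v` are the residues of the iterates `q ^ n v`.
  choose q₀ hq₀ using hex
  let q : V →ₗ[ℂ] V :=
    { toFun := q₀
      map_add' := fun v w => hcancel _ _ (by
        have h1 := hq₀ v
        have h2 := hq₀ w
        have h3 := hq₀ (v + w)
        rw [map_add, map_add] at h3
        linear_combination h1 + h2 - h3)
      map_smul' := fun c v => hcancel _ _ (by
        have h1 := hq₀ v
        have h3 := hq₀ (c • v)
        rw [map_smul, smul_eq_mul, map_mul, Algebra.smul_def] at h3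
        rw [RingHom.id_apply, Algebra.smul_def c v, Algebra.smul_def c (q₀ v)]
        linear_combination algebraMap ℂ V c * h1 - h3) }
  have hq : ∀ v, v = algebraMap ℂ V (res v) + ϖ * q v := hq₀
  have hqmul : ∀ v w, q (v * w) = res v • q w + q v * w := fun v w => hcancel _ _ (by
    have h1 := hq v
    have h2 := hq w
    have h3 := hq (v * w)
    rw [map_mul, map_mul] at h3
    rw [Algebra.smul_def]
    linear_combination w * h1 + algebraMap ℂ V (res v) * h2 - h3)
  let φ₀ : V →ₗ[ℂ] ℂ⟦X⟧ :=
    { toFun := fun v => PowerSeries.mk fun n => res ((q ^ n) v)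
      map_add' := fun v w => by ext n; simp
      map_smul' := fun c v => by ext n; simp }
  have hφ0 : ∀ v, coeff 0 (φ₀ v) = res v := fun v => by simp [φ₀]
  have hφs : ∀ v n, coeff (n + 1) (φ₀ v) = coeff n (φ₀ (q v)) := fun v n => by
    simp [φ₀, pow_succ]
  have hφ : ∀ v, φ₀ v = C (res v) + X * φ₀ (q v) := fun v => by
    ext n
    cases n with
    | zero => simp [← hφ0 v]
    | succ n => rw [hφs, map_add, coeff_succ_X_mul, coeff_C]; simp
  have hmul : ∀ n v w, coeff n (φ₀ (v * w)) = coeff n (φ₀ v * φ₀ w) := by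
    intro n
    induction n with
    | zero =>
      intro v w
      rw [hφ0, map_mul, coeff_zero_eq_constantCoeff_apply, map_mul,
        ← coeff_zero_eq_constantCoeff_apply, ← coeff_zero_eq_constantCoeff_apply, hφ0, hφ0]
    | succ n ih =>
      intro v w
      rw [hφs, hqmul, map_add, map_add, map_smul, ih, hφ v, add_mul, map_add, mul_assoc,
        coeff_succ_X_mul, coeff_C_mul, hφs, map_smul, smul_eq_mul]
  have hone : φ₀ 1 = 1 := by
    have hq1 : q 1 = 0 := by
      have := hqmul 1 1
      rw [mul_one, map_one res, one_smul, mul_one] at this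
      simpa using this
    rw [hφ, hq1]
    simp
  refine ⟨AlgHom.ofLinearMap φ₀ hone fun v w => PowerSeries.ext fun n => hmul n v w,
    fun v hv n => ?_⟩
  rw [AlgHom.ofLinearMap_apply] at hv
  induction n generalizing v with
  | zero => simp
  | succ n ih =>
    have h0 : res v = 0 := by rw [← hφ0, hv, map_zero]
    have h1 : φ₀ (q v) = 0 := by
      ext n
      rw [← hφs, hv, map_zero, map_zero]
    rw [hq v, h0, map_zero, zero_add, pow_succ']
    exact mul_dvd_mul_left _ (ih _ h1)

end Expansion

section Normalization

open PowerSeries IsLocalRing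

section Residue

lemma algebraMap_mem_of_isMaximal {B : Type*} [CommRing B] [Algebra ℂ⟦X⟧ B]
    [Algebra.IsIntegral ℂ⟦X⟧ B] {M : Ideal B} (hM : M.IsMaximal) {F : ℂ⟦X⟧}
    (hF : constantCoeff F = 0) : algebraMap ℂ⟦X⟧ B F ∈ M := by
  have hcomap : M.comap (algebraMap ℂ⟦X⟧ B) = maximalIdeal ℂ⟦X⟧ :=
    eq_maximalIdeal (Ideal.isMaximal_comap_of_isIntegral_of_isMaximal M)
  rw [← Ideal.mem_comap, hcomap, mem_maximalIdeal, mem_nonunits_iff, isUnit_iff_constantCoeff, hF]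
  exact not_isUnit_zero

variable {B : Type*} [CommRing B] [Algebra ℂ B] [Algebra ℂ⟦X⟧ B] [IsScalarTower ℂ ℂ⟦X⟧ B]
  [Algebra.IsIntegral ℂ⟦X⟧ B]

/-- The residue fields of an integral extension of `ℂ⟦X⟧` are `ℂ`. -/
lemma exists_residue {M : Ideal B} (hM : M.IsMaximal) :
    ∃ res : B →ₐ[ℂ] ℂ, ∀ b, res b = 0 ↔ b ∈ M := by
  let : Field (B ⧸ M) := Ideal.Quotient.field M
  have hres : Algebra.IsIntegral ℂ (B ⧸ M) := ⟨fun x => by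
    obtain ⟨b, rfl⟩ := Ideal.Quotient.mk_surjective x
    obtain ⟨p, hp, hpb⟩ := (inferInstance : Algebra.IsIntegral ℂ⟦X⟧ B).isIntegral b
    refine ⟨p.map constantCoeff, hp.map _, ?_⟩
    have h1 : (algebraMap ℂ (B ⧸ M)).comp constantCoeff =
        (Ideal.Quotient.mk M).comp (algebraMap ℂ⟦X⟧ B) := by
      ext F
      have h2 := algebraMap_mem_of_isMaximal hM (F := F - C (constantCoeff F)) (by simp)
      rw [map_sub, ← Ideal.Quotient.mk_eq_mk_iff_sub_mem] at h2
      rw [RingHom.comp_apply, RingHom.comp_apply, h2, ← Ideal.Quotient.mk_algebraMap,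
        IsScalarTower.algebraMap_apply ℂ ℂ⟦X⟧ B]
      rfl
    rw [Polynomial.eval₂_map, h1, ← Polynomial.hom_eval₂, hpb, map_zero]⟩
  let e : ℂ ≃ₐ[ℂ] (B ⧸ M) := AlgEquiv.ofBijective (Algebra.ofId ℂ (B ⧸ M))
    IsAlgClosed.algebraMap_bijective_of_isIntegral
  refine ⟨e.symm.toAlgHom.comp (Ideal.Quotient.mkₐ ℂ M), fun b => ?_⟩
  rw [← Ideal.Quotient.eq_zero_iff_mem]
  exact map_eq_zero_iff e.symm e.symm.injective

/-- The localization at a maximal ideal is a discrete valuation ring with residue field `ℂ`, and the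
image of `X` is not divisible by all powers of a uniformizer. -/
lemma exists_algHom_of_isDedekindDomain [IsDedekindDomain B]
    (hinj : Function.Injective (algebraMap ℂ⟦X⟧ B)) :
    ∃ φ : B →ₐ[ℂ] ℂ⟦X⟧, φ (algebraMap ℂ⟦X⟧ B X) ≠ 0 := by
  obtain ⟨M, hM⟩ := Ideal.exists_maximal B
  have hX : algebraMap ℂ⟦X⟧ B X ≠ 0 := fun h => X_ne_zero ((map_eq_zero_iff _ hinj).1 h)
  have hMbot : M ≠ ⊥ := fun h => by
    have := algebraMap_mem_of_isMaximal hM (F := X) (by simp)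
    rw [h, Ideal.mem_bot] at this
    exact hX this
  obtain ⟨res₀, hres₀⟩ := exists_residue hM
  let V := Localization.AtPrime M
  have hV : IsDiscreteValuationRing V :=
    IsLocalization.AtPrime.isDiscreteValuationRing_of_dedekind_domain B hMbot V
  let res : V →ₐ[ℂ] ℂ := IsLocalization.liftAlgHom (M := M.primeCompl) (f := res₀)
    fun y => isUnit_iff_ne_zero.2 fun h => y.2 ((hres₀ _).1 h)
  obtain ⟨ϖ, hϖ⟩ := IsDiscreteValuationRing.exists_irreducible V
  have hker : ∀ v, res v = 0 → ϖ ∣ v := fun v hv => by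
    rw [← Ideal.mem_span_singleton, ← hϖ.maximalIdeal_eq, mem_maximalIdeal, mem_nonunits_iff]
    intro hu
    exact (hu.map res).ne_zero hv
  obtain ⟨φ, hφ⟩ := exists_expansion res
    (fun a ha => (mul_eq_zero.1 ha).resolve_left hϖ.ne_zero) hker
  refine ⟨φ.comp (Algebra.algHom ℂ B V), fun h => ?_⟩
  have h2 : FiniteMultiplicity ϖ (algebraMap B V (algebraMap ℂ⟦X⟧ B X)) :=
    FiniteMultiplicity.of_not_isUnit hϖ.not_isUnit fun h =>
      hX ((map_eq_zero_iff _ (IsLocalization.injective V M.primeCompl_le_nonZeroDivisors)).1 h)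
  obtain ⟨n, hn⟩ := h2
  exact hn (hφ _ h _)

end Residue

variable {A : Type*} [CommRing A] [IsDomain A] [Algebra ℂ A] [Algebra ℂ⟦X⟧ A]
  [IsScalarTower ℂ ℂ⟦X⟧ A] [Module.Finite ℂ⟦X⟧ A]

/-- A domain that is finite over the ring of formal power series in one variable `T` maps to such a
ring, in such a way that `T` does not go to `0`: normalize, localize at a maximal ideal and expand
in powers of a uniformizer. -/
lemma exists_algHom_powerSeries (hinj : Function.Injective (algebraMap ℂ⟦X⟧ A)) :
    ∃ φ : A →ₐ[ℂ] ℂ⟦X⟧, φ (algebraMap ℂ⟦X⟧ A X) ≠ 0 := by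
  have : FaithfulSMul ℂ⟦X⟧ A := (faithfulSMul_iff_algebraMap_injective _ _).2 hinj
  let K := FractionRing ℂ⟦X⟧
  let L := FractionRing A
  let : Algebra K L := FractionRing.liftAlgebra ℂ⟦X⟧ L
  have : Module.Finite K L := .of_isLocalization ℂ⟦X⟧ A (nonZeroDivisors ℂ⟦X⟧)
  have hC : CharZero ℂ⟦X⟧ := charZero_of_injective_algebraMap (algebraMap ℂ ℂ⟦X⟧).injective
  have : CharZero K := charZero_of_injective_algebraMap (IsFractionRing.injective ℂ⟦X⟧ K)
  have hB : IsDedekindDomain (integralClosure ℂ⟦X⟧ L) := integralClosure.isDedekindDomain ℂ⟦X⟧ K L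
  have hinjL : Function.Injective (algebraMap ℂ⟦X⟧ L) := FaithfulSMul.algebraMap_injective _ _
  obtain ⟨φ, hφ⟩ := exists_algHom_of_isDedekindDomain (B := integralClosure ℂ⟦X⟧ L)
    fun a b h => hinjL (congrArg Subtype.val h)
  let ψ : A →ₐ[ℂ] integralClosure ℂ⟦X⟧ L :=
    (Algebra.algHom ℂ A L).codRestrict ((integralClosure ℂ⟦X⟧ L).restrictScalars ℂ) fun a =>
      ((inferInstance : Algebra.IsIntegral ℂ⟦X⟧ A).isIntegral a).algebraMap
  exact ⟨φ.comp ψ, hφ⟩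

end Normalization

/-! ### Formal curve selection -/

section Curve

open PowerSeries

lemma mem_span_singleton_pow_smul_top {R M : Type*} [CommRing R] [AddCommGroup M] [Module R M]
    (a : R) (n : ℕ) (x : M) :
    x ∈ (Ideal.span {a} ^ n • ⊤ : Submodule R M) ↔ ∃ y, a ^ n • y = x := by
  rw [Ideal.span_singleton_pow, Submodule.ideal_span_singleton_smul,
    Submodule.mem_smul_pointwise_iff_exists]
  simp

lemma isPrecomplete_pi {R κ : Type*} [CommRing R] (a : R) [IsPrecomplete (Ideal.span {a}) R] :
    IsPrecomplete (Ideal.span {a}) (κ → R) := by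
  refine ⟨fun f hf => ?_⟩
  simp only [SModEq.sub_mem, mem_span_singleton_pow_smul_top] at hf ⊢
  have h : ∀ k, ∃ L : R, ∀ n, f n k ≡ L [SMOD (Ideal.span {a} ^ n • ⊤ : Submodule R R)] := fun k =>
    IsPrecomplete.prec' (fun n => f n k) fun {m n} hmn => by
      obtain ⟨y, hy⟩ := hf hmn
      rw [SModEq.sub_mem, mem_span_singleton_pow_smul_top]
      exact ⟨y k, congrFun hy k⟩
  simp only [SModEq.sub_mem, mem_span_singleton_pow_smul_top] at h
  choose L hL using h
  refine ⟨L, fun n => ?_⟩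
  choose y hy using fun k => hL k n
  exact ⟨y, funext hy⟩

variable {ι : Type*} [Fintype ι]

/-- Modulo the powers `X i ^ l i`, every power series is a polynomial with exponents at most `l`. -/
lemma sub_sum_monomial_mem_span [DecidableEq ι] (l : ι → ℕ) (F : MvPowerSeries ι ℂ) :
    ∃ c : (ι →₀ ℕ) → ℂ,
      F - ∑ b ∈ Finset.Icc 0 (Finsupp.equivFunOnFinite.symm l), MvPowerSeries.monomial b (c b) ∈
        Ideal.span (Set.range fun i => (MvPowerSeries.X i : MvPowerSeries ι ℂ) ^ l i) := by
  set A := Finset.univ.image fun i => Finsupp.single i (l i) with hA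
  have h := monRem_add_sum_monQuo (A := A) F
  refine ⟨fun b => MvPowerSeries.coeff b (monRem A F), ?_⟩
  have h1 : ∑ b ∈ Finset.Icc 0 (Finsupp.equivFunOnFinite.symm l),
      MvPowerSeries.monomial b (MvPowerSeries.coeff b (monRem A F)) = monRem A F := by
    ext γ
    simp only [map_sum, MvPowerSeries.coeff_monomial]
    rw [Finset.sum_ite_eq]
    split_ifs with hγ
    · rfl
    · rw [coeff_monRem, if_pos]
      rw [Finset.mem_Icc, and_iff_right zero_le, Finsupp.le_def] at hγ
      push Not at hγ
      obtain ⟨i, hi⟩ := hγ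
      refine ⟨_, Finset.mem_image_of_mem _ (Finset.mem_univ i), ?_⟩
      rw [Finsupp.single_le_iff]
      exact hi.le
  rw [h1]
  nth_rewrite 1 [h]
  rw [add_sub_cancel_left]
  refine sum_mem fun a ha => Ideal.mul_mem_left _ _ (Ideal.subset_span ?_)
  obtain ⟨i, -, rfl⟩ := Finset.mem_image.1 ha
  exact ⟨i, MvPowerSeries.X_pow_eq i (l i)⟩

/-- A homomorphism of `ℂ`-algebras from formal power series to formal power series in one variable
is a substitution. -/
lemma exists_subst (ψ : MvPowerSeries ι ℂ →ₐ[ℂ] ℂ⟦X⟧) :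
    (∀ i, constantCoeff (ψ (MvPowerSeries.X i)) = 0) ∧
      ∀ F, ψ F = MvPowerSeries.subst (fun i => ψ (MvPowerSeries.X i)) F := by
  -- If `c` were the constant coefficient of the image of `X i` and `c ≠ 0`, the unit `X i - c` would
  -- have an image without constant coefficient.
  have h0 : ∀ i, constantCoeff (ψ (MvPowerSeries.X i)) = 0 := fun i => by
    by_contra h
    set c := constantCoeff (ψ (MvPowerSeries.X i)) with hc
    have h1 : IsUnit (MvPowerSeries.X i - algebraMap ℂ (MvPowerSeries ι ℂ) c) := by
      rw [MvPowerSeries.isUnit_iff_constantCoeff, map_sub, MvPowerSeries.constantCoeff_X, zero_sub]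
      exact (isUnit_iff_ne_zero.2 (by simpa [MvPowerSeries.algebraMap_apply] using h)).neg
    have h2 := (h1.map ψ).map (constantCoeff (R := ℂ))
    rw [map_sub, AlgHom.commutes, map_sub, ← hc] at h2
    simp at h2
  classical
  refine ⟨h0, fun F => ?_⟩
  set μ := fun i => ψ (MvPowerSeries.X i) with hμ
  have hs : MvPowerSeries.HasSubst μ := MvPowerSeries.hasSubst_of_constantCoeff_zero h0
  rw [← MvPowerSeries.coe_substAlgHom hs, ← sub_eq_zero]
  set θ : MvPowerSeries ι ℂ →ₐ[ℂ] ℂ⟦X⟧ := MvPowerSeries.substAlgHom hs with hθ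
  have hX : ∀ i, θ (MvPowerSeries.X i) = μ i := fun i => MvPowerSeries.substAlgHom_X hs i
  have hpoly : ∀ P : MvPolynomial ι ℂ, ψ P = θ P := by
    have : ψ.comp (MvPolynomial.coeToMvPowerSeries.algHom ℂ) =
        θ.comp (MvPolynomial.coeToMvPowerSeries.algHom ℂ) :=
      MvPolynomial.algHom_ext fun i => by simp [hX, hμ]
    intro P
    simpa using DFunLike.congr_fun this P
  -- Continuity is automatic: both homomorphisms map `X i ^ n` to multiples of `X ^ n`.
  have hdvd : ∀ n, X ^ n ∣ ψ F - θ F := fun n => by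
    obtain ⟨c, h⟩ := sub_sum_monomial_mem_span (fun _ => n) F
    set s : Finset (ι →₀ ℕ) := Finset.Icc 0 (Finsupp.equivFunOnFinite.symm fun _ => n)
    have hle : ∀ χ : MvPowerSeries ι ℂ →ₐ[ℂ] ℂ⟦X⟧, (∀ i, χ (MvPowerSeries.X i) = μ i) →
        X ^ n ∣ χ F - χ (∑ b ∈ s, MvPowerSeries.monomial b (c b)) := fun χ hχ => by
      rw [← map_sub, ← Ideal.mem_span_singleton, ← Ideal.mem_comap]
      refine Ideal.span_le.2 ?_ h
      rintro _ ⟨i, rfl⟩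
      rw [SetLike.mem_coe, Ideal.mem_comap, map_pow, hχ, Ideal.mem_span_singleton]
      exact pow_dvd_pow_of_dvd (X_dvd_iff.2 (h0 i)) n
    have heq : ψ (∑ b ∈ s, MvPowerSeries.monomial b (c b)) =
        θ (∑ b ∈ s, MvPowerSeries.monomial b (c b)) := by
      have := hpoly (∑ b ∈ s, MvPolynomial.monomial b (c b))
      rw [← MvPolynomial.coeToMvPowerSeries.ringHom_apply, map_sum] at this
      simpa using this
    have := (hle ψ fun _ => rfl).sub (hle θ hX)
    rwa [heq, sub_sub_sub_cancel_right] at this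
  ext n
  exact X_pow_dvd_iff.1 (hdvd (n + 1)) n (Nat.lt_succ_self n)

/-- The quotient of the ring of formal power series by a prime ideal `P` is finite over the power
series in one variable `X i₀`, if all variables are nilpotent modulo `P` and `X i₀`. -/
lemma finite_quotient {P : Ideal (MvPowerSeries ι ℂ)} (hP : P.IsPrime) {i₀ : ι} {l : ι → ℕ}
    (hl : ∀ j, MvPowerSeries.X j ^ l j ∈ P ⊔ Ideal.span {MvPowerSeries.X i₀})
    [Algebra ℂ⟦X⟧ (MvPowerSeries ι ℂ ⧸ P)] [IsScalarTower ℂ ℂ⟦X⟧ (MvPowerSeries ι ℂ ⧸ P)]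
    (halg : algebraMap ℂ⟦X⟧ (MvPowerSeries ι ℂ ⧸ P) X = Ideal.Quotient.mk P (MvPowerSeries.X i₀)) :
    Module.Finite ℂ⟦X⟧ (MvPowerSeries ι ℂ ⧸ P) := by
  classical
  set s : Finset (ι →₀ ℕ) := Finset.Icc 0 (Finsupp.equivFunOnFinite.symm l) with hs
  let f : (s → ℂ⟦X⟧) →ₗ[ℂ⟦X⟧] (MvPowerSeries ι ℂ ⧸ P) :=
    Fintype.linearCombination ℂ⟦X⟧ fun b : s => Ideal.Quotient.mk P (MvPowerSeries.monomial b 1)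
  have : IsPrecomplete (Ideal.span {(X : ℂ⟦X⟧)}) (s → ℂ⟦X⟧) := isPrecomplete_pi X
  have hX : ¬IsUnit (algebraMap ℂ⟦X⟧ (MvPowerSeries ι ℂ ⧸ P) X) := fun hu => by
    rw [halg] at hu
    obtain ⟨G, hG⟩ := hu.exists_right_inv
    obtain ⟨G, rfl⟩ := Ideal.Quotient.mk_surjective G
    rw [← map_mul, ← map_one (Ideal.Quotient.mk P), Ideal.Quotient.mk_eq_mk_iff_sub_mem] at hG
    refine hP.ne_top (Ideal.eq_top_of_isUnit_mem _ hG ?_)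
    rw [MvPowerSeries.isUnit_iff_constantCoeff]
    simp
  -- Generators modulo `X` generate a separated module over the complete ring `ℂ⟦X⟧`.
  have : IsHausdorff (Ideal.span {(X : ℂ⟦X⟧)}) (MvPowerSeries ι ℂ ⧸ P) := ⟨fun x hx => by
    by_contra hne
    obtain ⟨n, hn⟩ := FiniteMultiplicity.of_not_isUnit hX hne
    have h := hx (n + 1)
    rw [SModEq.zero, mem_span_singleton_pow_smul_top] at h
    obtain ⟨y, rfl⟩ := h
    exact hn ⟨y, by rw [Algebra.smul_def, map_pow]⟩⟩
  refine Module.Finite.of_surjective f (surjective_of_mkQ_comp_surjective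
    (I := Ideal.span {(X : ℂ⟦X⟧)}) fun y => ?_)
  obtain ⟨y, rfl⟩ := Submodule.mkQ_surjective _ y
  obtain ⟨F, rfl⟩ := Ideal.Quotient.mk_surjective y
  obtain ⟨c, hc⟩ := sub_sum_monomial_mem_span l F
  have hle : Ideal.span (Set.range fun i => (MvPowerSeries.X i : MvPowerSeries ι ℂ) ^ l i) ≤
      P ⊔ Ideal.span {MvPowerSeries.X i₀} := Ideal.span_le.2 (by rintro _ ⟨j, rfl⟩; exact hl j)
  obtain ⟨p, hp, q, hq, hpq⟩ := Submodule.mem_sup.1 (hle hc)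
  obtain ⟨G, rfl⟩ := Ideal.mem_span_singleton'.1 hq
  refine ⟨fun b => C (c b), ?_⟩
  rw [LinearMap.comp_apply, ← sub_eq_zero, ← map_sub, Submodule.mkQ_apply,
    Submodule.Quotient.mk_eq_zero, ← neg_mem_iff, neg_sub]
  have h1 : f (fun b => C (c b)) =
      Ideal.Quotient.mk P (∑ b ∈ s, MvPowerSeries.monomial b (c b)) := by
    rw [Fintype.linearCombination_apply, map_sum, ← Finset.sum_coe_sort s]
    refine Finset.sum_congr rfl fun b _ => ?_
    have h2 : MvPowerSeries.monomial (b : ι →₀ ℕ) (c b) =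
        algebraMap ℂ (MvPowerSeries ι ℂ) (c b) * MvPowerSeries.monomial (b : ι →₀ ℕ) 1 := by
      rw [← Algebra.smul_def, ← map_smul, smul_eq_mul, mul_one]
    have h3 : algebraMap ℂ⟦X⟧ (MvPowerSeries ι ℂ ⧸ P) (C (c b)) =
        Ideal.Quotient.mk P (algebraMap ℂ (MvPowerSeries ι ℂ) (c b)) :=
      (IsScalarTower.algebraMap_apply ℂ ℂ⟦X⟧ (MvPowerSeries ι ℂ ⧸ P) (c b)).symm
    rw [h2, map_mul, Algebra.smul_def, h3]
  rw [h1, ← map_sub, ← hpq, map_add, Ideal.Quotient.eq_zero_iff_mem.2 hp, zero_add, map_mul, ← halg,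
    mul_comm, ← Algebra.smul_def]
  exact Submodule.smul_mem_smul (Ideal.mem_span_singleton_self _) Submodule.mem_top

/-- **Curve selection** for formal power series: the zero set of an ideal of positive dimension
contains a formal curve. -/
theorem exists_formal_curve {J : Ideal (MvPowerSeries ι ℂ)}
    (hJ : ∃ i, ∀ l, (MvPowerSeries.X i : MvPowerSeries ι ℂ) ^ l ∉ J) :
    ∃ μ : ι → ℂ⟦X⟧, (∀ i, constantCoeff (μ i) = 0) ∧ μ ≠ 0 ∧
      ∀ F ∈ J, MvPowerSeries.subst μ F = (0 : ℂ⟦X⟧) := by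
  classical
  obtain ⟨P, hJP, hmax⟩ := exists_maximal_ge_of_wellFoundedGT
    (fun I : Ideal (MvPowerSeries ι ℂ) => ∃ i, ∀ l, (MvPowerSeries.X i : MvPowerSeries ι ℂ) ^ l ∉ I)
    J hJ
  obtain ⟨i₀, hi₀⟩ := hmax.prop
  have hgt : ∀ a, a ∉ P → ∀ i, ∃ l, MvPowerSeries.X i ^ l ∈ P ⊔ Ideal.span {a} := fun a ha => by
    have h1 : P < P ⊔ Ideal.span {a} := lt_of_le_of_ne le_sup_left fun h => ha (by
      rw [h]
      exact Ideal.mem_sup_right (Ideal.mem_span_singleton_self a))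
    simpa using hmax.not_prop_of_gt h1
  -- By maximality `P` is prime, and all variables are nilpotent modulo `P` and `X i₀`.
  have hP : P.IsPrime := by
    refine ⟨fun h => hi₀ 0 (h ▸ Submodule.mem_top), fun {a b} hab => ?_⟩
    by_contra! h
    obtain ⟨l, hl⟩ := hgt a h.1 i₀
    obtain ⟨l', hl'⟩ := hgt b h.2 i₀
    obtain ⟨p, hp, q, hq, hpq⟩ := Submodule.mem_sup.1 hl
    obtain ⟨p', hp', q', hq', hpq'⟩ := Submodule.mem_sup.1 hl'
    obtain ⟨c, rfl⟩ := Ideal.mem_span_singleton'.1 hq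
    obtain ⟨c', rfl⟩ := Ideal.mem_span_singleton'.1 hq'
    refine hi₀ (l + l') ?_
    have : (MvPowerSeries.X i₀ : MvPowerSeries ι ℂ) ^ (l + l') =
        (p' + c' * b) * p + (c * a) * p' + (c * c') * (a * b) := by
      rw [pow_add, ← hpq, ← hpq']
      ring
    rw [this]
    exact P.add_mem (P.add_mem (P.mul_mem_left _ hp) (P.mul_mem_left _ hp')) (P.mul_mem_left _ hab)
  choose l hl using hgt (MvPowerSeries.X i₀) fun h => hi₀ 1 (by rwa [pow_one])
  let χ : ℂ⟦X⟧ →ₐ[ℂ] (MvPowerSeries ι ℂ ⧸ P) :=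
    (Ideal.Quotient.mkₐ ℂ P).comp (MvPowerSeries.rename (R := ℂ) fun _ : Unit => i₀)
  have hχX : χ X = Ideal.Quotient.mk P (MvPowerSeries.X i₀) :=
    congrArg (Ideal.Quotient.mk P) (MvPowerSeries.rename_X _ ())
  let : Algebra ℂ⟦X⟧ (MvPowerSeries ι ℂ ⧸ P) := χ.toRingHom.toAlgebra
  have : IsScalarTower ℂ ℂ⟦X⟧ (MvPowerSeries ι ℂ ⧸ P) :=
    IsScalarTower.of_algebraMap_eq fun c => (χ.commutes c).symm
  have hfin := finite_quotient hP hl hχX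
  have hinj : Function.Injective (algebraMap ℂ⟦X⟧ (MvPowerSeries ι ℂ ⧸ P)) := by
    rw [injective_iff_map_eq_zero]
    intro F hF
    by_contra hne
    obtain ⟨n, hn⟩ := IsDiscreteValuationRing.associated_pow_irreducible hne X_prime.irreducible
    have h1 := hn.map (algebraMap ℂ⟦X⟧ (MvPowerSeries ι ℂ ⧸ P))
    rw [hF] at h1
    have h2 := (associated_zero_iff_eq_zero _).1 h1.symm
    rw [map_pow] at h2
    have h3 : Ideal.Quotient.mk P (MvPowerSeries.X i₀ ^ n) = 0 := by
      rw [map_pow, ← hχX]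
      exact h2
    exact hi₀ n (Ideal.Quotient.eq_zero_iff_mem.1 h3)
  obtain ⟨φ, hφ⟩ := exists_algHom_powerSeries hinj
  obtain ⟨h0, hsub⟩ := exists_subst (φ.comp (Ideal.Quotient.mkₐ ℂ P))
  refine ⟨_, h0, fun h => hφ ?_, fun F hF => ?_⟩
  · have := congrFun h i₀
    rwa [AlgHom.comp_apply, Ideal.Quotient.mkₐ_eq_mk, ← hχX] at this
  · rw [← hsub, AlgHom.comp_apply, Ideal.Quotient.mkₐ_eq_mk,
      Ideal.Quotient.eq_zero_iff_mem.2 (hJP hF), map_zero]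

end Curve

/-! ### Reflection -/

section Reflection

open Complex ComplexConjugate

variable {N : ℕ} {X : Set (Fin N → ℂ)} {r : ℝ} {d : ℕ} {σ : Fin d → (Fin N ⊕ Fin N → ℂ) → ℂ}

lemma smul_mem_ball {p : Fin N → ℂ} {c : ℂ} (h : ‖c‖ ^ 2 * ∑ i, ‖p i‖ ^ 2 < r ^ 2) :
    c • p ∈ ball N r := by
  simpa [ball, mul_pow, ← Finset.mul_sum] using h

lemma star_mem_ball {p : Fin N → ℂ} (h : p ∈ ball N r) : star p ∈ ball N r := by
  simpa [ball] using h

/-- The reflection symmetry `σ(p, 0) = 0 → σ(0, p̄) = 0` of functions that are real on the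
antidiagonal. The function `v ↦ σ((1/2 + iv) p, (1/2 - iv) p̄)` is real for real `v`, hence it
takes conjugate values at `-i/2` and `i/2`. -/
lemma IsGenerators.reflection (hσ : IsGenerators X r σ) {p : Fin N → ℂ} (hp : p ∈ ball N r)
    (i : Fin d) (h0 : σ i (Sum.elim p (star 0)) = 0) : σ i (Sum.elim 0 (star p)) = 0 := by
  set S := ∑ i, ‖p i‖ ^ 2 with hS
  have hSr : S < r ^ 2 := hp
  obtain ⟨R, hR1, hRS⟩ : ∃ R : ℝ, 1 < R ∧ R ^ 2 * S < r ^ 2 := by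
    have hc : Tendsto (fun R : ℝ => R ^ 2 * S) (𝓝[>] 1) (𝓝 (1 ^ 2 * S)) :=
      ((Continuous.tendsto (by fun_prop) 1).mono_left nhdsWithin_le_nhds)
    rw [one_pow, one_mul] at hc
    obtain ⟨R, h1, h2⟩ := ((hc.eventually (gt_mem_nhds hSr)).and self_mem_nhdsWithin).exists
    exact ⟨R, h2, h1⟩
  -- On `D` the arguments of `σ` stay in the ball; it contains `0` and `± i/2` because `R > 1`.
  set D : Set ℂ := Metric.ball (I / 2) R ∩ Metric.ball (-I / 2) R with hD
  have hDo : IsOpen D := Metric.isOpen_ball.inter Metric.isOpen_ball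
  have hDc : IsPreconnected D := ((convex_ball _ _).inter (convex_ball _ _)).isPreconnected
  have hn1 : ∀ v : ℂ, ‖1 / 2 + I * v‖ = dist v (I / 2) := fun v => by
    rw [dist_eq_norm, ← one_mul ‖v - I / 2‖, ← norm_I, ← norm_mul]
    congr 1
    linear_combination (1 / 2 : ℂ) * I_mul_I
  have hn2 : ∀ v : ℂ, ‖1 / 2 - I * v‖ = dist v (-I / 2) := fun v => by
    rw [dist_eq_norm, ← one_mul ‖v - -I / 2‖, ← norm_I, ← norm_neg I, ← norm_mul]
    congr 1
    linear_combination (1 / 2 : ℂ) * I_mul_I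
  have hmem : ∀ c : ℂ, ‖c‖ < R → c • p ∈ ball N r ∧ c • star p ∈ ball N r := fun c hc => by
    have h1 : ‖c‖ ^ 2 * S < r ^ 2 := lt_of_le_of_lt (by
      have : 0 ≤ S := Finset.sum_nonneg fun _ _ => by positivity
      gcongr) hRS
    exact ⟨smul_mem_ball h1, smul_mem_ball (by simpa using h1)⟩
  set γ : ℂ → Fin N ⊕ Fin N → ℂ :=
    fun v => Sum.elim ((1 / 2 + I * v) • p) ((1 / 2 - I * v) • star p) with hγ
  have hγD : ∀ v ∈ D, γ v ∈ prodSet (ball N r) (ball N r) := fun v hv =>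
    ⟨(hmem _ (by rw [hn1]; exact hv.1)).1, (hmem _ (by rw [hn2]; exact hv.2)).2⟩
  have hγd : Differentiable ℂ γ := differentiable_pi.2 fun j => by
    rcases j with j | j
    · simp only [hγ, Sum.elim_inl, Pi.smul_apply, smul_eq_mul]
      fun_prop
    · simp only [hγ, Sum.elim_inr, Pi.smul_apply, smul_eq_mul]
      fun_prop
  set k : ℂ → ℂ := fun v => σ i (γ v) with hk
  have hkd : ∀ v ∈ D, DifferentiableAt ℂ k v := fun v hv =>
    ((hσ.holomorphic i _ (hγD v hv)).differentiableAt).comp v (hγd v)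
  have hconj : ∀ v ∈ D, conj v ∈ D := fun v hv => by
    have h1 : dist (conj v) (I / 2) = dist v (-I / 2) := by
      have := dist_conj_conj v (-I / 2)
      rw [← this]
      congr 1
      simp [conj_ofNat]
    have h2 : dist (conj v) (-I / 2) = dist v (I / 2) := by
      have := dist_conj_conj v (I / 2)
      rw [← this]
      congr 1
      simp [conj_ofNat]
    exact ⟨by rw [Metric.mem_ball, h1]; exact hv.2, by rw [Metric.mem_ball, h2]; exact hv.1⟩
  set q : ℂ → ℂ := fun v => k v - conj (k (conj v)) with hq
  have hqd : DifferentiableOn ℂ q D := fun v hv =>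
    ((hkd v hv).sub (differentiableAt_conj_conj_iff.2 (hkd _ (hconj v hv)))).differentiableWithinAt
  have hD0 : (0 : ℂ) ∈ D := by
    constructor <;> simp <;> linarith
  have hfreq : ∃ᶠ v in 𝓝[≠] (0 : ℂ), q v = 0 := by
    have ht : Tendsto (fun t : ℝ => (t : ℂ)) (𝓝[≠] 0) (𝓝[≠] 0) := by
      refine tendsto_nhdsWithin_iff.2 ⟨(continuous_ofReal.tendsto' 0 0 rfl).mono_left
        nhdsWithin_le_nhds, ?_⟩
      filter_upwards [self_mem_nhdsWithin] with t ht
      simpa using ht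
    refine ht.frequently (Eventually.frequently ?_)
    have hev : ∀ᶠ t : ℝ in 𝓝[≠] 0, (t : ℂ) ∈ D :=
      (ht.mono_right nhdsWithin_le_nhds).eventually (hDo.mem_nhds hD0)
    filter_upwards [hev] with t ht
    have h1 : k t = σ i (Sum.elim ((1 / 2 + I * t) • p) (star ((1 / 2 + I * t : ℂ) • p))) := by
      simp only [hk, hγ, star_smul]
      congr 3
      simp [sub_eq_add_neg]
    have h2 := hσ.real i _ (hγD _ ht).1
    rw [hq]
    simp only [conj_ofReal]
    rw [sub_eq_zero, eq_comm, conj_eq_iff_im, h1]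
    exact h2
  have hzero :=
    (hqd.analyticOnNhd hDo).eqOn_zero_of_preconnected_of_frequently_eq_zero hDc hD0 hfreq
  have hI : I / 2 ∈ D := by
    constructor
    · simp; linarith
    · rw [Metric.mem_ball, dist_eq_norm]
      have : I / 2 - -I / 2 = I := by ring
      rw [this, norm_I]
      exact hR1
  have h1 := hzero hI
  have e1 : k (I / 2) = σ i (Sum.elim 0 (star p)) := by
    have a1 : (1 / 2 + I * (I / 2) : ℂ) = 0 := by linear_combination (1 / 2 : ℂ) * I_mul_I
    have a2 : (1 / 2 - I * (I / 2) : ℂ) = 1 := by linear_combination (-1 / 2 : ℂ) * I_mul_I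
    simp only [hk, hγ, a1, a2, zero_smul, one_smul]
  have e2 : k (conj (I / 2)) = σ i (Sum.elim p (star 0)) := by
    have a0 : conj (I / 2) = -I / 2 := by simp [conj_ofNat]
    have a1 : (1 / 2 + I * (-I / 2) : ℂ) = 1 := by linear_combination (-1 / 2 : ℂ) * I_mul_I
    have a2 : (1 / 2 - I * (-I / 2) : ℂ) = 0 := by linear_combination (1 / 2 : ℂ) * I_mul_I
    rw [a0]
    simp only [hk, hγ, a1, a2, zero_smul, one_smul, star_zero]
  simp only [hq, e1, e2, h0, map_zero, sub_zero, Pi.zero_apply] at h1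
  exact h1

lemma zero_mem_ball (hr : 0 < r) : (0 : Fin N → ℂ) ∈ ball N r := by
  simpa [ball] using pow_pos hr 2

lemma isOpen_ball : IsOpen (ball N r) :=
  isOpen_lt (by fun_prop) continuous_const

end Reflection

/-! ### Ideals of products -/

section Products

open MvPowerSeries

section General

variable {ω ι κ : Type*} {u : ι → ω} {v : κ → ω}

lemma exists_slice_eq (h : Function.Bijective (Sum.elim u v)) (s : (ι →₀ ℕ) → MvPowerSeries κ ℂ) :
    ∃ G : MvPowerSeries ω ℂ, ∀ α, slice u v α G = s α := by
  refine ⟨fun γ => coeff ((combEquiv h).symm γ).2 (s ((combEquiv h).symm γ).1), fun α => ?_⟩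
  ext β
  have : (combEquiv h).symm (comb u v α β) = (α, β) := (combEquiv h).symm_apply_apply (α, β)
  change coeff ((combEquiv h).symm (comb u v α β)).2 (s ((combEquiv h).symm (comb u v α β)).1) = _
  rw [this]

/-- Contraction with respect to the variables `v` of a series in the ideal generated by an ideal
`J` of power series in the variables `u` gives a series in `J`. -/
lemma contract_mem_of_mem_map [Finite ι] (h : Function.Bijective (Sum.elim u v))
    (L : MvPowerSeries κ ℂ →ₗ[ℂ] ℂ) {J : Ideal (MvPowerSeries ι ℂ)} {G : MvPowerSeries ω ℂ}
    (hG : G ∈ J.map (rename (R := ℂ) u)) : contract u v L G ∈ J := by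
  suffices H : ∀ H, contract u v L (H * G) ∈ J by simpa using H 1
  refine Submodule.span_induction (p := fun G _ => ∀ H, contract u v L (H * G) ∈ J)
    ?_ ?_ ?_ ?_ hG
  · rintro _ ⟨F, hF, rfl⟩ H
    change contract u v L (H * rename u F) ∈ J
    rw [contract_mul_rename h]
    exact J.mul_mem_left _ hF
  · intro H
    rw [mul_zero, map_zero]
    exact J.zero_mem
  · intro x y _ _ hx hy H
    rw [mul_add, map_add]
    exact J.add_mem (hx H) (hy H)
  · intro a x _ hx H
    rw [smul_eq_mul, ← mul_assoc]
    exact hx _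

lemma partialEval_rename [Fintype ι] [Finite κ] (h : Function.Bijective (Sum.elim u v))
    (F : MvPowerSeries κ ℂ) (z : ι → ℂ) :
    partialEval u v z (rename v F) = F := by
  classical
  ext β
  rw [coeff_partialEval_eq_tsum, tsum_eq_single 0]
  · rw [← coeff_slice, slice_rename_right h, if_pos rfl, mon_zero, mul_one]
  · intro α hα
    rw [← coeff_slice, slice_rename_right h, if_neg hα, map_zero, zero_mul]

variable [Fintype ω] [Fintype ι] [Fintype κ] {ρ : ω → ℝ≥0}

lemma nrm_rename (h : Function.Bijective (Sum.elim u v)) (F : MvPowerSeries κ ℂ) :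
    nrm ρ (rename v F) = nrm (ρ ∘ v) F := by
  classical
  rw [nrm_eq_tsum_slice h, tsum_eq_single 0]
  · rw [slice_rename_right h, if_pos rfl, mon_zero]
    simp
  · intro α hα
    rw [slice_rename_right h, if_neg hα, nrm_zero, zero_mul]

end General

variable {N : ℕ}

lemma bijective_elim_inl_inr {α β : Type*} :
    Function.Bijective (Sum.elim Sum.inl Sum.inr : α ⊕ β → α ⊕ β) := by
  rw [Sum.elim_inl_inr]
  exact Function.bijective_id

lemma bijective_elim_inr_inl {α β : Type*} :
    Function.Bijective (Sum.elim Sum.inr Sum.inl : β ⊕ α → α ⊕ β) :=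
  bijective_elim_swap bijective_elim_inl_inr

lemma elim_mem_polydisc {ρ : Fin N ⊕ Fin N → ℝ≥0} {Z ζ : Fin N → ℂ}
    (hZ : Z ∈ polydisc (ρ ∘ Sum.inl)) (hζ : ζ ∈ polydisc (ρ ∘ Sum.inr)) :
    Sum.elim Z ζ ∈ polydisc ρ := by
  rintro (i | i)
  · exact hZ i
  · exact hζ i

/-- A neighbourhood of the origin in a product contains a polydisc. -/
lemma exists_polydisc_of_eventually {p : (Fin N ⊕ Fin N → ℂ) → Prop}
    (h : ∀ᶠ w in 𝓝 (0 : Fin N ⊕ Fin N → ℂ), p w) :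
    ∃ ρ : Fin N ⊕ Fin N → ℝ≥0, (∀ x, 0 < ρ x) ∧ ∀ w ∈ polydisc ρ, p w := by
  obtain ⟨τ, hτ⟩ := exists_polydisc_subset h
  exact ⟨rad τ, rad_pos τ, hτ τ le_rfl⟩

lemma map_rename_formalIdeal_le (T : Set (Fin N → ℂ)) :
    (formalIdeal T).map (rename (R := ℂ) (Sum.inr : Fin N → Fin N ⊕ Fin N)) ≤
      formalIdeal (prodSet Set.univ T) := by
  rw [formalIdeal_eq_span T, Ideal.map_span, Ideal.span_le]
  rintro _ ⟨F, ⟨⟨τ, hF⟩, hv⟩, rfl⟩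
  obtain ⟨τ₁, hτ₁⟩ := exists_rad_le (ρ := (Sum.elim (rad τ) (rad τ) : Fin N ⊕ Fin N → ℝ≥0))
    (by rintro (i | i) <;> exact rad_pos τ i)
  have h1 : rad τ₁ ≤ (Sum.elim (rad τ) (rad τ) : Fin N ⊕ Fin N → ℝ≥0) := hτ₁ τ₁ le_rfl
  have h2 : nrm (rad τ₁) (rename (R := ℂ) (Sum.inr : Fin N → Fin N ⊕ Fin N) F) < ∞ := by
    refine (nrm_mono h1 _).trans_lt ?_
    rw [nrm_rename bijective_elim_inl_inr, Sum.elim_comp_inr]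
    exact hF
  refine mem_formalIdeal h2 ?_
  have hc : Tendsto (fun w : Fin N ⊕ Fin N → ℂ => w ∘ Sum.inr) (𝓝 0) (𝓝 0) :=
    Continuous.tendsto' (by fun_prop) _ _ rfl
  filter_upwards [hc.eventually hv, polydisc_mem_nhds (rad_pos τ₁)] with w hw hwτ hwT
  have h3 := ev_partialEval (u := Sum.inl) (v := Sum.inr) bijective_elim_inl_inr h2 hwτ
  rw [partialEval_rename bijective_elim_inl_inr] at h3
  exact h3.symm.trans (hw hwT.2)

/-- The coefficients, with respect to the variables `Z`, of a series in `I(ℂ^N × T)` lie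
in `I(T)`. -/
lemma slice_mem_formalIdeal {T : Set (Fin N → ℂ)} {G : MvPowerSeries (Fin N ⊕ Fin N) ℂ}
    (hG : G ∈ formalIdeal (prodSet Set.univ T)) (α : Fin N →₀ ℕ) :
    slice Sum.inl Sum.inr α G ∈ formalIdeal T := by
  rw [formalIdeal_eq_span] at hG
  suffices H : ∀ α, slice Sum.inl Sum.inr α G ∈ formalIdeal T from H α
  refine Submodule.span_induction (p := fun G _ => ∀ α, slice Sum.inl Sum.inr α G ∈ formalIdeal T)
    ?_ ?_ ?_ ?_ hG
  · rintro G ⟨⟨τ, hτ⟩, hv⟩ α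
    have h1 :=
      nrm_slice_lt_top (u := Sum.inl) (v := Sum.inr) bijective_elim_inl_inr (rad_pos τ) hτ α
    obtain ⟨τ₁, hτ₁⟩ := exists_rad_le (ρ := (rad τ : Fin N ⊕ Fin N → ℝ≥0) ∘ Sum.inr)
      fun i => rad_pos τ _
    obtain ⟨τ₂, hτ₂⟩ := exists_rad_le (ρ := (rad τ : Fin N ⊕ Fin N → ℝ≥0) ∘ Sum.inl)
      fun i => rad_pos τ _
    refine mem_formalIdeal ((nrm_mono (hτ₁ τ₁ le_rfl) _).trans_lt h1) ?_
    obtain ⟨ρ, hρ, hρv⟩ := exists_polydisc_of_eventually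
      (hv.and (polydisc_mem_nhds (rad_pos (ι := Fin N ⊕ Fin N) τ)))
    filter_upwards [polydisc_mem_nhds (ρ := ρ ∘ Sum.inr) fun i => hρ _,
      polydisc_mem_nhds (ρ := (rad τ : Fin N ⊕ Fin N → ℝ≥0) ∘ Sum.inr) fun i => rad_pos τ _]
      with ζ hζ hζτ hζT
    -- `G(·, ζ)` vanishes identically
    have h2 : partialEval Sum.inr Sum.inl ζ G = 0 := by
      refine eq_zero_of_eventually_ev_eq_zero (τ₀ := τ₂) ((nrm_mono (hτ₂ τ₂ le_rfl) _).trans_lt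
        ((nrm_partialEval_le bijective_elim_inr_inl hτ (rad_pos τ) hζτ).trans_lt hτ)) ?_
      filter_upwards [polydisc_mem_nhds (ρ := ρ ∘ Sum.inl) fun i => hρ _] with Z hZ
      have hw := hρv _ (elim_mem_polydisc hZ hζ)
      have h3 := ev_partialEval (u := Sum.inr) (v := Sum.inl) bijective_elim_inr_inl hτ hw.2
      rw [Sum.elim_comp_inl, Sum.elim_comp_inr] at h3
      rw [h3]
      exact hw.1 ⟨Set.mem_univ _, hζT⟩
    have h4 := coeff_partialEval (u := Sum.inr) (v := Sum.inl) ζ G α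
    rw [← h4, h2, map_zero]
  · intro α
    rw [map_zero]
    exact Ideal.zero_mem _
  · intro x y _ _ hx hy α
    rw [map_add]
    exact Ideal.add_mem _ (hx α) (hy α)
  · intro a x _ hx α
    exact slice_mul_mem bijective_elim_inl_inr hx a α

/-- The coefficients of the remainder are bounded functionals. -/
lemma enorm_coeff_R_le {S : Set (MvPowerSeries (Fin N) ℂ)} (B : StandardBasis S) {τ : ℕ}
    (hτ : B.τ₀ ≤ τ) (α : Fin N →₀ ℕ) (F : MvPowerSeries (Fin N) ℂ) :
    ‖((coeff α).comp B.R) F‖ₑ ≤ 2 * ((mon (rad τ) α : ℝ≥0) : ℝ≥0∞)⁻¹ * nrm (rad τ) F := by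
  have h0 : ((mon (rad τ) α : ℝ≥0) : ℝ≥0∞) ≠ 0 := by
    exact_mod_cast (mon_rad_pos τ α).ne'
  have h1 := (le_nrm (ρ := rad τ) (F := B.R F) α).trans (B.nrm_R τ hτ F)
  calc ‖coeff α (B.R F)‖ₑ
      = ‖coeff α (B.R F)‖ₑ * (mon (rad τ) α : ℝ≥0) * ((mon (rad τ) α : ℝ≥0) : ℝ≥0∞)⁻¹ := by
        rw [mul_assoc, ENNReal.mul_inv_cancel h0 ENNReal.coe_ne_top, mul_one]
    _ ≤ 2 * nrm (rad τ) F * ((mon (rad τ) α : ℝ≥0) : ℝ≥0∞)⁻¹ := by gcongr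
    _ = _ := by ring

lemma two_mul_inv_mon_rad_ne_top (τ : ℕ) (α : Fin N →₀ ℕ) :
    2 * ((mon (rad τ) α : ℝ≥0) : ℝ≥0∞)⁻¹ ≠ ∞ := by
  refine ENNReal.mul_ne_top (by simp) (ENNReal.inv_ne_top.2 ?_)
  exact_mod_cast (mon_rad_pos τ α).ne'

end Products

/-! ### The equivalences -/

section Equivalences

open MvPowerSeries

variable {N : ℕ} {X : Set (Fin N → ℂ)} {r : ℝ} {d : ℕ} {σ : Fin d → (Fin N ⊕ Fin N → ℂ) → ℂ}

lemma IsGenerators.zero_mem_segre (hσ : IsGenerators X r σ) {p : Fin N → ℂ}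
    (hp : p ∈ segre r σ 0) : 0 ∈ segre r σ p :=
  ⟨zero_mem_ball hσ.pos, fun i => hσ.reflection hp.1 i (hp.2 i)⟩

/-- Taylor series of the functions `σ i`, convergent on a common polydisc. -/
lemma IsGenerators.exists_taylorSeries (hσ : IsGenerators X r σ) :
    ∃ (G : Fin d → MvPowerSeries (Fin N ⊕ Fin N) ℂ) (ρ : Fin N ⊕ Fin N → ℝ≥0),
      (∀ x, 0 < ρ x) ∧ (∀ i, nrm ρ (G i) < ∞) ∧
      ∀ w ∈ polydisc ρ, w ∈ prodSet (ball N r) (ball N r) ∧ ∀ i, σ i w = ev w (G i) := by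
  have h0 : (0 : Fin N ⊕ Fin N → ℂ) ∈ prodSet (ball N r) (ball N r) :=
    ⟨zero_mem_ball hσ.pos, zero_mem_ball hσ.pos⟩
  choose G t ht hGt using fun i => Segre.exists_taylorSeries (hσ.holomorphic i 0 h0)
  have ho : IsOpen (prodSet (ball N r) (ball N r)) :=
    (isOpen_ball.preimage (by fun_prop : Continuous fun w : Fin N ⊕ Fin N → ℂ => w ∘ Sum.inl)).inter
      (isOpen_ball.preimage (by fun_prop : Continuous fun w : Fin N ⊕ Fin N → ℂ => w ∘ Sum.inr))
  obtain ⟨τ₀, hτ₀⟩ := exists_polydisc_subset (ho.mem_nhds h0)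
  have hle : ∀ i, t i ≤ max τ₀ (Finset.univ.sup t) := fun i =>
    (Finset.le_sup (Finset.mem_univ i)).trans (le_max_right _ _)
  exact ⟨G, rad (max τ₀ (Finset.univ.sup t)), rad_pos _,
    fun i => (nrm_mono (rad_antitone (hle i)) _).trans_lt (ht i), fun w hw =>
      ⟨hτ₀ _ (le_max_left _ _) hw, fun i => hGt i w (polydisc_mono (rad_antitone (hle i)) hw)⟩⟩

/-- If `X` is not essentially finite, a formal curve in some `E₀^U` is contained in the Segre
varieties `Σ_p`, `p ∈ Σ₀ ∩ U`. -/
lemma IsGenerators.exists_curve_of_not_essentiallyFinite (hσ : IsGenerators X r σ)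
    (h : ¬EssentiallyFinite r σ) :
    ∃ μ : Fin N → PowerSeries ℂ, (∀ j, PowerSeries.constantCoeff (μ j) = 0) ∧ μ ≠ 0 ∧
      ∃ U : Set (Fin N → ℂ), IsOpen U ∧ 0 ∈ U ∧ U ⊆ ball N r ∧
        ∀ p ∈ segre r σ 0 ∩ U, ∀ i, ∃ F : MvPowerSeries (Fin N) ℂ,
          HasTaylorSeries (fun Z => σ i (Sum.elim Z (star p))) F ∧
            MvPowerSeries.subst μ F = (0 : PowerSeries ℂ) := by
  simp only [EssentiallyFinite, not_forall] at h
  obtain ⟨U, hUo, hU0, hUb, hU⟩ := h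
  have h0 : 0 ∈ essVar r σ U := Set.mem_iInter₂.2 fun p hp => hσ.zero_mem_segre hp.1
  obtain ⟨μ, hμ0, hμ, hμJ⟩ := exists_formal_curve (exists_X_pow_notMem_formalIdeal h0 hU)
  refine ⟨μ, hμ0, hμ, U, hUo, hU0, hUb, fun p hp i => ?_⟩
  have han : AnalyticAt ℂ (fun Z => σ i (Sum.elim Z (star p))) 0 := by
    let T : (Fin N → ℂ) →L[ℂ] (Fin N ⊕ Fin N → ℂ) := ContinuousLinearMap.pi fun j =>
      Sum.elim (fun j => ContinuousLinearMap.proj (R := ℂ) (φ := fun _ : Fin N => ℂ) j)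
        (fun _ => 0) j
    let c : Fin N ⊕ Fin N → ℂ := Sum.elim (0 : Fin N → ℂ) (star p)
    have hT : ∀ Z, T Z + c = Sum.elim Z (star p) := fun Z => by
      ext j
      rcases j with j | j
      · exact add_zero _
      · exact zero_add _
    have h1 : AnalyticAt ℂ (fun Z => T Z + c) 0 :=
      (T.analyticAt 0).add analyticAt_const
    have h2 : AnalyticAt ℂ (σ i) (T 0 + c) := by
      rw [hT]
      exact hσ.holomorphic i _ ⟨zero_mem_ball hσ.pos, star_mem_ball (hUb hp.2)⟩
    refine (AnalyticAt.comp (f := fun Z => T Z + c) h2 h1).congr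
      (Eventually.of_forall fun Z => ?_)
    rw [Function.comp_apply, hT]
  obtain ⟨F, τ, hF, hFτ⟩ := Segre.exists_taylorSeries han
  have hev : ∀ᶠ Z in 𝓝 (0 : Fin N → ℂ), σ i (Sum.elim Z (star p)) = ev Z F :=
    mem_of_superset (polydisc_mem_nhds (rad_pos τ)) hFτ
  refine ⟨F, hasTaylorSeries_of_eqOn hF hev, hμJ F (mem_formalIdeal hF ?_)⟩
  filter_upwards [hev] with Z hZ hZE
  rw [← hZ]
  exact (Set.mem_iInter₂.1 hZE p hp).2 i

/-- A formal curve in the Segre varieties `Σ_p`, `p ∈ Σ₀ ∩ U`, gives a complex variety `Γ` of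
positive dimension with `Γ × Σ₀^* ⊆ 𝒳`. -/
lemma IsGenerators.exists_variety_of_curve (hσ : IsGenerators X r σ)
    {μ : Fin N → PowerSeries ℂ} (hμ0 : ∀ j, PowerSeries.constantCoeff (μ j) = 0) (hμ : μ ≠ 0)
    {U : Set (Fin N → ℂ)} (hUo : IsOpen U) (hU0 : 0 ∈ U)
    (h : ∀ p ∈ segre r σ 0 ∩ U, ∀ i, ∃ F : MvPowerSeries (Fin N) ℂ,
      HasTaylorSeries (fun Z => σ i (Sum.elim Z (star p))) F ∧
        MvPowerSeries.subst μ F = (0 : PowerSeries ℂ)) :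
    ∃ Γ : Set (Fin N → ℂ), IsAnalyticVarietyAt ℂ Γ ∧ 0 < germDim Γ ∧
      ∀ᶠ w in 𝓝 (0 : Fin N ⊕ Fin N → ℂ), w ∈ prodSet Γ (conjSet (segre r σ 0)) →
        w ∈ complexification r σ := by
  obtain ⟨G, ρ, hρ, hG, hGσ⟩ := hσ.exists_taylorSeries
  obtain ⟨τ₁, hτ₁⟩ := exists_rad_le (ρ := ρ ∘ Sum.inl) fun i => hρ _
  have hτ₁ := hτ₁ τ₁ le_rfl
  have hfin : ∀ ζ ∈ polydisc (ρ ∘ Sum.inr), ∀ i,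
      nrm (rad τ₁) (partialEval Sum.inr Sum.inl ζ (G i)) < ∞ := fun ζ hζ i =>
    (nrm_mono hτ₁ _).trans_lt ((nrm_partialEval_le bijective_elim_inr_inl (hG i) hρ hζ).trans_lt (hG i))
  have hev : ∀ ζ ∈ polydisc (ρ ∘ Sum.inr), ∀ Z ∈ polydisc (ρ ∘ Sum.inl), ∀ i,
      ev Z (partialEval Sum.inr Sum.inl ζ (G i)) = σ i (Sum.elim Z ζ) := fun ζ hζ Z hZ i => by
    have hw := elim_mem_polydisc hZ hζ
    have h1 := ev_partialEval (u := Sum.inr) (v := Sum.inl) bijective_elim_inr_inl (hG i) hw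
    rw [Sum.elim_comp_inl, Sum.elim_comp_inr] at h1
    rw [h1, (hGσ _ hw).2 i]
  set S : Set (MvPowerSeries (Fin N) ℂ) := {F | ∃ p ∈ segre r σ 0 ∩ U,
    star p ∈ polydisc (ρ ∘ Sum.inr) ∧ ∃ i, F = partialEval Sum.inr Sum.inl (star p) (G i)} with hS
  have hs : MvPowerSeries.HasSubst μ := MvPowerSeries.hasSubst_of_constantCoeff_zero hμ0
  have hker : ∀ F ∈ Ideal.span S, MvPowerSeries.substAlgHom (R := ℂ) hs F = 0 := fun F hF => by
    refine Ideal.span_le (I := RingHom.ker (MvPowerSeries.substAlgHom (R := ℂ) hs)).2 ?_ hF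
    rintro _ ⟨p, hp, hpρ, i, rfl⟩
    obtain ⟨F, hF, hFμ⟩ := h p hp i
    have h1 : HasTaylorSeries (fun Z => σ i (Sum.elim Z (star p)))
        (partialEval Sum.inr Sum.inl (star p) (G i)) :=
      hasTaylorSeries_of_eqOn (hfin _ hpρ i) (mem_of_superset
        (polydisc_mem_nhds (ρ := ρ ∘ Sum.inl) fun i => hρ _) fun Z hZ => (hev _ hpρ Z hZ i).symm)
    rw [SetLike.mem_coe, RingHom.mem_ker, h1.unique hF]
    rwa [MvPowerSeries.coe_substAlgHom]
  have hX : ∃ j, ∀ l, (MvPowerSeries.X j : MvPowerSeries (Fin N) ℂ) ^ l ∉ Ideal.span S := by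
    obtain ⟨j, hj⟩ := Function.ne_iff.1 hμ
    refine ⟨j, fun l hl => hj ?_⟩
    have h1 := hker _ hl
    rw [map_pow, MvPowerSeries.substAlgHom_X] at h1
    exact eq_zero_of_pow_eq_zero h1
  obtain ⟨Γ, hΓ, hΓd, hΓS⟩ := exists_variety_of_X_pow_notMem (τ₁ := τ₁) (S := S)
    (by rintro _ ⟨p, -, hpρ, i, rfl⟩; exact hfin _ hpρ i) hX
  refine ⟨Γ, hΓ, hΓd, ?_⟩
  have hc : Tendsto (fun w : Fin N ⊕ Fin N → ℂ => star (w ∘ Sum.inr)) (𝓝 0) (𝓝 0) :=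
    Continuous.tendsto' (by fun_prop) _ _ (by ext; simp)
  filter_upwards [polydisc_mem_nhds hρ, hc.eventually (hUo.mem_nhds hU0)] with w hw hwU hwΓ
  refine ⟨(hGσ w hw).1, fun i => ?_⟩
  have hζ : w ∘ Sum.inr ∈ polydisc (ρ ∘ Sum.inr) := fun j => hw _
  have h1 := (hΓS _ hwΓ.1).2 (partialEval Sum.inr Sum.inl (w ∘ Sum.inr) (G i))
    ⟨star (w ∘ Sum.inr), ⟨hwΓ.2, hwU⟩, by rwa [star_star], i, by rw [star_star]⟩
  have hZ : w ∘ Sum.inl ∈ polydisc (ρ ∘ Sum.inl) := fun j => hw _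
  rwa [hev _ hζ _ hZ, Sum.elim_comp_inl_inr] at h1

/-- If `Γ × Σ₀^* ⊆ 𝒳` near the origin then `Γ ⊆ E₀^U` near the origin, for small `U`. -/
lemma not_essentiallyFinite_of_variety (hr : 0 < r) {Γ : Set (Fin N → ℂ)} (hΓ : 0 < germDim Γ)
    (h : ∀ᶠ w in 𝓝 (0 : Fin N ⊕ Fin N → ℂ), w ∈ prodSet Γ (conjSet (segre r σ 0)) →
      w ∈ complexification r σ) : ¬EssentiallyFinite r σ := by
  intro hE
  obtain ⟨ρ, hρ, hρh⟩ := exists_polydisc_of_eventually h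
  have hc : Tendsto (fun p : Fin N → ℂ => star p) (𝓝 0) (𝓝 0) :=
    Continuous.tendsto' (by fun_prop) _ _ (star_zero _)
  have hU : ∀ᶠ p in 𝓝 (0 : Fin N → ℂ), p ∈ ball N r ∧ star p ∈ polydisc (ρ ∘ Sum.inr) :=
    (show ∀ᶠ p in 𝓝 (0 : Fin N → ℂ), p ∈ ball N r from
      isOpen_ball.mem_nhds (zero_mem_ball hr)).and
        (hc.eventually (polydisc_mem_nhds (ρ := ρ ∘ Sum.inr) fun i => hρ _))
  obtain ⟨U, hUs, hUo, hU0⟩ := eventually_nhds_iff.1 hU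
  have h1 := hE U hUo hU0 fun p hp => (hUs p hp).1
  refine absurd (germDim_mono (T := essVar r σ U) ?_) (not_le.2 (h1 ▸ hΓ))
  filter_upwards [polydisc_mem_nhds (ρ := ρ ∘ Sum.inl) fun i => hρ _] with Z hZ hZΓ
  refine Set.mem_iInter₂.2 fun p hp => ?_
  have h2 := hρh (Sum.elim Z (star p)) (elim_mem_polydisc hZ (hUs p hp.2).2)
    ⟨hZΓ, by rw [Sum.elim_comp_inr, conjSet, Set.mem_ofPred_eq, star_star]; exact hp.1⟩
  exact ⟨h2.1.1, h2.2⟩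

/-- Passing to remainders modulo `I(Γ)`, a series in `I(𝒳)` is congruent modulo `I(Γ)` to a series
whose coefficients, as functions of `ζ`, vanish on `T`. -/
lemma formalIdeal_le_of_prodSet_subset {Γ T : Set (Fin N → ℂ)} {Y : Set (Fin N ⊕ Fin N → ℂ)}
    (h : ∀ᶠ w in 𝓝 (0 : Fin N ⊕ Fin N → ℂ), w ∈ prodSet Γ T → w ∈ Y) :
    formalIdeal Y ≤ extendIdeal (formalIdeal Γ) ⊔ formalIdeal (prodSet Set.univ T) := by
  rw [formalIdeal_eq_span Y, Ideal.span_le]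
  rintro F ⟨⟨τ₁, hF⟩, hv⟩
  obtain ⟨B⟩ := exists_standardBasis_taylorGens Γ
  obtain ⟨t, ht⟩ := exists_rad_le (ρ := (rad τ₁ : Fin N ⊕ Fin N → ℝ≥0) ∘ Sum.inl)
    fun i => rad_pos τ₁ _
  obtain ⟨τ₂, hτ₂⟩ := exists_rad_le (ρ := (rad τ₁ : Fin N ⊕ Fin N → ℝ≥0) ∘ Sum.inr)
    fun i => rad_pos τ₁ _
  set τ := max t B.τ₀ with hτ
  set ρ : Fin N ⊕ Fin N → ℝ≥0 := Sum.elim (rad τ) ((rad τ₁ : Fin N ⊕ Fin N → ℝ≥0) ∘ Sum.inr)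
    with hρdef
  have hρl : ρ ∘ Sum.inl = rad τ := Sum.elim_comp_inl _ _
  have hρr : ρ ∘ Sum.inr = (rad τ₁ : Fin N ⊕ Fin N → ℝ≥0) ∘ Sum.inr := Sum.elim_comp_inr _ _
  have hρ : ∀ x, 0 < ρ x := by
    rintro (i | i)
    · exact rad_pos τ i
    · exact rad_pos τ₁ _
  have hρτ : ρ ≤ rad τ₁ := by
    rintro (i | i)
    · exact ht τ (le_max_left _ _) i
    · exact le_rfl
  have hFρ : nrm ρ F < ∞ := (nrm_mono hρτ F).trans_lt hF
  obtain ⟨R, hR⟩ := exists_slice_eq (bijective_elim_inr_inl (α := Fin N) (β := Fin N))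
    fun β => B.R (slice Sum.inr Sum.inl β F)
  have h1 : F - R ∈ extendIdeal (formalIdeal Γ) :=
    mem_map_rename_of_slice_mem bijective_elim_inr_inl fun β => by
      rw [map_sub, hR, formalIdeal_eq_span]
      exact B.sub_R_mem _
  have h2 : ∀ α, slice Sum.inl Sum.inr α R ∈ formalIdeal T := fun α => by
    have hc : slice Sum.inl Sum.inr α R = contract Sum.inr Sum.inl ((coeff α).comp B.R) F := by
      ext β
      rw [coeff_slice, comb_comm, ← coeff_slice, hR, coeff_contract]
      rfl
    have hle : ∀ H, ‖((coeff α).comp B.R) H‖ₑ ≤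
        2 * ((mon (rad τ) α : ℝ≥0) : ℝ≥0∞)⁻¹ * nrm (ρ ∘ Sum.inl) H := fun H => by
      rw [hρl]
      exact enorm_coeff_R_le B (le_max_right _ _) α H
    rw [hc]
    refine mem_formalIdeal (τ := τ₂) (((nrm_mono (hρr ▸ hτ₂ τ₂ le_rfl) _).trans
      (nrm_contract_le bijective_elim_inr_inl hle)).trans_lt
        (ENNReal.mul_lt_top (two_mul_inv_mon_rad_ne_top τ α).lt_top hFρ)) ?_
    obtain ⟨ρ', hρ', hρ'v⟩ := exists_polydisc_of_eventually
      ((hv.and h).and (polydisc_mem_nhds hρ))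
    filter_upwards [polydisc_mem_nhds (ρ := ρ' ∘ Sum.inr) fun i => hρ' _,
      polydisc_mem_nhds (ρ := ρ ∘ Sum.inr) fun i => hρ (.inr i)] with ζ hζ hζρ hζT
    rw [ev_contract bijective_elim_inr_inl (two_mul_inv_mon_rad_ne_top τ α) hle hFρ hρ hζρ, LinearMap.comp_apply]
    have h3 : partialEval Sum.inr Sum.inl ζ F ∈ formalIdeal Γ := by
      refine mem_formalIdeal (τ := τ) ?_ ?_
      · rw [← hρl]
        exact (nrm_partialEval_le bijective_elim_inr_inl hFρ hρ hζρ).trans_lt hFρ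
      · filter_upwards [polydisc_mem_nhds (ρ := ρ' ∘ Sum.inl) fun i => hρ' _] with Z hZ hZΓ
        have hw := hρ'v _ (elim_mem_polydisc hZ hζ)
        have h4 := ev_partialEval (u := Sum.inr) (v := Sum.inl) bijective_elim_inr_inl hFρ hw.2
        rw [Sum.elim_comp_inl, Sum.elim_comp_inr] at h4
        rw [h4]
        exact hw.1.1 (hw.1.2 ⟨hZΓ, hζT⟩)
    rw [formalIdeal_eq_span] at h3
    rw [(B.R_eq_zero_iff _).2 h3, map_zero]
  rw [← sub_add_cancel F R]
  exact Ideal.add_mem _ (Ideal.mem_sup_left h1) (Ideal.mem_sup_right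
    (map_rename_formalIdeal_le T (mem_map_rename_of_slice_mem bijective_elim_inl_inr h2)))

/-- Passing to remainders modulo `I(Σ₀^*)`, the coefficients with respect to `ζ` of the Taylor
series of `σ(Z, ζ)` become convergent series in `J`; they define `Γ`. -/
lemma IsGenerators.exists_variety_of_ideal (hσ : IsGenerators X r σ)
    {J : Ideal (MvPowerSeries (Fin N) ℂ)} (hJ : 0 < ringKrullDim (MvPowerSeries (Fin N) ℂ ⧸ J))
    (h : formalIdeal (complexification r σ) ≤
      extendIdeal J ⊔ formalIdeal (prodSet Set.univ (conjSet (segre r σ 0)))) :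
    ∃ Γ : Set (Fin N → ℂ), IsAnalyticVarietyAt ℂ Γ ∧ 0 < germDim Γ ∧
      ∀ᶠ w in 𝓝 (0 : Fin N ⊕ Fin N → ℂ), w ∈ prodSet Γ (conjSet (segre r σ 0)) →
        w ∈ complexification r σ := by
  set T := conjSet (segre r σ 0) with hT
  obtain ⟨G, ρ₀, hρ₀, hG₀, hGσ₀⟩ := hσ.exists_taylorSeries
  obtain ⟨B⟩ := exists_standardBasis_taylorGens T
  obtain ⟨τ₁, hτ₁⟩ := exists_rad_le (ρ := ρ₀ ∘ Sum.inl) fun i => hρ₀ _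
  obtain ⟨t, ht⟩ := exists_rad_le (ρ := ρ₀ ∘ Sum.inr) fun i => hρ₀ _
  set τ₂ := max t B.τ₀ with hτ₂
  have hB : B.τ₀ ≤ τ₂ := le_max_right _ _
  set ρ : Fin N ⊕ Fin N → ℝ≥0 := Sum.elim (rad τ₁) (rad τ₂) with hρdef
  have hρl : ρ ∘ Sum.inl = rad τ₁ := Sum.elim_comp_inl _ _
  have hρr : ρ ∘ Sum.inr = rad τ₂ := Sum.elim_comp_inr _ _
  have hρ : ∀ x, 0 < ρ x := by
    rintro (i | i)
    · exact rad_pos τ₁ i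
    · exact rad_pos τ₂ i
  have hρρ₀ : ρ ≤ ρ₀ := by
    rintro (i | i)
    · exact hτ₁ τ₁ le_rfl i
    · exact ht τ₂ (le_max_left _ _) i
  have hG : ∀ i, nrm ρ (G i) < ∞ := fun i => (nrm_mono hρρ₀ _).trans_lt (hG₀ i)
  have hGσ : ∀ w ∈ polydisc ρ, w ∈ prodSet (ball N r) (ball N r) ∧ ∀ i, σ i w = ev w (G i) :=
    fun w hw => hGσ₀ w (polydisc_mono hρρ₀ hw)
  have hle : ∀ β H, ‖((coeff β).comp B.R) H‖ₑ ≤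
      2 * ((mon (rad τ₂) β : ℝ≥0) : ℝ≥0∞)⁻¹ * nrm (ρ ∘ Sum.inr) H := fun β H => by
    rw [hρr]
    exact enorm_coeff_R_le B hB β H
  have hGX : ∀ i, G i ∈ formalIdeal (complexification r σ) := fun i => by
    obtain ⟨τ₃, hτ₃⟩ := exists_rad_le hρ
    refine mem_formalIdeal ((nrm_mono (hτ₃ τ₃ le_rfl) _).trans_lt (hG i)) ?_
    filter_upwards [polydisc_mem_nhds hρ] with w hw hwX
    rw [← (hGσ w hw).2 i]
    exact hwX.2 i
  have hmem : ∀ i β, contract Sum.inl Sum.inr ((coeff β).comp B.R) (G i) ∈ J := fun i β => by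
    obtain ⟨e, he, f, hf, hef⟩ := Submodule.mem_sup.1 (h (hGX i))
    have h1 : contract Sum.inl Sum.inr ((coeff β).comp B.R) f = 0 := by
      ext α
      have h2 := slice_mem_formalIdeal hf α
      rw [formalIdeal_eq_span] at h2
      rw [coeff_contract, LinearMap.comp_apply, (B.R_eq_zero_iff _).2 h2, map_zero, map_zero]
    rw [← hef, map_add, h1, add_zero]
    exact contract_mem_of_mem_map bijective_elim_inl_inr _ he
  set S : Set (MvPowerSeries (Fin N) ℂ) :=
    {F | ∃ i β, F = contract Sum.inl Sum.inr ((coeff β).comp B.R) (G i)} with hS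
  have hSJ : Ideal.span S ≤ J := Ideal.span_le.2 (by rintro _ ⟨i, β, rfl⟩; exact hmem i β)
  have hSfin : ∀ F ∈ S, nrm (rad τ₁) F < ∞ := by
    rintro _ ⟨i, β, rfl⟩
    rw [← hρl]
    exact (nrm_contract_le bijective_elim_inl_inr (hle β)).trans_lt
      (ENNReal.mul_lt_top (two_mul_inv_mon_rad_ne_top τ₂ β).lt_top (hG i))
  obtain ⟨j, hj⟩ := ringKrullDim_powerSeries_quotient_pos_iff.1 hJ
  obtain ⟨Γ, hΓ, hΓd, hΓS⟩ := exists_variety_of_X_pow_notMem hSfin ⟨j, fun l hl => hj l (hSJ hl)⟩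
  refine ⟨Γ, hΓ, hΓd, ?_⟩
  have hc : Tendsto (fun w : Fin N ⊕ Fin N → ℂ => w ∘ Sum.inr) (𝓝 0) (𝓝 0) :=
    Continuous.tendsto' (by fun_prop) _ _ rfl
  filter_upwards [polydisc_mem_nhds hρ, hc.eventually B.eventually_ev_eq_zero] with w hw hwB hwΓ
  refine ⟨(hGσ w hw).1, fun i => ?_⟩
  have hz : w ∘ Sum.inl ∈ polydisc (ρ ∘ Sum.inl) := fun j => hw _
  have hζ : w ∘ Sum.inr ∈ polydisc (rad τ₂) := by
    rw [← hρr]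
    exact fun j => hw _
  have h1 : B.R (partialEval Sum.inl Sum.inr (w ∘ Sum.inl) (G i)) = 0 := by
    ext β
    have h2 := ev_contract bijective_elim_inl_inr (two_mul_inv_mon_rad_ne_top τ₂ β) (hle β) (hG i) hρ hz
    rw [(hΓS _ hwΓ.1).2 _ ⟨i, β, rfl⟩] at h2
    exact h2.symm
  have h3 : partialEval Sum.inl Sum.inr (w ∘ Sum.inl) (G i) ∈ formalIdeal T := by
    rw [formalIdeal_eq_span]
    exact (B.R_eq_zero_iff _).1 h1
  have h4 : nrm (rad τ₂) (partialEval Sum.inl Sum.inr (w ∘ Sum.inl) (G i)) < ∞ := by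
    rw [← hρr]
    exact (nrm_partialEval_le bijective_elim_inl_inr (hG i) hρ hz).trans_lt (hG i)
  rw [(hGσ w hw).2 i, ← ev_partialEval (u := Sum.inl) (v := Sum.inr) bijective_elim_inl_inr (hG i) hw]
  exact hwB hwΓ.2 τ₂ hB hζ _ h3 h4

end Equivalences

end Segre

end

theorem lemma2p2 (N : ℕ) (X : Set (Fin N → ℂ)) (hX : Segre.IsAnalyticVarietyAt ℝ X)
    (d : ℕ) (r : ℝ) (σ : Fin d → (Fin N ⊕ Fin N → ℂ) → ℂ) (hσ : Segre.IsGenerators X r σ) :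
    List.TFAE [
      ¬ Segre.EssentiallyFinite r σ,
      ∃ Γ : Set (Fin N → ℂ), Segre.IsAnalyticVarietyAt ℂ Γ ∧ 0 < Segre.germDim Γ ∧
        ∀ᶠ w in 𝓝 (0 : Fin N ⊕ Fin N → ℂ),
          w ∈ Segre.prodSet Γ (Segre.conjSet (Segre.segre r σ 0)) →
            w ∈ Segre.complexification r σ,
      ∃ J : Ideal (MvPowerSeries (Fin N) ℂ), 0 < ringKrullDim (MvPowerSeries (Fin N) ℂ ⧸ J) ∧
        Segre.formalIdeal (Segre.complexification r σ) ≤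
          Segre.extendIdeal J ⊔
            Segre.formalIdeal (Segre.prodSet Set.univ (Segre.conjSet (Segre.segre r σ 0))),
      ∃ μ : Fin N → PowerSeries ℂ, (∀ j, PowerSeries.constantCoeff (μ j) = 0) ∧ μ ≠ 0 ∧
        ∃ U : Set (Fin N → ℂ), IsOpen U ∧ 0 ∈ U ∧ U ⊆ Segre.ball N r ∧
          ∀ p ∈ Segre.segre r σ 0 ∩ U, ∀ i, ∃ F : MvPowerSeries (Fin N) ℂ,
            Segre.HasTaylorSeries (fun Z => σ i (Sum.elim Z (star p))) F ∧
              MvPowerSeries.subst μ F = (0 : PowerSeries ℂ)] := by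
  tfae_have 1 → 4 := hσ.exists_curve_of_not_essentiallyFinite
  tfae_have 4 → 2 := fun ⟨μ, hμ0, hμ, U, hUo, hU0, _, h⟩ =>
    hσ.exists_variety_of_curve hμ0 hμ hUo hU0 h
  tfae_have 2 → 1 := fun ⟨Γ, _, hΓ, h⟩ => Segre.not_essentiallyFinite_of_variety hσ.pos hΓ h
  tfae_have 2 → 3 := fun ⟨Γ, hΓ, hd, h⟩ => ⟨Segre.formalIdeal Γ,
    Segre.ringKrullDim_powerSeries_quotient_pos_iff.2
      (Segre.exists_X_pow_notMem_formalIdeal hΓ.1 hd.ne'),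
    Segre.formalIdeal_le_of_prodSet_subset h⟩
  tfae_have 3 → 2 := fun ⟨J, hJ, h⟩ => hσ.exists_variety_of_ideal hJ h
  tfae_finish
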